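/- Let $(N_k,h_k,p_k)$ $(k\in\mathbb N)$ and $(N,h,p)$ be pointed, connected, complete Riemannian manifolds of dimension $n$ (smooth manifolds with metrics of class at least $C^1$). Suppose that $(N_k,h_k,p_k)$ converges to $(N,h,p)$ in the pointed $C^1$ sense, i.e. there are smooth diffeomorphisms $\Phi_k:U_k\to V_k$ between open sets $U_k\subset N$, $V_k\subset N_k$, with $p\in U_k$ and $\Phi_k(p)=p_k$, such that every compact subset of $N$ is contained in $U_k$ for all large $k$, and $\Phi_k^*h_k\to h$ in $C^1$ uniformly on compact subsets of $N$ (in coordinate charts). Functions on $N_k$ are compared with functions on $N$ by means of these $\Phi_k$. Let $f_k\in W^{1,2}_{loc}(N_k)\cap L^\infty_{loc}(N_k)$ and $f\in W^{1,2}_{loc}(N)\cap L^\infty_{loc}(N)$ be such that $f_k\circ\Phi_k\to f$ in $L^\infty(K)$ for every compact $K\subset N$, and $f_k\circ\Phi_k\to f$ weakly in $W^{1,2}_{loc}(N)$. Assume that the $\Delta f_k$ are locally uniformly bounded from above in the weak sense, i.e. for each $A>0$ there is a constant $C_A>0$ such that for every $k$ $$\int_{N_k}\nabla f_k\cdot\nabla\phi\,dq\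 \ge\ -C_A\int_{N_k}\phi\,dq$$ for all nonnegative $\phi\in W^{1,2}_{loc}(N_k)$ with support contained in $\{d_{h_k}(p_k,\cdot)<A\}$; or that they are locally uniformly bounded from below in the weak sense, i.e. for each $A>0$ there is $C_A>0$ such that for every $k$ and all such $\phi$ $$\int_{N_k}\nabla f_k\cdot\nabla\phi\,dq\ \le\ C_A\int_{N_k}\phi\,dq .$$ Then $f_k\to f$ strongly in $W^{1,2}_{loc}$, i.e. for every compact $K\subset N$ $$\int_K |f_k\circ\Phi_k-f|^2\,dq_h\to0\quad\text{and}\quad \int_K|\nabla(f_k\circ\Phi_k)-\nabla f|_h^2\,dq_h\to0,$$ where $\nabla$ in the last integral is the gradient of $h$. Moreover, $$\int_{N_k}|\nabla f_k|^2\,\eta_k\,dq\ \longrightarrow\ \int_N|\nabla f|^2\,\eta\,dq$$ whenever $\eta\in L^\infty(N)$ and $\eta_k\in L^\infty(N_k)$ have the following properties: there is a fixed $A>0$ such that the support of every $\eta_k$ is contained in $\{d_{h_k}(p_k,\cdot)<A\}$, and $\eta_k\to\eta$ in $L^\infty$, i.e. $\|\eta_k\circ\Phi_k-\eta\|_{L^\infty(U_k)}\to0$.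 -/

import Mathlib

open MeasureTheory Filter Topology Bundle Manifold
open scoped ENNReal ContDiff

noncomputable section

section SingleManifold

variable {n : ℕ} {M : Type*} [MetricSpace M] [ChartedSpace (EuclideanSpace ℝ (Fin n)) M]

/-- The tangent vector of `M` at `e.symm y` whose components in the chart `e` are `v`. -/
def chartVec (e : OpenPartialHomeomorph M (EuclideanSpace ℝ (Fin n)))
    (y v : EuclideanSpace ℝ (Fin n)) : TangentSpace (𝓡 n) (e.symm y) :=
  mfderiv (𝓡 n) (𝓡 n) e.symm y v

variable [RiemannianBundle (fun x : M => TangentSpace (𝓡 n) x)]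

/-- The matrix `g_ij` of the Riemannian metric in the chart `e`, at the point with coordinates
`y`. -/
def gramMatrix (e : OpenPartialHomeomorph M (EuclideanSpace ℝ (Fin n)))
    (y : EuclideanSpace ℝ (Fin n)) : Matrix (Fin n) (Fin n) ℝ :=
  Matrix.of fun i j => inner ℝ
    (chartVec e y (EuclideanSpace.single i 1)) (chartVec e y (EuclideanSpace.single j 1))

variable (n M) in
/-- The Riemannian volume measure `dq`. In each chart it is `√(det g_ij)` times Lebesgue measure.
The measures so defined on the chart domains agree on overlaps, and the supremum (in the complete
lattice of measures) glues them: it restricts to each of them on the corresponding chart domain. -/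
def riemannianVolume [MeasurableSpace M] : Measure M :=
  ⨆ e ∈ IsManifold.maximalAtlas (𝓡 n) ∞ M,
    (((volume : Measure (EuclideanSpace ℝ (Fin n))).restrict e.target).withDensity
      fun y => ENNReal.ofReal (√ (gramMatrix e y).det)).map e.symm

/-- The pairing, at the point with coordinates `y` in the chart `e`, of the vector field `X` with
the vector whose components in the chart are `v`. For `X = ∇ f` this is the partial derivative of
`f ∘ e.symm` at `y` in the direction `v`. -/
def chartPairing (e : OpenPartialHomeomorph M (EuclideanSpace ℝ (Fin n)))
    (X : ∀ x : M, TangentSpace (𝓡 n) x) (y v : EuclideanSpace ℝ (Fin n)) : ℝ :=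
  inner ℝ (X (e.symm y)) (chartVec e y v)

/-- The vector field `X` is measurable (up to null sets): its components in every chart are. -/
def IsMeasurableField (X : ∀ x : M, TangentSpace (𝓡 n) x) : Prop :=
  ∀ e ∈ IsManifold.maximalAtlas (𝓡 n) ∞ M, ∀ v : EuclideanSpace ℝ (Fin n),
    AEStronglyMeasurable (fun y => chartPairing e X y v) (volume.restrict e.target)

/-- `X` is the weak gradient `∇ f` of `f`: in every chart, `f` and the components of its
differential `⟨X, ·⟩` are locally integrable, and the latter are the distributional partial
derivatives of the former. -/
structure HasWeakGradient (f : M → ℝ) (X : ∀ x : M, TangentSpace (𝓡 n) x) : Prop where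
  locallyIntegrable : ∀ e ∈ IsManifold.maximalAtlas (𝓡 n) ∞ M,
    LocallyIntegrableOn (fun y => f (e.symm y)) e.target
  locallyIntegrable_grad : ∀ e ∈ IsManifold.maximalAtlas (𝓡 n) ∞ M,
    ∀ v : EuclideanSpace ℝ (Fin n),
      LocallyIntegrableOn (fun y => chartPairing e X y v) e.target
  integral_eq : ∀ e ∈ IsManifold.maximalAtlas (𝓡 n) ∞ M, ∀ u : EuclideanSpace ℝ (Fin n) → ℝ,
    ContDiff ℝ ∞ u → HasCompactSupport u → tsupport u ⊆ e.target →
    ∀ v : EuclideanSpace ℝ (Fin n),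
      ∫ y, f (e.symm y) * fderiv ℝ u y v = - ∫ y, chartPairing e X y v * u y

variable [MeasurableSpace M]

variable (n) in
/-- `f ∈ L^p_loc(M)`. -/
def MemLpLoc (p : ℝ≥0∞) (f : M → ℝ) : Prop :=
  ∀ K : Set M, IsCompact K → MemLp f p ((riemannianVolume n M).restrict K)

/-- `f ∈ W^{1,2}_loc(M)`, with weak gradient `X`. -/
structure MemW12Loc (f : M → ℝ) (X : ∀ x : M, TangentSpace (𝓡 n) x) : Prop where
  hasWeakGradient : HasWeakGradient f X
  memLp : MemLpLoc n 2 f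
  lintegral_grad_lt_top : ∀ K : Set M, IsCompact K →
    ∫⁻ x in K, ‖X x‖ₑ ^ 2 ∂(riemannianVolume n M) < ⊤

/-- For `f` with weak gradient `X`: the inequality `Δ f ≤ C` holds in the weak sense on the set
`B`, where the test functions are the nonnegative `φ ∈ W^{1,2}_loc(M)` with support in `B`. -/
def WeakLaplacianLE (X : ∀ x : M, TangentSpace (𝓡 n) x) (C : ℝ) (B : Set M) : Prop :=
  ∀ (φ : M → ℝ) (Y : ∀ x : M, TangentSpace (𝓡 n) x), MemW12Loc φ Y → (∀ x, 0 ≤ φ x) →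
    tsupport φ ⊆ B →
    ∫ x, inner ℝ (X x) (Y x) ∂(riemannianVolume n M) ≥ - C * ∫ x, φ x ∂(riemannianVolume n M)

/-- For `f` with weak gradient `X`: the inequality `Δ f ≥ -C` holds in the weak sense on `B`. -/
def WeakLaplacianGE (X : ∀ x : M, TangentSpace (𝓡 n) x) (C : ℝ) (B : Set M) : Prop :=
  ∀ (φ : M → ℝ) (Y : ∀ x : M, TangentSpace (𝓡 n) x), MemW12Loc φ Y → (∀ x, 0 ≤ φ x) →
    tsupport φ ⊆ B →
    ∫ x, inner ℝ (X x) (Y x) ∂(riemannianVolume n M) ≤ C * ∫ x, φ x ∂(riemannianVolume n M)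

end SingleManifold

section Convergence

variable {n : ℕ}
  {M : Type*} [MetricSpace M] [ChartedSpace (EuclideanSpace ℝ (Fin n)) M]
  [RiemannianBundle (fun x : M => TangentSpace (𝓡 n) x)]
  {N : ℕ → Type*} [∀ k, MetricSpace (N k)]
  [∀ k, ChartedSpace (EuclideanSpace ℝ (Fin n)) (N k)]
  [∀ k, RiemannianBundle (fun x : N k => TangentSpace (𝓡 n) x)]

/-- The components, in the chart `e` of `M`, of the pullback under `Φ : M → M'` of the Riemannian
metric of `M'`. -/
def pullbackMetric {M' : Type*} [MetricSpace M'] [ChartedSpace (EuclideanSpace ℝ (Fin n)) M']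
    [RiemannianBundle (fun x : M' => TangentSpace (𝓡 n) x)] (Φ : M → M')
    (e : OpenPartialHomeomorph M (EuclideanSpace ℝ (Fin n)))
    (v w y : EuclideanSpace ℝ (Fin n)) : ℝ :=
  inner ℝ (mfderiv (𝓡 n) (𝓡 n) Φ (e.symm y) (chartVec e y v))
    (mfderiv (𝓡 n) (𝓡 n) Φ (e.symm y) (chartVec e y w))

/-- Pointed `C¹` convergence of the Riemannian manifolds `(N k, h_k, p_k)` to `(M, h, p)`, realized
by the diffeomorphisms `Φ k` from open sets `(Φ k).source ⊆ M` onto open sets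
`(Φ k).target ⊆ N k`: the domains exhaust `M`, and the components of `(Φ k)^* h_k` in every chart
of `M` converge, together with their first derivatives, to those of `h`, uniformly on compact
sets. -/
structure PointedC1Convergence (Φ : ∀ k, OpenPartialHomeomorph M (N k)) (p : M) (pk : ∀ k, N k) :
    Prop where
  contMDiffOn : ∀ k, ContMDiffOn (𝓡 n) (𝓡 n) ∞ (Φ k) (Φ k).source
  contMDiffOn_symm : ∀ k, ContMDiffOn (𝓡 n) (𝓡 n) ∞ (Φ k).symm (Φ k).target
  mem_source : ∀ k, p ∈ (Φ k).source
  map_base : ∀ k, Φ k p = pk k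
  exhausts : ∀ K : Set M, IsCompact K → ∀ᶠ k in atTop, K ⊆ (Φ k).source
  tendsto_metric : ∀ e ∈ IsManifold.maximalAtlas (𝓡 n) ∞ M, ∀ K : Set (EuclideanSpace ℝ (Fin n)),
    IsCompact K → K ⊆ e.target → ∀ v w : EuclideanSpace ℝ (Fin n),
      TendstoUniformlyOn (fun k => pullbackMetric (Φ k) e v w)
        (fun y => inner ℝ (chartVec e y v) (chartVec e y w)) atTop K
  tendsto_fderiv_metric : ∀ e ∈ IsManifold.maximalAtlas (𝓡 n) ∞ M,
    ∀ K : Set (EuclideanSpace ℝ (Fin n)),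
    IsCompact K → K ⊆ e.target → ∀ v w : EuclideanSpace ℝ (Fin n),
      TendstoUniformlyOn (fun k => fderiv ℝ (pullbackMetric (Φ k) e v w))
        (fderiv ℝ fun y => inner ℝ (chartVec e y v) (chartVec e y w)) atTop K

/-- Tangent spaces are complete, being finite-dimensional. -/
theorem completeSpace_tangentSpace (x : M) : CompleteSpace (TangentSpace (𝓡 n) x) :=
  have : FiniteDimensional ℝ (TangentSpace (𝓡 n) x) :=
    inferInstanceAs (FiniteDimensional ℝ (EuclideanSpace ℝ (Fin n)))
  FiniteDimensional.complete ℝ (TangentSpace (𝓡 n) x)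

/-- If `X` is the gradient of `f` on `M'`, this is the gradient of `f ∘ Φ` with respect to the
Riemannian metric of `M`. -/
def pullbackGrad {M' : Type*} [MetricSpace M'] [ChartedSpace (EuclideanSpace ℝ (Fin n)) M']
    [RiemannianBundle (fun x : M' => TangentSpace (𝓡 n) x)] (Φ : M → M')
    (X : ∀ x : M', TangentSpace (𝓡 n) x) (x : M) : TangentSpace (𝓡 n) x :=
  haveI := completeSpace_tangentSpace (n := n) x
  (InnerProductSpace.toDual ℝ (TangentSpace (𝓡 n) x)).symm
    ((innerSL ℝ (X (Φ x))).comp (mfderiv (𝓡 n) (𝓡 n) Φ x))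

theorem inner_pullbackGrad {M' : Type*} [MetricSpace M']
    [ChartedSpace (EuclideanSpace ℝ (Fin n)) M']
    [RiemannianBundle (fun x : M' => TangentSpace (𝓡 n) x)] (Φ : M → M')
    (X : ∀ x : M', TangentSpace (𝓡 n) x) (x : M) (v : TangentSpace (𝓡 n) x) :
    inner ℝ (pullbackGrad Φ X x) v = inner ℝ (X (Φ x)) (mfderiv (𝓡 n) (𝓡 n) Φ x v) := by
  have := completeSpace_tangentSpace (n := n) x
  simp only [pullbackGrad]
  rw [InnerProductSpace.toDual_symm_apply]
  rfl

variable [MeasurableSpace M]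

variable (n) in
/-- `f_k → f` in `L^∞_loc`, where `f_k` is transplanted to `M` by `Φ k`. -/
def TendstoLinftyLoc (Φ : ∀ k, OpenPartialHomeomorph M (N k)) (fk : ∀ k, N k → ℝ) (f : M → ℝ) :
    Prop :=
  ∀ K : Set M, IsCompact K →
    Tendsto (fun k => eLpNorm (fun x => fk k (Φ k x) - f x) ⊤ ((riemannianVolume n M).restrict K))
      atTop (𝓝 0)

/-- `f_k → f` weakly in `W^{1,2}_loc`, where `f_k` (with gradient `Xk k`) is transplanted to `M` by
`Φ k` and `f` has gradient `X`. Since `f ↦ (f, ∇ f)` embeds `W^{1,2}` as a closed subspace of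
`L² × L²`, this is weak `L²_loc` convergence of the functions and of their gradients. -/
structure TendstoWeaklyW12Loc (Φ : ∀ k, OpenPartialHomeomorph M (N k))
    (fk : ∀ k, N k → ℝ) (Xk : ∀ k, ∀ x : N k, TangentSpace (𝓡 n) x)
    (f : M → ℝ) (X : ∀ x : M, TangentSpace (𝓡 n) x) : Prop where
  tendsto_fun : ∀ K : Set M, IsCompact K → ∀ g : M → ℝ,
    MemLp g 2 ((riemannianVolume n M).restrict K) →
    Tendsto (fun k => ∫ x in K, fk k (Φ k x) * g x ∂(riemannianVolume n M)) atTop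
      (𝓝 (∫ x in K, f x * g x ∂(riemannianVolume n M)))
  tendsto_grad : ∀ K : Set M, IsCompact K → ∀ Y : ∀ x : M, TangentSpace (𝓡 n) x,
    IsMeasurableField Y → ∫⁻ x in K, ‖Y x‖ₑ ^ 2 ∂(riemannianVolume n M) < ⊤ →
    Tendsto (fun k => ∫ x in K, inner ℝ (pullbackGrad (Φ k) (Xk k) x) (Y x)
        ∂(riemannianVolume n M)) atTop
      (𝓝 (∫ x in K, inner ℝ (X x) (Y x) ∂(riemannianVolume n M)))

/-- `f_k → f` strongly in `W^{1,2}_loc`, with the same conventions: on every compact set the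
functions and the gradients converge in `L²`. -/
structure TendstoStronglyW12Loc (Φ : ∀ k, OpenPartialHomeomorph M (N k))
    (fk : ∀ k, N k → ℝ) (Xk : ∀ k, ∀ x : N k, TangentSpace (𝓡 n) x)
    (f : M → ℝ) (X : ∀ x : M, TangentSpace (𝓡 n) x) : Prop where
  tendsto_fun : ∀ K : Set M, IsCompact K →
    Tendsto (fun k => ∫⁻ x in K, ‖fk k (Φ k x) - f x‖ₑ ^ 2 ∂(riemannianVolume n M)) atTop (𝓝 0)
  tendsto_grad : ∀ K : Set M, IsCompact K →
    Tendsto (fun k => ∫⁻ x in K, ‖pullbackGrad (Φ k) (Xk k) x - X x‖ₑ ^ 2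
      ∂(riemannianVolume n M)) atTop (𝓝 0)

end Convergence

end

/-! The proof tests the differential inequality for `fk k` with a cutoff times the small difference
between `fk k` and `f`, then absorbs the errors. Fix a smooth cutoff `ψ` with values in [0, 1] and
compact support, and let ε_k be the sup norm of f_k ∘ Φ_k - f on a closed ball `L` containing that
support. Put s = 1 when the Laplacians are bounded above and s = -1 when they are bounded below.
Then φ = ψ² (ε_k - s (f_k - f)), transplanted to `N k`, is nonnegative up to a null set and at most
2 ε_k. It is an admissible test function because weak gradients can be transported by
diffeomorphisms and multiplied by cutoffs (`IsCloseOn.exists_testFunction`).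

Write F = ∇f and W = ∇(f_k ∘ Φ_k) - ∇f. In the limit metric, s times the pairing of F + W with ∇φ is
-ψ² |W|² - ψ² ⟨F, W⟩ plus a term containing ε_k ψ ∇ψ. The differential inequality therefore yields ∫
ψ² |W|² ≤ -∫ ψ² ⟨F, W⟩ + O(δ + ε_k) (∫ ψ² |W|² + B) + O(ε_k), where B does not depend on k and δ
measures how far Φ_k is from an isometry on `L` (`IsCloseOn.gradient_estimate`). Weak convergence
kills the first term on the right, uniform convergence makes ε_k tend to 0, and δ can be fixed
arbitrarily small before k tends to infinity. Half of the left side absorbs the rest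
(`tendsto_zero_of_absorbed_bound`), so the gradients converge strongly. No uniform energy bound for
the f_k has to be proved beforehand.

Two geometric facts support this. Convergence of the metrics makes differentials and volumes
uniformly δ-close on compact sets (`PointedC1Convergence.eventually_isCloseOn`). Comparing lengths
of paths shows that Φ_k maps balls about `p` into balls of controlled radius about `pk k`, and that
images of balls contain balls (`IsCloseOn.image_closedBall_subset`, `IsCloseOn.ball_subset_image`).
Closed balls of `M` are compact by Hopf-Rinow.

For the integrals with weights η_k, the second of these inclusions places all supports in the image
of one compact ball. There |∇f_k|² η_k is compared with |∇f|² η by means of the strong convergence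
and Young's inequality (`IsCloseOn.abs_integral_norm_sq_mul_sub_le`). -/

set_option linter.unusedSectionVars false

/-! ### Pulling back measures by open partial homeomorphisms -/

namespace OpenPartialHomeomorph

variable {X Y : Type*} [TopologicalSpace X] [TopologicalSpace Y]
  [MeasurableSpace X] [MeasurableSpace Y] [BorelSpace X] [BorelSpace Y]

/-- The pullback of a measure under an open partial homeomorphism, supported on its source. -/
noncomputable def pullMeasure (e : OpenPartialHomeomorph X Y) (m : Measure Y) : Measure X :=
  (m.restrict e.target).map e.symm

theorem measurableEmbedding_symm_val (e : OpenPartialHomeomorph X Y) :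
    MeasurableEmbedding (fun y : e.target => e.symm y) :=
  ((MeasurableEmbedding.subtype_coe e.open_source.measurableSet).comp
    e.toHomeomorphSourceTarget.symm.measurableEmbedding)

theorem measurableSet_inter_preimage_symm (e : OpenPartialHomeomorph X Y) {s : Set X}
    (hs : MeasurableSet s) : MeasurableSet (e.target ∩ e.symm ⁻¹' s) := by
  have h := (e.open_target.measurableSet.subtype_image
    (e.toHomeomorphSourceTarget.symm.measurable (measurable_subtype_coe hs)))
  convert h using 1
  ext y
  simp [and_comm]

theorem aemeasurable_symm (e : OpenPartialHomeomorph X Y) (m : Measure Y) :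
    AEMeasurable e.symm (m.restrict e.target) :=
  e.continuousOn_symm.aemeasurable e.open_target.measurableSet

/-- On the subtype `e.target` the inverse is a measurable embedding. Mapping along an embedding lets
the integral formulas below hold for arbitrary functions, with no measurability assumption. -/
theorem pullMeasure_eq (e : OpenPartialHomeomorph X Y) (m : Measure Y) :
    e.pullMeasure m = (m.comap ((↑) : e.target → Y)).map (fun y : e.target => e.symm y) := by
  have ht := e.open_target.measurableSet
  rw [pullMeasure, ← map_comap_subtype_coe ht,
    AEMeasurable.map_map_of_aemeasurable _ measurable_subtype_coe.aemeasurable]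
  · rfl
  · rw [map_comap_subtype_coe ht]
    exact e.aemeasurable_symm m

theorem pullMeasure_apply (e : OpenPartialHomeomorph X Y) (m : Measure Y) (s : Set X) :
    e.pullMeasure m s = m (e.target ∩ e.symm ⁻¹' s) := by
  rw [pullMeasure_eq, e.measurableEmbedding_symm_val.map_apply,
    comap_subtype_coe_apply e.open_target.measurableSet]
  congr 1
  ext y
  simp [and_comm]

theorem lintegral_pullMeasure (e : OpenPartialHomeomorph X Y) (m : Measure Y) (g : X → ℝ≥0∞) :
    ∫⁻ x, g x ∂e.pullMeasure m = ∫⁻ y in e.target, g (e.symm y) ∂m := by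
  rw [pullMeasure_eq, e.measurableEmbedding_symm_val.lintegral_map,
    ← lintegral_subtype_comap e.open_target.measurableSet]

theorem integral_pullMeasure (e : OpenPartialHomeomorph X Y) (m : Measure Y) (g : X → ℝ) :
    ∫ x, g x ∂e.pullMeasure m = ∫ y in e.target, g (e.symm y) ∂m := by
  rw [pullMeasure_eq, e.measurableEmbedding_symm_val.integral_map,
    ← integral_subtype_comap e.open_target.measurableSet]

theorem ae_pullMeasure_iff (e : OpenPartialHomeomorph X Y) (m : Measure Y) (P : X → Prop) :
    (∀ᵐ x ∂e.pullMeasure m, P x) ↔ ∀ᵐ y ∂m.restrict e.target, P (e.symm y) := by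
  rw [pullMeasure_eq, e.measurableEmbedding_symm_val.ae_map_iff,
    ae_restrict_iff_subtype e.open_target.measurableSet]

theorem aestronglyMeasurable_pullMeasure_iff (e : OpenPartialHomeomorph X Y) (m : Measure Y)
    (g : X → ℝ) : AEStronglyMeasurable g (e.pullMeasure m) ↔
      AEStronglyMeasurable (fun y => g (e.symm y)) (m.restrict e.target) := by
  rw [pullMeasure_eq, e.measurableEmbedding_symm_val.aestronglyMeasurable_map_iff,
    ← map_comap_subtype_coe e.open_target.measurableSet,
    (MeasurableEmbedding.subtype_coe e.open_target.measurableSet).aestronglyMeasurable_map_iff]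
  rfl

theorem restrict_pullMeasure_source (e : OpenPartialHomeomorph X Y) (m : Measure Y) :
    (e.pullMeasure m).restrict e.source = e.pullMeasure m := by
  apply Measure.restrict_eq_self_of_ae_mem
  rw [ae_pullMeasure_iff]
  filter_upwards [ae_restrict_mem e.open_target.measurableSet] with y hy using e.map_target hy

theorem integral_comp_pullMeasure (e : OpenPartialHomeomorph X Y) (m : Measure Y)
    (G : Y → ℝ) : ∫ x, G (e x) ∂e.pullMeasure m = ∫ y in e.target, G y ∂m := by
  rw [integral_pullMeasure]
  exact setIntegral_congr_fun e.open_target.measurableSet fun y hy => by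
    simp only [e.right_inv hy]

/-- Integrals of functions supported in the image of a subset of the source. -/
theorem setLIntegral_comp_pullMeasure (e : OpenPartialHomeomorph X Y) (m : Measure Y)
    {L : Set X} (hL : MeasurableSet L) (hLe : L ⊆ e.source) (heL : MeasurableSet (e '' L))
    (G : Y → ℝ≥0∞) : ∫⁻ x in L, G (e x) ∂e.pullMeasure m = ∫⁻ y in e '' L, G y ∂m := by
  rw [← lintegral_indicator hL, ← lintegral_indicator heL, lintegral_pullMeasure,
    ← lintegral_indicator e.open_target.measurableSet]
  congr 1
  ext y
  by_cases hy : y ∈ e.target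
  · rw [Set.indicator_of_mem hy]
    by_cases h : e.symm y ∈ L
    · have : y ∈ e '' L := ⟨_, h, e.right_inv hy⟩
      rw [Set.indicator_of_mem h, Set.indicator_of_mem this, e.right_inv hy]
    · have : y ∉ e '' L := by
        rintro ⟨x, hx, rfl⟩
        exact h (by rwa [e.left_inv (hLe hx)])
      rw [Set.indicator_of_notMem h, Set.indicator_of_notMem this]
  · have : y ∉ e '' L := by
      rintro ⟨x, hx, rfl⟩
      exact hy (e.map_source (hLe hx))
    rw [Set.indicator_of_notMem hy, Set.indicator_of_notMem this]

/-- This moves an integral over the whole of `Y` to the fixed set `L`: injectivity of `e` on its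
source makes `G ∘ e` vanish on the source outside `L`. -/
theorem integral_eq_setIntegral_pullMeasure (e : OpenPartialHomeomorph X Y) (m : Measure Y)
    {L : Set X} (hL : MeasurableSet L) (hLe : L ⊆ e.source)
    (G : Y → ℝ) (hG : Function.support G ⊆ e '' L) :
    ∫ y, G y ∂m = ∫ x in L, G (e x) ∂e.pullMeasure m := by
  have h1 : ∫ x in L, G (e x) ∂e.pullMeasure m = ∫ x, G (e x) ∂e.pullMeasure m := by
    rw [← integral_indicator hL]
    apply integral_congr_ae
    have : ∀ᵐ x ∂e.pullMeasure m, x ∈ e.source := by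
      rw [ae_pullMeasure_iff]
      filter_upwards [ae_restrict_mem e.open_target.measurableSet] with y hy using e.map_target hy
    filter_upwards [this] with x hx
    by_cases h : x ∈ L
    · rw [Set.indicator_of_mem h]
    · rw [Set.indicator_of_notMem h]
      by_contra hne
      obtain ⟨z, hz, hzx⟩ := hG (show e x ∈ Function.support G from fun h0 => hne h0.symm)
      exact h (e.injOn (hLe hz) hx hzx ▸ hz)
  rw [h1, integral_comp_pullMeasure, setIntegral_eq_integral_of_forall_compl_eq_zero]
  intro y hy
  by_contra hne
  obtain ⟨z, hz, rfl⟩ := hG hne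
  exact hy (e.map_source (hLe hz))

end OpenPartialHomeomorph

/-! ### Linear algebra of almost isometric maps -/

/-- If a bilinear form is within `δ` of the inner product on the diagonal, it is so everywhere. -/
theorem abs_inner_map_sub_inner_le {A B : Type*} [NormedAddCommGroup A] [InnerProductSpace ℝ A]
    [NormedAddCommGroup B] [InnerProductSpace ℝ B] (D : A →ₗ[ℝ] B) {δ : ℝ}
    (hD : ∀ v, |‖D v‖ ^ 2 - ‖v‖ ^ 2| ≤ δ * ‖v‖ ^ 2) (u v : A) :
    |inner ℝ (D u) (D v) - inner ℝ u v| ≤ δ * ‖u‖ * ‖v‖ := by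
  rcases eq_or_ne u 0 with rfl | hu
  · simp
  rcases eq_or_ne v 0 with rfl | hv
  · simp
  -- Polarization on unit vectors: the errors on `a + b` and `a - b` add up to at most δ (‖a + b‖² +
  -- ‖a - b‖²) = 4 δ, and polarization divides by 4.
  have key : ∀ a b : A, ‖a‖ = 1 → ‖b‖ = 1 → |inner ℝ (D a) (D b) - inner ℝ a b| ≤ δ := by
    intro a b ha hb
    have h1 := hD (a + b)
    have h2 := hD (a - b)
    have h3 := parallelogram_law_with_norm ℝ a b
    have e1 := norm_add_sq_real (D a) (D b)
    have e2 := norm_sub_sq_real (D a) (D b)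
    have e3 := norm_add_sq_real a b
    have e4 := norm_sub_sq_real a b
    rw [map_add] at h1
    rw [map_sub] at h2
    rw [abs_le] at h1 h2 ⊢
    simp only [ha, hb] at *
    constructor <;> nlinarith
  have hu' : 0 < ‖u‖ := norm_pos_iff.2 hu
  have hv' : 0 < ‖v‖ := norm_pos_iff.2 hv
  have := key (‖u‖⁻¹ • u) (‖v‖⁻¹ • v) (by rw [norm_smul]; simp [hu'.ne'])
    (by rw [norm_smul]; simp [hv'.ne'])
  simp only [map_smul, inner_smul_left, inner_smul_right, RCLike.conj_to_real] at this
  rw [← mul_sub, ← mul_sub, abs_mul, abs_mul, abs_of_pos (by positivity),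
    abs_of_pos (by positivity), mul_left_comm] at this
  calc _ = ‖u‖ * ‖v‖ * (‖u‖⁻¹ * (‖v‖⁻¹ * |inner ℝ (D u) (D v) - inner ℝ u v|)) := by
        field_simp
    _ ≤ ‖u‖ * ‖v‖ * δ := by gcongr
    _ = _ := by ring

/-- The inner product of two vectors of `B` is close to that of their transposes under a nearly
isometric surjection `D : A → B`. -/
theorem abs_inner_sub_inner_adjoint_le {A B : Type*} [NormedAddCommGroup A]
    [InnerProductSpace ℝ A] [NormedAddCommGroup B] [InnerProductSpace ℝ B] (D : A →ₗ[ℝ] B)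
    (hsurj : Function.Surjective D) {δ : ℝ} (hδ : δ ≤ 1 / 2)
    (hD : ∀ v, |‖D v‖ ^ 2 - ‖v‖ ^ 2| ≤ δ * ‖v‖ ^ 2) {p q : B} {α β : A}
    (hp : ∀ v, inner ℝ α v = inner ℝ p (D v)) (hq : ∀ v, inner ℝ β v = inner ℝ q (D v)) :
    |inner ℝ p q - inner ℝ α β| ≤ 2 * δ * ‖α‖ * ‖β‖ := by
  -- With q = D ζ one has β = Dᵀ D ζ, which is close to ζ because Dᵀ D is close to the identity,
  -- while ⟨p, q⟩ = ⟨α, ζ⟩. The whole discrepancy is thus ⟨α, ζ - β⟩.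
  obtain ⟨ζ, rfl⟩ := hsurj q
  rcases eq_or_ne ζ 0 with rfl | hζ
  · have : β = 0 := by
      rw [← inner_self_eq_zero (𝕜 := ℝ), hq]
      simp
    simp [this]
  have hδ0 : 0 ≤ δ := by
    have := (abs_nonneg _).trans (hD ζ)
    exact nonneg_of_mul_nonneg_left this (by positivity)
  have h1 : ‖β - ζ‖ ≤ δ * ‖ζ‖ := by
    rcases eq_or_ne (β - ζ) 0 with h0 | h0
    · rw [h0, norm_zero]; positivity
    have h := abs_inner_map_sub_inner_le D hD ζ (β - ζ)
    rw [← hq, ← inner_sub_left, real_inner_self_eq_norm_sq, abs_of_nonneg (by positivity)] at h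
    have : 0 < ‖β - ζ‖ := norm_pos_iff.2 h0
    nlinarith
  have h2 : ‖ζ‖ ≤ 2 * ‖β‖ := by
    have : ‖ζ‖ ≤ ‖β‖ + ‖β - ζ‖ := by
      have := norm_sub_norm_le ζ β
      rw [norm_sub_rev] at this
      linarith
    nlinarith [norm_nonneg ζ]
  rw [← hp, ← inner_sub_right]
  calc |inner ℝ α (ζ - β)| ≤ ‖α‖ * ‖ζ - β‖ := abs_real_inner_le_norm _ _
    _ ≤ ‖α‖ * (δ * (2 * ‖β‖)) := by
        rw [norm_sub_rev]
        gcongr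
        exact h1.trans (by gcongr)
    _ = _ := by ring

/-! ### Charts and local diffeomorphisms -/

section Charts

variable {n : ℕ}
  {M : Type*} [MetricSpace M] [ChartedSpace (EuclideanSpace ℝ (Fin n)) M] [IsManifold (𝓡 n) ∞ M]
  {M' : Type*} [MetricSpace M'] [ChartedSpace (EuclideanSpace ℝ (Fin n)) M']
  [IsManifold (𝓡 n) ∞ M']

variable (n) in
/-- A local diffeomorphism: an open partial homeomorphism smooth in both directions. -/
structure OpenPartialHomeomorph.IsSmooth (Φ : OpenPartialHomeomorph M M') : Prop where
  contMDiffOn : ContMDiffOn (𝓡 n) (𝓡 n) ∞ Φ Φ.source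
  contMDiffOn_symm : ContMDiffOn (𝓡 n) (𝓡 n) ∞ Φ.symm Φ.target

theorem OpenPartialHomeomorph.IsSmooth.symm {Φ : OpenPartialHomeomorph M M'} (h : Φ.IsSmooth n) :
    Φ.symm.IsSmooth n :=
  ⟨h.contMDiffOn_symm, by simpa using h.contMDiffOn⟩

theorem OpenPartialHomeomorph.IsSmooth.mdifferentiable {Φ : OpenPartialHomeomorph M M'}
    (h : Φ.IsSmooth n) : Φ.MDifferentiable (𝓡 n) (𝓡 n) :=
  ⟨h.contMDiffOn.mdifferentiableOn (by simp), h.contMDiffOn_symm.mdifferentiableOn (by simp)⟩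

theorem isSmooth_of_mem_maximalAtlas {e : OpenPartialHomeomorph M (EuclideanSpace ℝ (Fin n))}
    (he : e ∈ IsManifold.maximalAtlas (𝓡 n) ∞ M) : e.IsSmooth n :=
  ⟨contMDiffOn_of_mem_maximalAtlas he, contMDiffOn_symm_of_mem_maximalAtlas he⟩

/-- Transport of charts by a local diffeomorphism. -/
theorem symm_trans_mem_maximalAtlas {Φ : OpenPartialHomeomorph M M'} (hΦ : Φ.IsSmooth n)
    {e : OpenPartialHomeomorph M (EuclideanSpace ℝ (Fin n))}
    (he : e ∈ IsManifold.maximalAtlas (𝓡 n) ∞ M) :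
    Φ.symm ≫ₕ e ∈ IsManifold.maximalAtlas (𝓡 n) ∞ M' := by
  have h := isSmooth_of_mem_maximalAtlas he
  apply OpenPartialHomeomorph.mem_maximalAtlas_of_contMDiffOn
  · exact h.contMDiffOn.comp (hΦ.contMDiffOn_symm.mono (by simp)) (by
      intro x hx; simp at hx; exact hx.2)
  · exact hΦ.contMDiffOn.comp (h.contMDiffOn_symm.mono (by simp)) (by
      intro x hx; simp at hx; exact hx.2)

theorem restr_mem_maximalAtlas_of_isOpen {e : OpenPartialHomeomorph M (EuclideanSpace ℝ (Fin n))}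
    (he : e ∈ IsManifold.maximalAtlas (𝓡 n) ∞ M) {O : Set M} (hO : IsOpen O) :
    e.restr O ∈ IsManifold.maximalAtlas (𝓡 n) ∞ M :=
  restr_mem_maximalAtlas (contDiffGroupoid ∞ (𝓡 n)) he hO

theorem mdifferentiableAt_chart_symm {e : OpenPartialHomeomorph M (EuclideanSpace ℝ (Fin n))}
    (he : e ∈ IsManifold.maximalAtlas (𝓡 n) ∞ M) {y : EuclideanSpace ℝ (Fin n)}
    (hy : y ∈ e.target) : MDifferentiableAt (𝓡 n) (𝓡 n) e.symm y :=
  (isSmooth_of_mem_maximalAtlas he).mdifferentiable.mdifferentiableAt_symm hy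

theorem chartVec_symm_trans {Φ : OpenPartialHomeomorph M M'} (hΦ : Φ.IsSmooth n)
    {e : OpenPartialHomeomorph M (EuclideanSpace ℝ (Fin n))}
    (he : e ∈ IsManifold.maximalAtlas (𝓡 n) ∞ M) {y : EuclideanSpace ℝ (Fin n)}
    (hy : y ∈ e.target) (hy' : e.symm y ∈ Φ.source) (v : EuclideanSpace ℝ (Fin n)) :
    chartVec (Φ.symm ≫ₕ e) y v = mfderiv (𝓡 n) (𝓡 n) Φ (e.symm y) (chartVec e y v) := by
  have h1 : MDifferentiableAt (𝓡 n) (𝓡 n) Φ (e.symm y) := hΦ.mdifferentiable.mdifferentiableAt hy'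
  have h2 := mdifferentiableAt_chart_symm he hy
  exact congrArg (fun L => L v) (mfderiv_comp y h1 h2)

/-- The differential of a chart's inverse as a linear map. -/
noncomputable def chartVecL (e : OpenPartialHomeomorph M (EuclideanSpace ℝ (Fin n)))
    (y : EuclideanSpace ℝ (Fin n)) :
    EuclideanSpace ℝ (Fin n) →ₗ[ℝ] TangentSpace (𝓡 n) (e.symm y) where
  toFun := chartVec e y
  map_add' := fun v w => (mfderiv (𝓡 n) (𝓡 n) e.symm y).map_add v w
  map_smul' := fun c v => (mfderiv (𝓡 n) (𝓡 n) e.symm y).map_smul c v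

theorem chartVecL_apply (e : OpenPartialHomeomorph M (EuclideanSpace ℝ (Fin n)))
    (y v : EuclideanSpace ℝ (Fin n)) : chartVecL e y v = chartVec e y v := rfl

theorem chartVecL_bijective {e : OpenPartialHomeomorph M (EuclideanSpace ℝ (Fin n))}
    (he : e ∈ IsManifold.maximalAtlas (𝓡 n) ∞ M) {y : EuclideanSpace ℝ (Fin n)}
    (hy : y ∈ e.target) : Function.Bijective (chartVecL e y) :=
  (isSmooth_of_mem_maximalAtlas he).symm.mdifferentiable.mfderiv_bijective hy

theorem euclidean_eq_sum_single (v : EuclideanSpace ℝ (Fin n)) :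
    v = ∑ i, v i • EuclideanSpace.single i (1 : ℝ) := by
  ext j
  simp [Pi.single_apply]

theorem chartVec_eq_sum (e : OpenPartialHomeomorph M (EuclideanSpace ℝ (Fin n)))
    (y v : EuclideanSpace ℝ (Fin n)) :
    chartVec e y v = ∑ i, v i • chartVec e y (EuclideanSpace.single i 1) := by
  simp only [← chartVecL_apply]
  conv_lhs => rw [euclidean_eq_sum_single v]
  rw [map_sum]
  simp only [map_smul]

theorem exists_chartVec_eq {e : OpenPartialHomeomorph M (EuclideanSpace ℝ (Fin n))}
    (he : e ∈ IsManifold.maximalAtlas (𝓡 n) ∞ M) {y : EuclideanSpace ℝ (Fin n)}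
    (hy : y ∈ e.target) (ξ : TangentSpace (𝓡 n) (e.symm y)) :
    ∃ v, chartVec e y v = ξ :=
  (chartVecL_bijective he hy).2 ξ

end Charts

/-! ### The metric in coordinates -/

section RiemannianCharts

variable {n : ℕ}
  {M : Type*} [MetricSpace M] [ChartedSpace (EuclideanSpace ℝ (Fin n)) M]
  [IsManifold (𝓡 n) ∞ M] [RiemannianBundle (fun x : M => TangentSpace (𝓡 n) x)]
  {M' : Type*} [MetricSpace M'] [ChartedSpace (EuclideanSpace ℝ (Fin n)) M']
  [IsManifold (𝓡 n) ∞ M'] [RiemannianBundle (fun x : M' => TangentSpace (𝓡 n) x)]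

theorem chartPairing_symm_trans {Φ : OpenPartialHomeomorph M M'} (hΦ : Φ.IsSmooth n)
    {e : OpenPartialHomeomorph M (EuclideanSpace ℝ (Fin n))}
    (he : e ∈ IsManifold.maximalAtlas (𝓡 n) ∞ M) {y : EuclideanSpace ℝ (Fin n)}
    (hy : y ∈ e.target) (hy' : e.symm y ∈ Φ.source) (X : ∀ x : M', TangentSpace (𝓡 n) x)
    (v : EuclideanSpace ℝ (Fin n)) :
    chartPairing (Φ.symm ≫ₕ e) X y v = chartPairing e (pullbackGrad Φ X) y v := by
  rw [chartPairing, chartPairing, inner_pullbackGrad, ← chartVec_symm_trans hΦ he hy hy']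
  rfl

/-- A chart `e` of `M` composed with `Φ.symm` is a chart of `M'` with the same coordinates, so
statements about the metric of `M'` become statements about the pulled back metric read in `e`. -/
theorem gramMatrix_symm_trans {Φ : OpenPartialHomeomorph M M'} (hΦ : Φ.IsSmooth n)
    {e : OpenPartialHomeomorph M (EuclideanSpace ℝ (Fin n))}
    (he : e ∈ IsManifold.maximalAtlas (𝓡 n) ∞ M) {y : EuclideanSpace ℝ (Fin n)}
    (hy : y ∈ e.target) (hy' : e.symm y ∈ Φ.source) :
    gramMatrix (Φ.symm ≫ₕ e) y = Matrix.of fun i j =>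
      pullbackMetric Φ e (EuclideanSpace.single i 1) (EuclideanSpace.single j 1) y := by
  ext i j
  simp only [gramMatrix, Matrix.of_apply, pullbackMetric]
  rw [← chartVec_symm_trans hΦ he hy hy', ← chartVec_symm_trans hΦ he hy hy']
  rfl

theorem posDef_gramMatrix {e : OpenPartialHomeomorph M (EuclideanSpace ℝ (Fin n))}
    (he : e ∈ IsManifold.maximalAtlas (𝓡 n) ∞ M) {y : EuclideanSpace ℝ (Fin n)}
    (hy : y ∈ e.target) : (gramMatrix e y).PosDef := by
  have h : gramMatrix e y = Matrix.gram ℝ (fun i => chartVec e y (EuclideanSpace.single i 1)) := rfl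
  rw [h, Matrix.posDef_gram_iff_linearIndependent]
  have h2 := (EuclideanSpace.basisFun (Fin n) ℝ).toBasis.linearIndependent.map'
    (chartVecL e y) (LinearMap.ker_eq_bot.2 (chartVecL_bijective he hy).1)
  have h3 : (chartVecL e y) ∘ (EuclideanSpace.basisFun (Fin n) ℝ).toBasis =
      fun i => chartVec e y (EuclideanSpace.single i 1) := by
    ext i
    simp [chartVecL_apply]
  rw [h3] at h2
  exact h2

variable (n M) in
theorem isContinuousRiemannianBundle_of_contMDiff
    [h : IsContMDiffRiemannianBundle (𝓡 n) 1 (EuclideanSpace ℝ (Fin n))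
      (fun x : M => TangentSpace (𝓡 n) x)] :
    IsContinuousRiemannianBundle (EuclideanSpace ℝ (Fin n))
      (fun x : M => TangentSpace (𝓡 n) x) := by
  obtain ⟨g, hg, hg'⟩ := h.exists_contMDiff
  exact ⟨g, hg.continuous, hg'⟩

variable [IsContMDiffRiemannianBundle (𝓡 n) 1 (EuclideanSpace ℝ (Fin n))
      (fun x : M => TangentSpace (𝓡 n) x)]

/-- The curve of vectors is the tangent map of the smooth map `e.symm` applied to a constant
section, and tangent maps of smooth maps are continuous. -/
theorem continuousOn_chartVec {e : OpenPartialHomeomorph M (EuclideanSpace ℝ (Fin n))}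
    (he : e ∈ IsManifold.maximalAtlas (𝓡 n) ∞ M) (v : EuclideanSpace ℝ (Fin n)) :
    ContinuousOn (fun y => (⟨e.symm y, chartVec e y v⟩ : TangentBundle (𝓡 n) M)) e.target := by
  have h := (contMDiffOn_symm_of_mem_maximalAtlas he).continuousOn_tangentMapWithin
    (by simp) e.open_target.uniqueMDiffOn
  have h2 : Continuous (fun y : EuclideanSpace ℝ (Fin n) =>
      (⟨y, v⟩ : TangentBundle (𝓡 n) (EuclideanSpace ℝ (Fin n)))) := by
    exact (tangentBundleModelSpaceHomeomorph (𝓡 n)).symm.continuous.comp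
      (g := (tangentBundleModelSpaceHomeomorph (𝓡 n)).symm) (f := fun y => (y, v)) (by fun_prop)
  refine (h.comp h2.continuousOn (fun y hy => hy)).congr fun y hy => ?_
  simp only [Function.comp, tangentMapWithin, chartVec]
  rw [mfderivWithin_of_isOpen e.open_target hy]

theorem continuousOn_inner_chartVec {e : OpenPartialHomeomorph M (EuclideanSpace ℝ (Fin n))}
    (he : e ∈ IsManifold.maximalAtlas (𝓡 n) ∞ M) (v w : EuclideanSpace ℝ (Fin n)) :
    ContinuousOn (fun y => (inner ℝ (chartVec e y v) (chartVec e y w) : ℝ)) e.target := by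
  have := isContinuousRiemannianBundle_of_contMDiff n M
  exact ContinuousOn.inner_bundle (continuousOn_chartVec he v) (continuousOn_chartVec he w)

theorem continuousOn_gramMatrix {e : OpenPartialHomeomorph M (EuclideanSpace ℝ (Fin n))}
    (he : e ∈ IsManifold.maximalAtlas (𝓡 n) ∞ M) : ContinuousOn (gramMatrix e) e.target := by
  apply continuousOn_pi.2 fun i => continuousOn_pi.2 fun j => ?_
  exact continuousOn_inner_chartVec he _ _

theorem continuousOn_det_gramMatrix {e : OpenPartialHomeomorph M (EuclideanSpace ℝ (Fin n))}
    (he : e ∈ IsManifold.maximalAtlas (𝓡 n) ∞ M) :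
    ContinuousOn (fun y => (gramMatrix e y).det) e.target :=
  continuous_id.matrix_det.comp_continuousOn (continuousOn_gramMatrix he)

/-- On compact sets, coordinates of tangent vectors are controlled by the Riemannian norm. -/
theorem exists_norm_le_norm_chartVec {e : OpenPartialHomeomorph M (EuclideanSpace ℝ (Fin n))}
    (he : e ∈ IsManifold.maximalAtlas (𝓡 n) ∞ M) {K : Set (EuclideanSpace ℝ (Fin n))}
    (hK : IsCompact K) (hKe : K ⊆ e.target) :
    ∃ C > 0, ∀ y ∈ K, ∀ v, ‖v‖ ≤ C * ‖chartVec e y v‖ := by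
  let q : EuclideanSpace ℝ (Fin n) × EuclideanSpace ℝ (Fin n) → ℝ :=
    fun z => ‖chartVec e z.1 z.2‖ ^ 2
  have hq : q = fun z => ∑ i, ∑ j, z.2 i * z.2 j * gramMatrix e z.1 i j := by
    ext z
    simp only [q]
    rw [← real_inner_self_eq_norm_sq, chartVec_eq_sum, sum_inner]
    simp only [inner_sum, inner_smul_left, inner_smul_right, RCLike.conj_to_real, gramMatrix,
      Matrix.of_apply, mul_assoc]
    exact Finset.sum_congr rfl fun i _ => Finset.sum_congr rfl fun j _ => mul_left_comm _ _ _
  have hcont : ContinuousOn q (K ×ˢ Metric.sphere 0 1) := by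
    rw [hq]
    refine continuousOn_finsetSum _ fun i _ => continuousOn_finsetSum _ fun j _ => ?_
    refine ContinuousOn.mul (by fun_prop) ?_
    exact (continuousOn_inner_chartVec he _ _).comp continuousOn_fst fun z hz => hKe hz.1
  -- The product with the sphere is empty if `K` is empty or the dimension is 0. In that case no
  -- minimum exists, but every `v` over a point of `K` is zero.
  rcases (K ×ˢ Metric.sphere (0 : EuclideanSpace ℝ (Fin n)) 1).eq_empty_or_nonempty with h0 | hne
  · refine ⟨1, one_pos, fun y hy v => ?_⟩
    have : v = 0 := by
      by_contra hv
      have : (y, ‖v‖⁻¹ • v) ∈ K ×ˢ Metric.sphere (0 : EuclideanSpace ℝ (Fin n)) 1 := by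
        refine ⟨hy, ?_⟩
        simp [norm_smul, norm_ne_zero_iff.2 hv]
      rw [h0] at this
      exact this
    rw [this, norm_zero]
    positivity
  obtain ⟨z, hz, hmin⟩ := (hK.prod (isCompact_sphere _ _)).exists_isMinOn hne hcont
  have hz0 : 0 < ‖chartVec e z.1 z.2‖ := by
    rw [norm_pos_iff, ← chartVecL_apply]
    intro h
    have := (chartVecL_bijective he (hKe hz.1)).1 (h.trans (map_zero _).symm)
    have h2 := hz.2
    rw [this] at h2
    simp at h2
  refine ⟨‖chartVec e z.1 z.2‖⁻¹, by positivity, fun y hy v => ?_⟩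
  rcases eq_or_ne v 0 with rfl | hv
  · rw [norm_zero]; positivity
  have hv' : 0 < ‖v‖ := norm_pos_iff.2 hv
  have h1 : (y, ‖v‖⁻¹ • v) ∈ K ×ˢ Metric.sphere (0 : EuclideanSpace ℝ (Fin n)) 1 := by
    refine ⟨hy, ?_⟩
    simp [norm_smul, norm_ne_zero_iff.2 hv]
  have h2 : ‖chartVec e z.1 z.2‖ ≤ ‖chartVec e y (‖v‖⁻¹ • v)‖ :=
    (pow_le_pow_iff_left₀ (norm_nonneg _) (norm_nonneg _) two_ne_zero).1 (hmin h1)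
  rw [← chartVecL_apply e y, map_smul, norm_smul, norm_inv, norm_norm, chartVecL_apply] at h2
  rw [inv_mul_eq_div, le_div_iff₀ hz0]
  calc ‖v‖ * ‖chartVec e z.1 z.2‖ ≤ ‖v‖ * (‖v‖⁻¹ * ‖chartVec e y v‖) := by gcongr
    _ = _ := by field_simp

end RiemannianCharts

/-! ### The Riemannian volume in coordinates -/

section RiemannianVolume

variable {n : ℕ}
  {M : Type*} [MetricSpace M] [ChartedSpace (EuclideanSpace ℝ (Fin n)) M]
  [IsManifold (𝓡 n) ∞ M] [RiemannianBundle (fun x : M => TangentSpace (𝓡 n) x)]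

theorem inner_tangentSpace_congr {x x' : M} (h : x = x') (u v : EuclideanSpace ℝ (Fin n)) :
    @inner ℝ (TangentSpace (𝓡 n) x) _ u v = @inner ℝ (TangentSpace (𝓡 n) x') _ u v := by
  subst h
  rfl

/-- Chain rule for e⁻¹ = e'⁻¹ ∘ (e' ∘ e⁻¹) near `y`. The equality is stated in the model space
because the two vectors sit over base points that are equal only propositionally. -/
theorem chartVec_coord_change {e e' : OpenPartialHomeomorph M (EuclideanSpace ℝ (Fin n))}
    (he : e ∈ IsManifold.maximalAtlas (𝓡 n) ∞ M) (he' : e' ∈ IsManifold.maximalAtlas (𝓡 n) ∞ M)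
    {y : EuclideanSpace ℝ (Fin n)} (hy : y ∈ e.target) (hy' : e.symm y ∈ e'.source)
    (v : EuclideanSpace ℝ (Fin n)) :
    DifferentiableAt ℝ (e' ∘ e.symm) y ∧
    (chartVec e y v : EuclideanSpace ℝ (Fin n)) =
      chartVec e' (e' (e.symm y)) (fderiv ℝ (e' ∘ e.symm) y v) := by
  have h1 := mdifferentiableAt_chart_symm he hy
  have h2 : MDifferentiableAt (𝓡 n) (𝓡 n) e' (e.symm y) :=
    (isSmooth_of_mem_maximalAtlas he').mdifferentiable.mdifferentiableAt hy'
  have h3 : MDifferentiableAt (𝓡 n) (𝓡 n) (e' ∘ e.symm) y := h2.comp y h1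
  have h4 := mdifferentiableAt_chart_symm he' (e'.map_source hy')
  refine ⟨mdifferentiableAt_iff_differentiableAt.1 h3, ?_⟩
  have h5 : e.symm =ᶠ[𝓝 y] e'.symm ∘ (e' ∘ e.symm) := by
    have : e.symm ⁻¹' e'.source ∈ 𝓝 y :=
      (e.continuousAt_symm hy).preimage_mem_nhds (e'.open_source.mem_nhds hy')
    filter_upwards [this] with z hz
    exact (e'.left_inv hz).symm
  have h6 := h5.mfderiv_eq (I := 𝓡 n) (I' := 𝓡 n)
  have h7 := mfderiv_comp (I := 𝓡 n) (I' := 𝓡 n) (I'' := 𝓡 n) y h4 h3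
  rw [← mfderiv_eq_fderiv]
  exact congrArg (fun L : EuclideanSpace ℝ (Fin n) →L[ℝ] EuclideanSpace ℝ (Fin n) => L v)
    (h6.trans h7)

/-- With `J` the Jacobian matrix of the coordinate change, the Gram matrices satisfy G = Jᵀ G' J. -/
theorem gramMatrix_coord_change {e e' : OpenPartialHomeomorph M (EuclideanSpace ℝ (Fin n))}
    (he : e ∈ IsManifold.maximalAtlas (𝓡 n) ∞ M) (he' : e' ∈ IsManifold.maximalAtlas (𝓡 n) ∞ M)
    {y : EuclideanSpace ℝ (Fin n)} (hy : y ∈ e.target) (hy' : e.symm y ∈ e'.source) :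
    (gramMatrix e y).det =
      (fderiv ℝ (e' ∘ e.symm) y).det ^ 2 * (gramMatrix e' (e' (e.symm y))).det := by
  set b := (EuclideanSpace.basisFun (Fin n) ℝ).toBasis
  set J := LinearMap.toMatrix b b (fderiv ℝ (e' ∘ e.symm) y : _ →ₗ[ℝ] _) with hJ
  have hJa : ∀ a i, J a i = (fderiv ℝ (e' ∘ e.symm) y (EuclideanSpace.single i 1)) a := by
    intro a i
    simp [hJ, b, LinearMap.toMatrix_apply]
  have hbase : e.symm y = e'.symm (e' (e.symm y)) := (e'.left_inv hy').symm
  have hG : gramMatrix e y = J.transpose * gramMatrix e' (e' (e.symm y)) * J := by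
    ext i j
    have h1 : gramMatrix e y i j = inner ℝ
        (chartVec e' (e' (e.symm y)) (fderiv ℝ (e' ∘ e.symm) y (EuclideanSpace.single i 1)))
        (chartVec e' (e' (e.symm y)) (fderiv ℝ (e' ∘ e.symm) y (EuclideanSpace.single j 1))) := by
      refine Eq.trans ?_ (inner_tangentSpace_congr hbase _ _)
      simp only [gramMatrix, Matrix.of_apply]
      congr 1
      · exact (chartVec_coord_change he he' hy hy' _).2
      · exact (chartVec_coord_change he he' hy hy' _).2
    rw [h1, chartVec_eq_sum, chartVec_eq_sum _ _ (fderiv ℝ (e' ∘ e.symm) y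
      (EuclideanSpace.single j 1)), sum_inner]
    simp only [inner_sum, inner_smul_left, inner_smul_right, RCLike.conj_to_real,
      Matrix.mul_apply, Matrix.transpose_apply, hJa, Finset.sum_mul]
    rw [Finset.sum_comm]
    refine Finset.sum_congr rfl fun a _ => Finset.sum_congr rfl fun c _ => ?_
    simp only [gramMatrix, Matrix.of_apply]
    ring
  have hdet : J.det = (fderiv ℝ (e' ∘ e.symm) y).det := LinearMap.det_toMatrix b _
  rw [hG, Matrix.det_mul, Matrix.det_mul, Matrix.det_transpose, hdet]
  ring

/-- The coordinate density of the Riemannian volume. -/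
noncomputable def volumeDensity (e : OpenPartialHomeomorph M (EuclideanSpace ℝ (Fin n)))
    (y : EuclideanSpace ℝ (Fin n)) : ℝ≥0∞ :=
  ENNReal.ofReal (√ (gramMatrix e y).det)

theorem volumeDensity_ne_zero {e : OpenPartialHomeomorph M (EuclideanSpace ℝ (Fin n))}
    (he : e ∈ IsManifold.maximalAtlas (𝓡 n) ∞ M) {y : EuclideanSpace ℝ (Fin n)}
    (hy : y ∈ e.target) : volumeDensity e y ≠ 0 := by
  have := (posDef_gramMatrix he hy).det_pos
  simp [volumeDensity, this]

variable [MeasurableSpace M] [BorelSpace M]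

/-- The Riemannian volume in a chart. -/
noncomputable def chartVolume (e : OpenPartialHomeomorph M (EuclideanSpace ℝ (Fin n))) :
    Measure M :=
  e.pullMeasure ((volume : Measure (EuclideanSpace ℝ (Fin n))).withDensity (volumeDensity e))

theorem riemannianVolume_eq_iSup : riemannianVolume n M =
    ⨆ e ∈ IsManifold.maximalAtlas (𝓡 n) ∞ M, chartVolume e := by
  simp only [riemannianVolume, chartVolume, OpenPartialHomeomorph.pullMeasure]
  congr! 5 with e he
  rw [restrict_withDensity e.open_target.measurableSet]
  rfl

theorem chartVolume_apply (e : OpenPartialHomeomorph M (EuclideanSpace ℝ (Fin n)))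
    {s : Set M} (hs : MeasurableSet s) :
    chartVolume e s = ∫⁻ y in e.target ∩ e.symm ⁻¹' s, volumeDensity e y := by
  rw [chartVolume, OpenPartialHomeomorph.pullMeasure_apply, withDensity_apply]
  exact e.measurableSet_inter_preimage_symm hs

variable [IsContMDiffRiemannianBundle (𝓡 n) 1 (EuclideanSpace ℝ (Fin n))
      (fun x : M => TangentSpace (𝓡 n) x)]

/-- The Jacobian in the change of variables formula is exactly the factor relating the square roots
of the two Gram determinants. -/
theorem chartVolume_congr {e e' : OpenPartialHomeomorph M (EuclideanSpace ℝ (Fin n))}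
    (he : e ∈ IsManifold.maximalAtlas (𝓡 n) ∞ M) (he' : e' ∈ IsManifold.maximalAtlas (𝓡 n) ∞ M)
    {s : Set M} (hs : MeasurableSet s) (hse : s ⊆ e.source) (hse' : s ⊆ e'.source) :
    chartVolume e s = chartVolume e' s := by
  have hA : MeasurableSet (e.target ∩ e.symm ⁻¹' s) := e.measurableSet_inter_preimage_symm hs
  have himage : e'.target ∩ e'.symm ⁻¹' s = (e' ∘ e.symm) '' (e.target ∩ e.symm ⁻¹' s) := by
    ext z
    constructor
    · rintro ⟨hz, hzs⟩
      refine ⟨e (e'.symm z), ⟨e.map_source (hse hzs), ?_⟩, ?_⟩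
      · simpa [e.left_inv (hse hzs)] using hzs
      · simp [e.left_inv (hse hzs), e'.right_inv hz]
    · rintro ⟨y, ⟨hy, hys⟩, rfl⟩
      refine ⟨e'.map_source (hse' hys), ?_⟩
      simpa [e'.left_inv (hse' hys)] using hys
  have hinj : Set.InjOn (e' ∘ e.symm) (e.target ∩ e.symm ⁻¹' s) := by
    intro y hy z hz h
    exact e.symm.injOn hy.1 hz.1 (e'.injOn (hse' hy.2) (hse' hz.2) h)
  rw [chartVolume_apply e hs, chartVolume_apply e' hs, himage,
    lintegral_image_eq_lintegral_abs_det_fderiv_mul volume hA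
      (fun y hy => ((chartVec_coord_change he he' hy.1 (hse' hy.2) 0).1.hasFDerivAt).hasFDerivWithinAt)
      hinj]
  refine setLIntegral_congr_fun hA fun y hy => ?_
  simp only [volumeDensity, Function.comp]
  rw [gramMatrix_coord_change he he' hy.1 (hse' hy.2), Real.sqrt_mul (sq_nonneg _),
    Real.sqrt_sq_eq_abs, ENNReal.ofReal_mul (abs_nonneg _)]

/-- The measure of `e'` is carried by `e'.source`, so only the overlap of the two domains
contributes, and there both measures agree. -/
theorem restrict_source_chartVolume_le {e e' : OpenPartialHomeomorph M (EuclideanSpace ℝ (Fin n))}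
    (he : e ∈ IsManifold.maximalAtlas (𝓡 n) ∞ M) (he' : e' ∈ IsManifold.maximalAtlas (𝓡 n) ∞ M) :
    (chartVolume e').restrict e.source ≤ chartVolume e := by
  refine Measure.le_iff.2 fun s hs => ?_
  have h1 : chartVolume e' (s ∩ e.source) = chartVolume e' (s ∩ e.source ∩ e'.source) := by
    rw [chartVolume, OpenPartialHomeomorph.pullMeasure_apply,
      OpenPartialHomeomorph.pullMeasure_apply]
    congr 1
    ext y
    simp only [Set.mem_inter_iff, Set.mem_preimage]
    constructor
    · rintro ⟨a, b⟩; exact ⟨a, b, e'.map_target a⟩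
    · rintro ⟨a, b, -⟩; exact ⟨a, b⟩
  rw [Measure.restrict_apply hs, h1, ← chartVolume_congr he he'
    ((hs.inter e.open_source.measurableSet).inter e'.open_source.measurableSet)
    (fun x hx => hx.1.2) (fun x hx => hx.2)]
  exact measure_mono fun x hx => hx.1.1

/-- On the domain of a chart, the Riemannian volume is the coordinate expression. -/
theorem restrict_riemannianVolume {e : OpenPartialHomeomorph M (EuclideanSpace ℝ (Fin n))}
    (he : e ∈ IsManifold.maximalAtlas (𝓡 n) ∞ M) :
    (riemannianVolume n M).restrict e.source = chartVolume e := by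
  have hm := e.open_source.measurableSet
  rw [riemannianVolume_eq_iSup]
  apply le_antisymm
  -- A supremum of measures does not restrict termwise for free. Adding infinite mass outside
  -- `e.source` gives one measure dominating every chart volume, and this mass disappears after
  -- restriction to `e.source`.
  · have h1 : (⨆ e ∈ IsManifold.maximalAtlas (𝓡 n) ∞ M, chartVolume e) ≤
        chartVolume e + (⊤ : Measure M).restrict e.sourceᶜ := by
      refine iSup₂_le fun e' he' => ?_
      rw [← Measure.restrict_add_restrict_compl (μ := chartVolume e') hm]
      exact add_le_add (restrict_source_chartVolume_le he he') (Measure.restrict_mono le_rfl le_top)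
    refine (Measure.restrict_mono le_rfl h1).trans ?_
    rw [Measure.restrict_add, Measure.restrict_restrict hm]
    simp [Measure.restrict_le_self]
  · conv_lhs => rw [chartVolume, ← OpenPartialHomeomorph.restrict_pullMeasure_source]
    exact Measure.restrict_mono le_rfl (le_iSup₂ (f := fun e (_ : e ∈
      IsManifold.maximalAtlas (𝓡 n) ∞ M) => chartVolume e) e he)

theorem riemannianVolume_apply_of_subset_source
    {e : OpenPartialHomeomorph M (EuclideanSpace ℝ (Fin n))}
    (he : e ∈ IsManifold.maximalAtlas (𝓡 n) ∞ M) {s : Set M} (hs : MeasurableSet s)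
    (hse : s ⊆ e.source) :
    riemannianVolume n M s = ∫⁻ y in e.target ∩ e.symm ⁻¹' s, volumeDensity e y := by
  rw [← chartVolume_apply e hs, ← restrict_riemannianVolume he, Measure.restrict_apply hs,
    Set.inter_eq_self_of_subset_left hse]

theorem aemeasurable_volumeDensity {e : OpenPartialHomeomorph M (EuclideanSpace ℝ (Fin n))}
    (he : e ∈ IsManifold.maximalAtlas (𝓡 n) ∞ M) :
    AEMeasurable (volumeDensity e) (volume.restrict e.target) :=
  (ENNReal.continuous_ofReal.comp_continuousOn
    (Real.continuous_sqrt.comp_continuousOn (continuousOn_det_gramMatrix he))).aemeasurable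
    e.open_target.measurableSet

/-- Null sets of the Riemannian volume are null in every chart. -/
theorem ae_chart_iff {e : OpenPartialHomeomorph M (EuclideanSpace ℝ (Fin n))}
    (he : e ∈ IsManifold.maximalAtlas (𝓡 n) ∞ M) (P : M → Prop) :
    (∀ᵐ x ∂(riemannianVolume n M).restrict e.source, P x) ↔
      ∀ᵐ y ∂volume.restrict e.target, P (e.symm y) := by
  rw [restrict_riemannianVolume he, chartVolume, OpenPartialHomeomorph.ae_pullMeasure_iff,
    restrict_withDensity e.open_target.measurableSet,
    ae_withDensity_iff' (aemeasurable_volumeDensity he)]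
  have h := ae_restrict_mem (μ := (volume : Measure (EuclideanSpace ℝ (Fin n))))
    e.open_target.measurableSet
  constructor <;> intro H <;> filter_upwards [H, h] with y hy hy'
  · exact hy (volumeDensity_ne_zero he hy')
  · exact fun _ => hy

theorem aestronglyMeasurable_chart {e : OpenPartialHomeomorph M (EuclideanSpace ℝ (Fin n))}
    (he : e ∈ IsManifold.maximalAtlas (𝓡 n) ∞ M) {g : M → ℝ}
    (hg : AEStronglyMeasurable (fun y => g (e.symm y)) (volume.restrict e.target)) :
    AEStronglyMeasurable g ((riemannianVolume n M).restrict e.source) := by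
  rw [restrict_riemannianVolume he, chartVolume,
    OpenPartialHomeomorph.aestronglyMeasurable_pullMeasure_iff,
    restrict_withDensity e.open_target.measurableSet]
  exact hg.mono_ac (withDensity_absolutelyContinuous _ _)

variable (n M) in
theorem isLocallyFiniteMeasure_riemannianVolume :
    IsLocallyFiniteMeasure (riemannianVolume n M) := by
  refine ⟨fun x => ?_⟩
  set e := chartAt (EuclideanSpace ℝ (Fin n)) x
  have he : e ∈ IsManifold.maximalAtlas (𝓡 n) ∞ M := IsManifold.chart_mem_maximalAtlas x
  have hx : x ∈ e.source := mem_chart_source _ x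
  have hc : ContinuousAt (fun y => √ (gramMatrix e y).det) (e x) :=
    (Real.continuous_sqrt.comp_continuousOn (continuousOn_det_gramMatrix he)).continuousAt
      (e.open_target.mem_nhds (e.map_source hx))
  obtain ⟨O, hOs, hO, hxO⟩ := mem_nhds_iff.1 (hc.eventually (gt_mem_nhds (lt_add_one _)))
  obtain ⟨r, hr, hball⟩ := Metric.isOpen_iff.1 (hO.inter e.open_target) (e x)
    ⟨hxO, e.map_source hx⟩
  have hopen : IsOpen (e.source ∩ e ⁻¹' Metric.ball (e x) r) :=
    e.isOpen_inter_preimage Metric.isOpen_ball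
  refine ⟨_, hopen.mem_nhds ⟨hx, Metric.mem_ball_self hr⟩, ?_⟩
  rw [riemannianVolume_apply_of_subset_source he hopen.measurableSet Set.inter_subset_left]
  have hsub : e.target ∩ e.symm ⁻¹' (e.source ∩ e ⁻¹' Metric.ball (e x) r) ⊆
      Metric.ball (e x) r := by
    rintro y ⟨hy, -, hy2⟩
    simpa [e.right_inv hy] using hy2
  calc _ ≤ ∫⁻ y in Metric.ball (e x) r, volumeDensity e y := lintegral_mono_set hsub
    _ ≤ ∫⁻ y in Metric.ball (e x) r, ENNReal.ofReal (√ (gramMatrix e (e x)).det + 1) := by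
        refine setLIntegral_mono measurable_const fun y hy => ?_
        exact ENNReal.ofReal_le_ofReal (hOs (hball hy).1).le
    _ < ⊤ := by
        rw [setLIntegral_const]
        exact ENNReal.mul_lt_top ENNReal.ofReal_lt_top measure_ball_lt_top

theorem riemannianVolume_lt_top {K : Set M} (hK : IsCompact K) : riemannianVolume n M K < ⊤ :=
  have := isLocallyFiniteMeasure_riemannianVolume n M
  hK.measure_lt_top

/-- Measurability can be checked in small charts. -/
theorem aestronglyMeasurable_of_charts {O : Set M} (hO : IsOpen O) {g : M → ℝ}
    (hg : ∀ e ∈ IsManifold.maximalAtlas (𝓡 n) ∞ M, e.source ⊆ O →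
      AEStronglyMeasurable (fun y => g (e.symm y)) (volume.restrict e.target))
    {K : Set M} (hK : IsCompact K) (hKO : K ⊆ O) :
    AEStronglyMeasurable g ((riemannianVolume n M).restrict K) := by
  have hloc : ∀ x ∈ O, ∃ U ∈ 𝓝 x, AEStronglyMeasurable g ((riemannianVolume n M).restrict U) := by
    intro x hx
    set e := (chartAt (EuclideanSpace ℝ (Fin n)) x).restr O with hedef
    have he : e ∈ IsManifold.maximalAtlas (𝓡 n) ∞ M :=
      restr_mem_maximalAtlas_of_isOpen (IsManifold.chart_mem_maximalAtlas x) hO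
    have hsrc : e.source = (chartAt (EuclideanSpace ℝ (Fin n)) x).source ∩ O := by
      rw [hedef, OpenPartialHomeomorph.restr_source, hO.interior_eq]
    refine ⟨e.source, e.open_source.mem_nhds (by rw [hsrc]; exact ⟨mem_chart_source _ x, hx⟩), ?_⟩
    exact aestronglyMeasurable_chart he (hg e he (by rw [hsrc]; exact Set.inter_subset_right))
  choose! U hU hgU using hloc
  obtain ⟨t, hcov⟩ := hK.elim_nhds_subcover' (fun x _ => U x) (fun x hx => hU x (hKO hx))
  refine AEStronglyMeasurable.mono_set hcov ?_
  have heq : ⋃ x ∈ t, U (x : M) = ⋃ x : t, U (x.1 : M) := by ext; simp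
  rw [heq, aestronglyMeasurable_iUnion_iff]
  exact fun x => hgU _ (hKO x.1.2)

end RiemannianVolume

/-! ### Measurable vector fields -/

section MeasurableFields

variable {n : ℕ}
  {M : Type*} [MetricSpace M] [ChartedSpace (EuclideanSpace ℝ (Fin n)) M]
  [IsManifold (𝓡 n) ∞ M] [RiemannianBundle (fun x : M => TangentSpace (𝓡 n) x)]

/-- The coordinate formula g^{ij} X_i Y_j for covariant components. The inverse matrix is written
through the determinant and the adjugate, whose continuity in `y` is immediate. -/
theorem inner_eq_sum_inv_gramMatrix {e : OpenPartialHomeomorph M (EuclideanSpace ℝ (Fin n))}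
    (he : e ∈ IsManifold.maximalAtlas (𝓡 n) ∞ M) (X Y : ∀ x : M, TangentSpace (𝓡 n) x)
    {y : EuclideanSpace ℝ (Fin n)} (hy : y ∈ e.target) :
    inner ℝ (X (e.symm y)) (Y (e.symm y)) = ∑ j, ∑ i,
      chartPairing e X y (EuclideanSpace.single i 1) *
        ((gramMatrix e y).det⁻¹ * (gramMatrix e y).adjugate i j) *
        chartPairing e Y y (EuclideanSpace.single j 1) := by
  obtain ⟨a, ha⟩ := exists_chartVec_eq he hy (X (e.symm y))
  have hdet := (posDef_gramMatrix he hy).det_pos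
  set p : Fin n → ℝ := fun i => chartPairing e X y (EuclideanSpace.single i 1) with hp
  have h1 : p = Matrix.vecMul a (gramMatrix e y) := by
    ext j
    simp only [hp, chartPairing, Matrix.vecMul, dotProduct, gramMatrix, Matrix.of_apply]
    rw [← ha, chartVec_eq_sum, sum_inner]
    simp [inner_smul_left]
  have h2 : a = Matrix.vecMul p (gramMatrix e y)⁻¹ := by
    rw [h1, Matrix.vecMul_vecMul, Matrix.mul_nonsing_inv _ (isUnit_iff_ne_zero.2 hdet.ne'),
      Matrix.vecMul_one]
  have h3 : inner ℝ (X (e.symm y)) (Y (e.symm y)) =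
      ∑ j, a j * chartPairing e Y y (EuclideanSpace.single j 1) := by
    rw [← ha, chartVec_eq_sum, sum_inner]
    refine Finset.sum_congr rfl fun j _ => ?_
    rw [inner_smul_left, chartPairing, real_inner_comm]
    rfl
  rw [h3]
  refine Finset.sum_congr rfl fun j _ => ?_
  rw [h2]
  simp only [Matrix.vecMul, dotProduct, Finset.sum_mul, Matrix.inv_def, Ring.inverse_eq_inv',
    Matrix.smul_apply, smul_eq_mul, hp]

variable [IsContMDiffRiemannianBundle (𝓡 n) 1 (EuclideanSpace ℝ (Fin n))
      (fun x : M => TangentSpace (𝓡 n) x)]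

/-- The components of the vector field `X` in the charts with domain in `O` are measurable. -/
def IsMeasurableFieldOn (O : Set M) (X : ∀ x : M, TangentSpace (𝓡 n) x) : Prop :=
  ∀ e ∈ IsManifold.maximalAtlas (𝓡 n) ∞ M, e.source ⊆ O → ∀ v : EuclideanSpace ℝ (Fin n),
    AEStronglyMeasurable (fun y => chartPairing e X y v) (volume.restrict e.target)

theorem IsMeasurableField.on {X : ∀ x : M, TangentSpace (𝓡 n) x} (hX : IsMeasurableField X)
    (O : Set M) : IsMeasurableFieldOn O X := fun e he _ v => hX e he v

theorem IsMeasurableFieldOn.sub {O : Set M} {X Y : ∀ x : M, TangentSpace (𝓡 n) x}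
    (hX : IsMeasurableFieldOn O X) (hY : IsMeasurableFieldOn O Y) :
    IsMeasurableFieldOn O (fun x => X x - Y x) := fun e he hO v => by
  simp only [chartPairing, inner_sub_left]
  exact (hX e he hO v).sub (hY e he hO v)

theorem aestronglyMeasurable_inner_chart
    {e : OpenPartialHomeomorph M (EuclideanSpace ℝ (Fin n))}
    (he : e ∈ IsManifold.maximalAtlas (𝓡 n) ∞ M) {X Y : ∀ x : M, TangentSpace (𝓡 n) x}
    (hX : ∀ v, AEStronglyMeasurable (fun y => chartPairing e X y v) (volume.restrict e.target))
    (hY : ∀ v, AEStronglyMeasurable (fun y => chartPairing e Y y v) (volume.restrict e.target)) :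
    AEStronglyMeasurable (fun y => (inner ℝ (X (e.symm y)) (Y (e.symm y)) : ℝ))
      (volume.restrict e.target) := by
  have hm := e.open_target.measurableSet
  have h : AEStronglyMeasurable (fun y => ∑ j, ∑ i,
      chartPairing e X y (EuclideanSpace.single i 1) *
        ((gramMatrix e y).det⁻¹ * (gramMatrix e y).adjugate i j) *
        chartPairing e Y y (EuclideanSpace.single j 1)) (volume.restrict e.target) := by
    refine Finset.aestronglyMeasurable_fun_sum _ fun j _ =>
      Finset.aestronglyMeasurable_fun_sum _ fun i _ => ((hX _).mul ?_).mul (hY _)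
    refine ContinuousOn.aestronglyMeasurable (ContinuousOn.mul ?_ ?_) hm
    · exact (continuousOn_det_gramMatrix he).inv₀ fun y hy => (posDef_gramMatrix he hy).det_pos.ne'
    · exact ((continuous_apply j).comp (continuous_apply i)).comp_continuousOn
        (continuous_id.matrix_adjugate.comp_continuousOn (continuousOn_gramMatrix he))
  refine h.congr ?_
  filter_upwards [ae_restrict_mem hm] with y hy
  exact (inner_eq_sum_inv_gramMatrix he X Y hy).symm

variable [MeasurableSpace M] [BorelSpace M]

theorem IsMeasurableFieldOn.aestronglyMeasurable_inner {O : Set M} (hO : IsOpen O)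
    {X Y : ∀ x : M, TangentSpace (𝓡 n) x}
    (hX : IsMeasurableFieldOn O X) (hY : IsMeasurableFieldOn O Y)
    {K : Set M} (hK : IsCompact K) (hKO : K ⊆ O) :
    AEStronglyMeasurable (fun x => (inner ℝ (X x) (Y x) : ℝ))
      ((riemannianVolume n M).restrict K) :=
  aestronglyMeasurable_of_charts hO (fun e he heO =>
    aestronglyMeasurable_inner_chart he (hX e he heO) (hY e he heO)) hK hKO

theorem IsMeasurableFieldOn.aestronglyMeasurable_norm {O : Set M} (hO : IsOpen O)
    {X : ∀ x : M, TangentSpace (𝓡 n) x} (hX : IsMeasurableFieldOn O X)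
    {K : Set M} (hK : IsCompact K) (hKO : K ⊆ O) :
    AEStronglyMeasurable (fun x => ‖X x‖) ((riemannianVolume n M).restrict K) := by
  have h := Real.continuous_sqrt.comp_aestronglyMeasurable
    (hX.aestronglyMeasurable_inner hO hX hK hKO)
  refine h.congr (Eventually.of_forall fun x => ?_)
  simp [Real.sqrt_sq]

theorem isMeasurableFieldOn_pullbackGrad
    {M' : Type*} [MetricSpace M'] [ChartedSpace (EuclideanSpace ℝ (Fin n)) M']
    [IsManifold (𝓡 n) ∞ M'] [RiemannianBundle (fun x : M' => TangentSpace (𝓡 n) x)]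
    {Φ : OpenPartialHomeomorph M M'} (hΦ : Φ.IsSmooth n) {X : ∀ x : M', TangentSpace (𝓡 n) x}
    (hX : IsMeasurableField X) : IsMeasurableFieldOn Φ.source (pullbackGrad Φ X) := by
  intro e he heO v
  have h := hX _ (symm_trans_mem_maximalAtlas hΦ he) v
  have ht : (Φ.symm ≫ₕ e).target = e.target := by
    simp only [OpenPartialHomeomorph.trans_target, OpenPartialHomeomorph.symm_target]
    exact Set.inter_eq_left.2 fun y hy => heO (e.map_target hy)
  rw [ht] at h
  refine h.congr ?_
  filter_upwards [ae_restrict_mem e.open_target.measurableSet] with y hy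
  exact chartPairing_symm_trans hΦ he hy (heO (e.map_target hy)) X v

end MeasurableFields

/-! ### Local integrability and cutoffs in Euclidean space -/

section EuclideanCutoff

variable {F : Type*} [NormedAddCommGroup F] [InnerProductSpace ℝ F] [FiniteDimensional ℝ F]
  [MeasurableSpace F] [BorelSpace F]

theorem integrable_mul_of_tsupport_subset {T : Set F} {g b : F → ℝ}
    (hg : LocallyIntegrableOn g T) (hb : Continuous b) (hbc : HasCompactSupport b)
    (hbT : tsupport b ⊆ T) : Integrable (fun y => g y * b y) := by
  have h1 : IntegrableOn (fun y => g y * b y) (tsupport b) :=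
    (hg.integrableOn_compact_subset hbT hbc).mul_continuousOn hb.continuousOn hbc
  refine (integrableOn_iff_integrable_of_support_subset ?_).1 h1
  intro y hy
  refine subset_tsupport b fun h => hy ?_
  simp [h]

/-- Extension by zero: `g` need only be controlled on `T`, since at points of `S` outside `T` the
product vanishes in a whole neighbourhood. -/
theorem locallyIntegrableOn_mul_of_eventually_eq_zero {T S : Set F} (hT : IsOpen T) (hS : IsOpen S)
    {g c : F → ℝ} (hg : LocallyIntegrableOn g T) (hc : ContinuousOn c S)
    (h0 : ∀ y ∈ S, y ∉ T → c =ᶠ[𝓝 y] 0) : LocallyIntegrableOn (fun y => c y * g y) S := by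
  intro y hy
  by_cases hyT : y ∈ T
  · have h1 : LocallyIntegrableOn (fun y => c y * g y) (T ∩ S) :=
      (hg.mono_set Set.inter_subset_left).continuousOn_mul (hc.mono Set.inter_subset_right)
        (hT.inter hS).isLocallyClosed
    have h2 := h1 y ⟨hyT, hy⟩
    rwa [(hT.inter hS).nhdsWithin_eq ⟨hyT, hy⟩, ← hS.nhdsWithin_eq hy] at h2
  · obtain ⟨U, hU, hUo, hyU⟩ := eventually_nhds_iff.1 (h0 y hy hyT)
    refine ⟨U, mem_nhdsWithin_of_mem_nhds (hUo.mem_nhds hyU), ?_⟩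
    refine (integrableOn_zero (ε' := ℝ)).congr_fun (fun z hz => ?_) hUo.measurableSet
    have := hU z hz
    simp [this]

/-- Integration by parts against the constant 1. This is what allows additive constants in weak
gradients. -/
theorem integral_fderiv_apply_eq_zero {u : F → ℝ} (hu : ContDiff ℝ ∞ u)
    (huc : HasCompactSupport u) (v : F) : ∫ y, fderiv ℝ u y v = 0 := by
  have hd : Continuous fun y => fderiv ℝ u y v := (hu.continuous_fderiv (by simp)).clm_apply
    continuous_const
  have hdc : HasCompactSupport fun y => fderiv ℝ u y v := huc.fderiv_apply (𝕜 := ℝ) v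
  have h := integral_mul_fderiv_eq_neg_fderiv_mul_of_integrable (𝕜 := ℝ) (μ := volume)
    (f := fun _ => (1 : ℝ)) (g := u) (v := v) (by simp)
    (by simpa using hd.integrable_of_hasCompactSupport hdc)
    (by simpa using hu.continuous.integrable_of_hasCompactSupport huc)
    (by fun_prop) (fun x _ => hu.differentiable (by simp) x)
  simpa using h

end EuclideanCutoff

/-! ### Calculus of weak gradients -/

section WeakGradient

variable {n : ℕ}
  {M : Type*} [MetricSpace M] [ChartedSpace (EuclideanSpace ℝ (Fin n)) M]
  [IsManifold (𝓡 n) ∞ M] [RiemannianBundle (fun x : M => TangentSpace (𝓡 n) x)]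

/-- `X` is the weak gradient of `f` in all charts with domain in `O`. -/
structure HasWeakGradientOn (O : Set M) (f : M → ℝ) (X : ∀ x : M, TangentSpace (𝓡 n) x) :
    Prop where
  locallyIntegrable : ∀ e ∈ IsManifold.maximalAtlas (𝓡 n) ∞ M, e.source ⊆ O →
    LocallyIntegrableOn (fun y => f (e.symm y)) e.target
  locallyIntegrable_grad : ∀ e ∈ IsManifold.maximalAtlas (𝓡 n) ∞ M, e.source ⊆ O →
    ∀ v : EuclideanSpace ℝ (Fin n),
      LocallyIntegrableOn (fun y => chartPairing e X y v) e.target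
  integral_eq : ∀ e ∈ IsManifold.maximalAtlas (𝓡 n) ∞ M, e.source ⊆ O →
    ∀ u : EuclideanSpace ℝ (Fin n) → ℝ,
    ContDiff ℝ ∞ u → HasCompactSupport u → tsupport u ⊆ e.target →
    ∀ v : EuclideanSpace ℝ (Fin n),
      ∫ y, f (e.symm y) * fderiv ℝ u y v = - ∫ y, chartPairing e X y v * u y

theorem HasWeakGradient.on {f : M → ℝ} {X : ∀ x : M, TangentSpace (𝓡 n) x}
    (h : HasWeakGradient f X) (O : Set M) : HasWeakGradientOn O f X :=
  ⟨fun e he _ => h.1 e he, fun e he _ => h.2 e he, fun e he _ => h.3 e he⟩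

theorem HasWeakGradient.isMeasurableField {f : M → ℝ} {X : ∀ x : M, TangentSpace (𝓡 n) x}
    (h : HasWeakGradient f X) : IsMeasurableField X := fun e he v =>
  (h.locallyIntegrable_grad e he v).aestronglyMeasurable

/-- A chart `e` inside `Φ.source` is transported to the chart `Φ.symm ≫ₕ e` of `M'`. In it the
function and the paired components have the same coordinate expressions, so the defining identities
carry over. -/
theorem HasWeakGradientOn.pullback
    {M' : Type*} [MetricSpace M'] [ChartedSpace (EuclideanSpace ℝ (Fin n)) M']
    [IsManifold (𝓡 n) ∞ M'] [RiemannianBundle (fun x : M' => TangentSpace (𝓡 n) x)]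
    {Φ : OpenPartialHomeomorph M M'} (hΦ : Φ.IsSmooth n) {f : M' → ℝ}
    {X : ∀ x : M', TangentSpace (𝓡 n) x} (h : HasWeakGradientOn Φ.target f X) :
    HasWeakGradientOn Φ.source (fun x => f (Φ x)) (pullbackGrad Φ X) := by
  have ht : ∀ e : OpenPartialHomeomorph M (EuclideanSpace ℝ (Fin n)), e.source ⊆ Φ.source →
      (Φ.symm ≫ₕ e).target = e.target := by
    intro e heO
    simp only [OpenPartialHomeomorph.trans_target, OpenPartialHomeomorph.symm_target]
    exact Set.inter_eq_left.2 fun y hy => heO (e.map_target hy)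
  have hs : ∀ e : OpenPartialHomeomorph M (EuclideanSpace ℝ (Fin n)),
      (Φ.symm ≫ₕ e).source ⊆ Φ.target := by
    intro e x hx
    simp at hx
    exact hx.1
  refine ⟨fun e he heO => ?_, fun e he heO v => ?_, fun e he heO u hu huc hue v => ?_⟩
  · have := h.locallyIntegrable _ (symm_trans_mem_maximalAtlas hΦ he) (hs e)
    rwa [ht e heO] at this
  · have := h.locallyIntegrable_grad _ (symm_trans_mem_maximalAtlas hΦ he) (hs e) v
    rw [ht e heO] at this
    refine this.congr ?_
    filter_upwards [ae_restrict_mem e.open_target.measurableSet] with y hy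
    exact chartPairing_symm_trans hΦ he hy (heO (e.map_target hy)) X v
  · have := h.integral_eq _ (symm_trans_mem_maximalAtlas hΦ he) (hs e) u hu huc
      (by rwa [ht e heO]) v
    refine this.trans ?_
    congr 2
    ext y
    by_cases hy : y ∈ tsupport u
    · rw [chartPairing_symm_trans hΦ he (hue hy) (heO (e.map_target (hue hy)))]
    · rw [image_eq_zero_of_notMem_tsupport hy]
      simp

/-- The form is the one of the test function, ε - s (f' - f): a constant plus a combination of two
functions. -/
theorem HasWeakGradientOn.const_add_smul_add_smul {O : Set M} {f g : M → ℝ}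
    {X Y : ∀ x : M, TangentSpace (𝓡 n) x} (hf : HasWeakGradientOn O f X)
    (hg : HasWeakGradientOn O g Y) (c a b : ℝ) :
    HasWeakGradientOn O (fun x => c + (a * f x + b * g x)) (fun x => a • X x + b • Y x) := by
  have hp : ∀ (e : OpenPartialHomeomorph M (EuclideanSpace ℝ (Fin n))) y v,
      chartPairing e (fun x => a • X x + b • Y x) y v =
        a * chartPairing e X y v + b * chartPairing e Y y v := by
    intro e y v
    simp [chartPairing, inner_add_left, inner_smul_left]
  refine ⟨fun e he heO => ?_, fun e he heO v => ?_, fun e he heO u hu huc hue v => ?_⟩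
  · exact (locallyIntegrableOn_const c).add (((hf.1 e he heO).smul a).add ((hg.1 e he heO).smul b))
  · simp only [hp]
    exact ((hf.2 e he heO v).smul a).add ((hg.2 e he heO v).smul b)
  · have hdu : Continuous fun y => fderiv ℝ u y v := (hu.continuous_fderiv (by simp)).clm_apply
      continuous_const
    have hduc : HasCompactSupport fun y => fderiv ℝ u y v := huc.fderiv_apply (𝕜 := ℝ) v
    have hdut : (tsupport fun y => fderiv ℝ u y v) ⊆ e.target :=
      (tsupport_fderiv_apply_subset ℝ v).trans hue
    have i1 := integrable_mul_of_tsupport_subset (hf.1 e he heO) hdu hduc hdut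
    have i2 := integrable_mul_of_tsupport_subset (hg.1 e he heO) hdu hduc hdut
    have i3 := integrable_mul_of_tsupport_subset (hf.2 e he heO v) hu.continuous huc hue
    have i4 := integrable_mul_of_tsupport_subset (hg.2 e he heO v) hu.continuous huc hue
    have i5 := hdu.integrable_of_hasCompactSupport (μ := volume) hduc
    simp only [hp, add_mul, mul_assoc]
    have i12 : Integrable (fun y => a * (f (e.symm y) * fderiv ℝ u y v) +
        b * (g (e.symm y) * fderiv ℝ u y v)) := (i1.const_mul a).add (i2.const_mul b)
    rw [integral_add (i5.const_mul c) i12,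
      integral_add (i1.const_mul a) (i2.const_mul b),
      integral_add (i3.const_mul a) (i4.const_mul b)]
    simp only [integral_const_mul]
    rw [integral_fderiv_apply_eq_zero hu huc, hf.3 e he heO u hu huc hue,
      hg.3 e he heO u hu huc hue]
    ring

/-- The differential of a real function as a covector. -/
noncomputable def differentialCovector (χ : M → ℝ) (x : M) : TangentSpace (𝓡 n) x →L[ℝ] ℝ :=
  mfderiv (𝓡 n) 𝓘(ℝ, ℝ) χ x

/-- The gradient of a differentiable function. -/
noncomputable def manifoldGrad (χ : M → ℝ) (x : M) : TangentSpace (𝓡 n) x :=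
  haveI := completeSpace_tangentSpace (n := n) x
  (InnerProductSpace.toDual ℝ (TangentSpace (𝓡 n) x)).symm (differentialCovector χ x)

theorem inner_manifoldGrad (χ : M → ℝ) (x : M) (v : TangentSpace (𝓡 n) x) :
    inner ℝ (manifoldGrad χ x) v = (mfderiv (𝓡 n) 𝓘(ℝ, ℝ) χ x v : ℝ) := by
  have := completeSpace_tangentSpace (n := n) x
  simp only [manifoldGrad]
  rw [InnerProductSpace.toDual_symm_apply]
  rfl

theorem contDiffOn_comp_chart_symm {χ : M → ℝ} (hχ : ContMDiff (𝓡 n) 𝓘(ℝ, ℝ) ∞ χ)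
    {e : OpenPartialHomeomorph M (EuclideanSpace ℝ (Fin n))}
    (he : e ∈ IsManifold.maximalAtlas (𝓡 n) ∞ M) :
    ContDiffOn ℝ ∞ (fun y => χ (e.symm y)) e.target :=
  contMDiffOn_iff_contDiffOn.1 (hχ.comp_contMDiffOn (contMDiffOn_symm_of_mem_maximalAtlas he))

theorem chartPairing_manifoldGrad {χ : M → ℝ} (hχ : ContMDiff (𝓡 n) 𝓘(ℝ, ℝ) ∞ χ)
    {e : OpenPartialHomeomorph M (EuclideanSpace ℝ (Fin n))}
    (he : e ∈ IsManifold.maximalAtlas (𝓡 n) ∞ M) {y : EuclideanSpace ℝ (Fin n)}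
    (hy : y ∈ e.target) (v : EuclideanSpace ℝ (Fin n)) :
    chartPairing e (manifoldGrad χ) y v = fderiv ℝ (fun y => χ (e.symm y)) y v := by
  rw [chartPairing, inner_manifoldGrad, ← mfderiv_eq_fderiv]
  exact (congrArg (fun L : EuclideanSpace ℝ (Fin n) →L[ℝ] ℝ => L v)
    (mfderiv_comp (I' := 𝓡 n) y (hχ.mdifferentiableAt (by simp))
      (mdifferentiableAt_chart_symm he hy))).symm

/-- Multiplication of a test function in a chart by a smooth cutoff. -/
theorem testFunction_mul_cutoff {χ : M → ℝ} (hχ : ContMDiff (𝓡 n) 𝓘(ℝ, ℝ) ∞ χ)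
    {O : Set M} (hχO : tsupport χ ⊆ O)
    {e : OpenPartialHomeomorph M (EuclideanSpace ℝ (Fin n))}
    (he : e ∈ IsManifold.maximalAtlas (𝓡 n) ∞ M) {u : EuclideanSpace ℝ (Fin n) → ℝ}
    (hu : ContDiff ℝ ∞ u) (huc : HasCompactSupport u) (hue : tsupport u ⊆ e.target) :
    ContDiff ℝ ∞ (fun y => χ (e.symm y) * u y) ∧
    HasCompactSupport (fun y => χ (e.symm y) * u y) ∧
    tsupport (fun y => χ (e.symm y) * u y) ⊆ e.target ∩ e.symm ⁻¹' O := by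
  have hsub : tsupport (fun y => χ (e.symm y) * u y) ⊆ tsupport u := tsupport_mul_subset_right
  refine ⟨?_, huc.mul_left, fun y hy => ⟨hue (hsub hy), ?_⟩⟩
  · rw [contDiff_iff_contDiffAt]
    intro y
    by_cases hy : y ∈ tsupport u
    · exact ((contDiffOn_comp_chart_symm hχ he).contDiffAt (e.open_target.mem_nhds (hue hy))).mul
        hu.contDiffAt
    · have h0 : (fun y => χ (e.symm y) * u y) =ᶠ[𝓝 y] fun _ => 0 := by
        filter_upwards [(isClosed_tsupport u).isOpen_compl.mem_nhds hy] with z hz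
        rw [image_eq_zero_of_notMem_tsupport hz, mul_zero]
      exact contDiffAt_const.congr_of_eventuallyEq h0
  · apply hχO
    by_contra hnot
    have hy' := hue (hsub hy)
    have h0 : (fun y => χ (e.symm y) * u y) =ᶠ[𝓝 y] 0 := by
      filter_upwards [(e.continuousAt_symm hy').preimage_mem_nhds
        ((isClosed_tsupport χ).isOpen_compl.mem_nhds hnot)] with z hz
      rw [image_eq_zero_of_notMem_tsupport hz, zero_mul]
      rfl
    exact notMem_tsupport_iff_eventuallyEq.2 h0 hy

/-- The product of a smooth cutoff supported in `O` and of a function with a weak gradient on `O`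
has a weak gradient. -/
theorem HasWeakGradientOn.cutoff_mul {O : Set M} (hO : IsOpen O) {g : M → ℝ}
    {X : ∀ x : M, TangentSpace (𝓡 n) x} (h : HasWeakGradientOn O g X) {χ : M → ℝ}
    (hχ : ContMDiff (𝓡 n) 𝓘(ℝ, ℝ) ∞ χ) (hχO : tsupport χ ⊆ O) :
    HasWeakGradient (fun x => χ x * g x) (fun x => χ x • X x + g x • manifoldGrad χ x) := by
  -- The hypothesis concerns only charts with domain in `O`, so every chart is cut down to `O`,
  -- where the cutoff has its support.
  have hr : ∀ e ∈ IsManifold.maximalAtlas (𝓡 n) ∞ M,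
      e.restr O ∈ IsManifold.maximalAtlas (𝓡 n) ∞ M ∧ (e.restr O).source ⊆ O ∧
      (e.restr O).target = e.target ∩ e.symm ⁻¹' O := by
    intro e he
    refine ⟨restr_mem_maximalAtlas_of_isOpen he hO, ?_, ?_⟩
    · rw [e.restr_source, hO.interior_eq]; exact Set.inter_subset_right
    · rw [OpenPartialHomeomorph.restr_target, hO.interior_eq]
  have hTopen : ∀ e ∈ IsManifold.maximalAtlas (𝓡 n) ∞ M, IsOpen (e.target ∩ e.symm ⁻¹' O) :=
    fun e he => by rw [← (hr e he).2.2]; exact (e.restr O).open_target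
  have hg : ∀ e ∈ IsManifold.maximalAtlas (𝓡 n) ∞ M,
      LocallyIntegrableOn (fun y => g (e.symm y)) (e.target ∩ e.symm ⁻¹' O) := fun e he => by
    have := h.1 _ (hr e he).1 (hr e he).2.1
    rwa [(hr e he).2.2] at this
  have hX : ∀ e ∈ IsManifold.maximalAtlas (𝓡 n) ∞ M, ∀ v,
      LocallyIntegrableOn (fun y => chartPairing e X y v) (e.target ∩ e.symm ⁻¹' O) :=
    fun e he v => by
      have := h.2 _ (hr e he).1 (hr e he).2.1 v
      rwa [(hr e he).2.2] at this
  have h0 : ∀ e : OpenPartialHomeomorph M (EuclideanSpace ℝ (Fin n)), ∀ y ∈ e.target,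
      y ∉ e.target ∩ e.symm ⁻¹' O → (fun y => χ (e.symm y)) =ᶠ[𝓝 y] 0 := by
    intro e y hy hyO
    have hnot : e.symm y ∉ tsupport χ := fun hh => hyO ⟨hy, hχO hh⟩
    filter_upwards [(e.continuousAt_symm hy).preimage_mem_nhds
        ((isClosed_tsupport χ).isOpen_compl.mem_nhds hnot)] with z hz
    exact image_eq_zero_of_notMem_tsupport hz
  have hp : ∀ e ∈ IsManifold.maximalAtlas (𝓡 n) ∞ M, ∀ y ∈ e.target, ∀ v,
      chartPairing e (fun x => χ x • X x + g x • manifoldGrad χ x) y v =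
        χ (e.symm y) * chartPairing e X y v +
          fderiv ℝ (fun y => χ (e.symm y)) y v * g (e.symm y) := by
    intro e he y hy v
    rw [← chartPairing_manifoldGrad hχ he hy]
    simp only [chartPairing, inner_add_left, inner_smul_left, RCLike.conj_to_real]
    ring
  refine ⟨fun e he => ?_, fun e he v => ?_, fun e he u hu huc hue v => ?_⟩
  · exact locallyIntegrableOn_mul_of_eventually_eq_zero (hTopen e he) e.open_target (hg e he)
      (contDiffOn_comp_chart_symm hχ he).continuousOn (h0 e)
  · have h1 := locallyIntegrableOn_mul_of_eventually_eq_zero (hTopen e he) e.open_target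
      (hX e he v) (contDiffOn_comp_chart_symm hχ he).continuousOn (h0 e)
    have h2 := locallyIntegrableOn_mul_of_eventually_eq_zero (hTopen e he) e.open_target (hg e he)
      (c := fun y => fderiv ℝ (fun y => χ (e.symm y)) y v)
      (((contDiffOn_comp_chart_symm hχ he).continuousOn_fderiv_of_isOpen e.open_target
        (by simp)).clm_apply continuousOn_const)
      (fun y hy hyO => by
        filter_upwards [(h0 e y hy hyO).fderiv (𝕜 := ℝ)] with z hz
        rw [hz]
        simp [fderiv_zero])
    refine (h1.add h2).congr ?_
    filter_upwards [ae_restrict_mem e.open_target.measurableSet] with y hy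
    exact (hp e he y hy v).symm
  · have hdu : ContDiff ℝ ∞ fun y => fderiv ℝ u y v :=
      (hu.fderiv_right (m := ∞) (by simp)).clm_apply contDiff_const
    have hduc : HasCompactSupport fun y => fderiv ℝ u y v := huc.fderiv_apply (𝕜 := ℝ) v
    have hdut : (tsupport fun y => fderiv ℝ u y v) ⊆ e.target :=
      (tsupport_fderiv_apply_subset ℝ v).trans hue
    obtain ⟨a1, a2, a3⟩ := testFunction_mul_cutoff hχ hχO he hu huc hue
    obtain ⟨b1, b2, b3⟩ := testFunction_mul_cutoff hχ hχO he hdu hduc hdut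
    have hda : Continuous fun y => fderiv ℝ (fun y => χ (e.symm y) * u y) y v :=
      (a1.continuous_fderiv (by simp)).clm_apply continuous_const
    have hdac : HasCompactSupport fun y => fderiv ℝ (fun y => χ (e.symm y) * u y) y v :=
      a2.fderiv_apply (𝕜 := ℝ) v
    have hdat : (tsupport fun y => fderiv ℝ (fun y => χ (e.symm y) * u y) y v) ⊆
        e.target ∩ e.symm ⁻¹' O := (tsupport_fderiv_apply_subset ℝ v).trans a3
    have i1 := integrable_mul_of_tsupport_subset (hg e he) hda hdac hdat
    have i2 := integrable_mul_of_tsupport_subset (hg e he) b1.continuous b2 b3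
    have i3 := integrable_mul_of_tsupport_subset (hX e he v) a1.continuous a2 a3
    -- The weak gradient of `g` is tested with `χ u`, whose support lies over `O`. The product rule
    -- then converts the result into the identity for `χ g` tested with `u`.
    have key := h.3 _ (hr e he).1 (hr e he).2.1 _ a1 a2 (by rwa [(hr e he).2.2]) v
    have key' : ∫ y, g (e.symm y) * fderiv ℝ (fun y => χ (e.symm y) * u y) y v =
        - ∫ y, chartPairing e X y v * (χ (e.symm y) * u y) := key
    have hprod : ∀ y, fderiv ℝ (fun y => χ (e.symm y)) y v * u y =
        fderiv ℝ (fun y => χ (e.symm y) * u y) y v - χ (e.symm y) * fderiv ℝ u y v := by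
      intro y
      by_cases hy : y ∈ tsupport u
      · have hc := ((contDiffOn_comp_chart_symm hχ he).contDiffAt
          (e.open_target.mem_nhds (hue hy))).differentiableAt (by simp)
        rw [fderiv_fun_mul hc (hu.differentiable (by simp) y)]
        simp
        ring
      · have e1 : fderiv ℝ (fun y => χ (e.symm y) * u y) y = 0 := by
          refine image_eq_zero_of_notMem_tsupport (f := fderiv ℝ fun y => χ (e.symm y) * u y)
            fun hh => hy ?_
          exact tsupport_mul_subset_right (tsupport_fderiv_subset ℝ hh)
        have e2 : fderiv ℝ u y = 0 :=
          image_eq_zero_of_notMem_tsupport fun hh => hy (tsupport_fderiv_subset ℝ hh)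
        rw [image_eq_zero_of_notMem_tsupport hy, e1, e2]
        simp
    have hL : ∀ y, χ (e.symm y) * g (e.symm y) * fderiv ℝ u y v =
        g (e.symm y) * (χ (e.symm y) * fderiv ℝ u y v) := fun y => by ring
    have hR : ∀ y, chartPairing e (fun x => χ x • X x + g x • manifoldGrad χ x) y v * u y =
        chartPairing e X y v * (χ (e.symm y) * u y) +
          (g (e.symm y) * fderiv ℝ (fun y => χ (e.symm y) * u y) y v -
            g (e.symm y) * (χ (e.symm y) * fderiv ℝ u y v)) := by
      intro y
      by_cases hy : y ∈ tsupport u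
      · rw [hp e he y (hue hy), ← mul_sub, ← hprod]
        ring
      · rw [← mul_sub, ← hprod, image_eq_zero_of_notMem_tsupport hy]
        simp
    simp only [hL, hR]
    have i12 : Integrable (fun y => g (e.symm y) * fderiv ℝ (fun y => χ (e.symm y) * u y) y v -
        g (e.symm y) * (χ (e.symm y) * fderiv ℝ u y v)) := i1.sub i2
    rw [integral_add i3 i12, integral_sub i1 i2, key']
    ring

variable [MeasurableSpace M] [BorelSpace M]
  [IsContMDiffRiemannianBundle (𝓡 n) 1 (EuclideanSpace ℝ (Fin n))
      (fun x : M => TangentSpace (𝓡 n) x)]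

theorem HasWeakGradientOn.aestronglyMeasurable {O : Set M} (hO : IsOpen O) {f : M → ℝ}
    {X : ∀ x : M, TangentSpace (𝓡 n) x} (h : HasWeakGradientOn O f X)
    {K : Set M} (hK : IsCompact K) (hKO : K ⊆ O) :
    AEStronglyMeasurable f ((riemannianVolume n M).restrict K) :=
  aestronglyMeasurable_of_charts hO (fun e he heO => (h.1 e he heO).aestronglyMeasurable) hK hKO

/-- Needed because the test function is truncated to be nonnegative everywhere, which alters it on a
null set. -/
theorem HasWeakGradientOn.congr_ae {O : Set M} {f g : M → ℝ}
    {X : ∀ x : M, TangentSpace (𝓡 n) x} (h : HasWeakGradientOn O f X)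
    (hfg : ∀ᵐ x ∂(riemannianVolume n M).restrict O, f x = g x) : HasWeakGradientOn O g X := by
  have hc : ∀ e ∈ IsManifold.maximalAtlas (𝓡 n) ∞ M, e.source ⊆ O →
      ∀ᵐ y ∂volume.restrict e.target, f (e.symm y) = g (e.symm y) := fun e he heO =>
    (ae_chart_iff he _).1 (ae_restrict_of_ae_restrict_of_subset heO hfg)
  refine ⟨fun e he heO => (h.1 e he heO).congr (hc e he heO), h.2,
    fun e he heO u hu huc hue v => ?_⟩
  rw [← h.3 e he heO u hu huc hue v]
  apply integral_congr_ae
  have := (ae_restrict_iff' e.open_target.measurableSet).1 (hc e he heO)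
  filter_upwards [this] with y hy
  by_cases hyt : y ∈ e.target
  · rw [hy hyt]
  · have e2 : fderiv ℝ u y = 0 :=
      image_eq_zero_of_notMem_tsupport fun hh => hyt (hue (tsupport_fderiv_subset ℝ hh))
    simp [e2]

end WeakGradient

/-! ### Lengths of paths, Hopf-Rinow, and images of balls -/

section Paths

variable {n : ℕ}
  {M : Type*} [MetricSpace M] [ChartedSpace (EuclideanSpace ℝ (Fin n)) M]
  [IsManifold (𝓡 n) ∞ M] [RiemannianBundle (fun x : M => TangentSpace (𝓡 n) x)]
  {M' : Type*} [MetricSpace M'] [ChartedSpace (EuclideanSpace ℝ (Fin n)) M']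
  [IsManifold (𝓡 n) ∞ M'] [RiemannianBundle (fun x : M' => TangentSpace (𝓡 n) x)]

theorem edist_le_pathELength [IsRiemannianManifold (𝓡 n) M] {γ : ℝ → M} {a b : ℝ}
    (hγ : ContMDiffOn 𝓘(ℝ, ℝ) (𝓡 n) 1 γ (Set.Icc a b)) (hab : a ≤ b) :
    edist (γ a) (γ b) ≤ pathELength (𝓡 n) γ a b := by
  rw [IsRiemannianManifold.out (I := 𝓡 n)]
  exact riemannianEDist_le_pathELength hγ rfl rfl hab

variable (n) in
theorem exists_path_of_dist_lt [IsRiemannianManifold (𝓡 n) M] {x y : M} {r : ℝ}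
    (h : dist x y < r) : ∃ γ : ℝ → M, γ 0 = x ∧ γ 1 = y ∧
      ContMDiffOn 𝓘(ℝ, ℝ) (𝓡 n) 1 γ (Set.Icc 0 1) ∧
      pathELength (𝓡 n) γ 0 1 < ENNReal.ofReal r := by
  apply exists_lt_of_riemannianEDist_lt
  rw [← IsRiemannianManifold.out (I := 𝓡 n), edist_dist]
  exact (ENNReal.ofReal_lt_ofReal_iff_of_nonneg dist_nonneg).2 h

theorem pathELength_comp_le {Φ : M → M'} {U : Set M} (hU : IsOpen U)
    (hΦ : ContMDiffOn (𝓡 n) (𝓡 n) 1 Φ U) {γ : ℝ → M} {a b : ℝ}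
    (hγ : ContMDiffOn 𝓘(ℝ, ℝ) (𝓡 n) 1 γ (Set.Icc a b))
    (hγU : ∀ t ∈ Set.Icc a b, γ t ∈ U) {C : ℝ≥0∞} (hC : C ≠ ⊤)
    (hbound : ∀ t ∈ Set.Icc a b, ∀ v, ‖mfderiv (𝓡 n) (𝓡 n) Φ (γ t) v‖ₑ ≤ C * ‖v‖ₑ) :
    ContMDiffOn 𝓘(ℝ, ℝ) (𝓡 n) 1 (Φ ∘ γ) (Set.Icc a b) ∧
    pathELength (𝓡 n) (Φ ∘ γ) a b ≤ C * pathELength (𝓡 n) γ a b := by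
  refine ⟨hΦ.comp hγ hγU, ?_⟩
  -- Degenerate intervals are separated because the chain rule for derivatives within `Set.Icc a b`
  -- requires unique differentiability, hence `a < b`.
  rcases le_or_gt b a with hab | hab
  · rcases hab.eq_or_lt with rfl | hab
    · simp
    · rw [pathELength_eq_lintegral_mfderiv_Icc, Set.Icc_eq_empty (not_le.2 hab)]
      simp
  rw [pathELength_eq_lintegral_mfderivWithin_Icc, pathELength_eq_lintegral_mfderivWithin_Icc,
    ← lintegral_const_mul' _ _ hC]
  refine setLIntegral_mono' measurableSet_Icc fun t ht => ?_
  have h1 : MDifferentiableAt (𝓡 n) (𝓡 n) Φ (γ t) :=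
    (hΦ.mdifferentiableOn one_ne_zero).mdifferentiableAt (hU.mem_nhds (hγU t ht))
  have h2 := mfderiv_comp_mfderivWithin t h1 (hγ.mdifferentiableOn one_ne_zero t ht)
    (uniqueMDiffWithinAt_iff_uniqueDiffWithinAt.2 (uniqueDiffOn_Icc hab t ht))
  rw [h2]
  exact hbound t ht _

/-- Length space property: an almost shortest path from `x` to `y` crosses the sphere of radius `r`
by the intermediate value theorem, and what remains of it beyond `z` is shorter than `t`. -/
theorem exists_dist_le_of_dist_lt_add [IsRiemannianManifold (𝓡 n) M] {x y : M} {r t : ℝ}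
    (hr : 0 ≤ r) (ht : 0 < t) (h : dist x y < r + t) : ∃ z, dist x z ≤ r ∧ dist z y < t := by
  rcases le_or_gt (dist x y) r with h1 | h1
  · exact ⟨y, h1, by simpa using ht⟩
  obtain ⟨γ, hγ0, hγ1, hγ, hlen⟩ := exists_path_of_dist_lt n h
  have hc : ContinuousOn (fun s => dist x (γ s)) (Set.Icc 0 1) :=
    continuous_dist.comp_continuousOn (continuousOn_const.prodMk hγ.continuousOn)
  obtain ⟨s, hs, hsr⟩ : r ∈ (fun s => dist x (γ s)) '' Set.Icc 0 1 := by
    apply intermediate_value_Icc zero_le_one hc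
    simp only [hγ0, hγ1, dist_self]
    exact ⟨hr, h1.le⟩
  refine ⟨γ s, hsr.le, ?_⟩
  have e1 := edist_le_pathELength (hγ.mono (Set.Icc_subset_Icc_right hs.2)) hs.1
  have e2 := edist_le_pathELength (hγ.mono (Set.Icc_subset_Icc_left hs.1)) hs.2
  rw [← pathELength_add hs.1 hs.2] at hlen
  have h3 : edist (γ 0) (γ s) + edist (γ s) (γ 1) < ENNReal.ofReal (r + t) :=
    (add_le_add e1 e2).trans_lt hlen
  rw [hγ0, hγ1, edist_dist, edist_dist, ← ENNReal.ofReal_add dist_nonneg dist_nonneg,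
    ENNReal.ofReal_lt_ofReal_iff (by positivity)] at h3
  simp only at hsr
  linarith

variable (n M) in
/-- The Hopf-Rinow theorem: closed balls of a complete Riemannian manifold are compact. -/
theorem properSpace_of_isRiemannianManifold [IsRiemannianManifold (𝓡 n) M] [CompleteSpace M] :
    ProperSpace M := by
  have : LocallyCompactSpace M := ChartedSpace.locallyCompactSpace (EuclideanSpace ℝ (Fin n)) M
  refine ⟨fun p r => ?_⟩
  by_contra hr
  -- Continuity argument on the radius: the supremum `R` of the radii of compact balls is attained
  -- and can then be exceeded, a contradiction.
  set S : Set ℝ := {s | 0 ≤ s ∧ IsCompact (Metric.closedBall p s)} with hS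
  have hdown : ∀ s s', s ≤ s' → IsCompact (Metric.closedBall p s') →
      IsCompact (Metric.closedBall p s) := fun s s' hss h =>
    h.of_isClosed_subset Metric.isClosed_closedBall (Metric.closedBall_subset_closedBall hss)
  have h0 : (0 : ℝ) ∈ S := ⟨le_rfl, by simp⟩
  have hbdd : BddAbove S := ⟨r, fun s hs => by
    by_contra hlt
    exact hr (hdown _ _ (not_le.1 hlt).le hs.2)⟩
  set R := sSup S
  have hR0 : 0 ≤ R := le_csSup hbdd h0
  have hbelow : ∀ s < R, IsCompact (Metric.closedBall p s) := fun s hs => by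
    obtain ⟨s', hs', hss'⟩ := exists_lt_of_lt_csSup ⟨0, h0⟩ hs
    exact hdown _ _ hss'.le hs'.2
  have hR : IsCompact (Metric.closedBall p R) := by
    rcases hR0.eq_or_lt with hR0 | hR0
    · rw [← hR0]; simp
    rw [isCompact_iff_totallyBounded_isComplete]
    refine ⟨Metric.totallyBounded_iff.2 fun ε hε => ?_, Metric.isClosed_closedBall.isComplete⟩
    -- The ball of radius `s` is compact, and every point of the ball of radius `R` is at distance
    -- less than ε/2 from it. A finite ε/2-net of the smaller ball is therefore an ε-net of the
    -- larger one; completeness finishes.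
    set s := max 0 (R - ε / 4)
    have hsR : s < R := max_lt hR0 (by linarith)
    obtain ⟨t, ht, hcov⟩ := Metric.totallyBounded_iff.1 (hbelow s hsR).totallyBounded (ε / 2)
      (half_pos hε)
    refine ⟨t, ht, fun x hx => ?_⟩
    have hxR : dist p x < s + ε / 2 := by
      rw [dist_comm]
      have := Metric.mem_closedBall.1 hx
      have := le_max_right 0 (R - ε / 4)
      linarith
    obtain ⟨z, hz1, hz2⟩ := exists_dist_le_of_dist_lt_add (n := n) (le_max_left _ _) (half_pos hε) hxR
    have hz := hcov (Metric.mem_closedBall'.2 hz1)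
    simp only [Set.mem_iUnion, Metric.mem_ball, exists_prop] at hz ⊢
    obtain ⟨w, hw, hzw⟩ := hz
    refine ⟨w, hw, ?_⟩
    have := dist_triangle x z w
    rw [dist_comm x z] at this
    linarith
  -- Local compactness gives a compact thickening of the ball of radius `R`, and by the length space
  -- property it contains the ball of radius `R + δ / 2`.
  obtain ⟨δ, hδ, hcomp⟩ := hR.exists_isCompact_cthickening
  have hmem : R + δ / 2 ∈ S := by
    refine ⟨by positivity, hcomp.of_isClosed_subset Metric.isClosed_closedBall fun x hx => ?_⟩
    have hxR : dist p x < R + δ := by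
      rw [dist_comm]
      have := Metric.mem_closedBall.1 hx
      linarith
    obtain ⟨z, hz1, hz2⟩ := exists_dist_le_of_dist_lt_add (n := n) hR0 hδ hxR
    refine Metric.mem_cthickening_of_dist_le x z δ _ (Metric.mem_closedBall'.2 hz1) ?_
    rw [dist_comm]
    exact hz2.le
  have := le_csSup hbdd hmem
  linarith

/-- A map which is smooth and `C`-Lipschitz at the infinitesimal level on a ball is `C`-Lipschitz
from the center of this ball. -/
theorem edist_map_le_of_mem_ball [IsRiemannianManifold (𝓡 n) M] [IsRiemannianManifold (𝓡 n) M']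
    {Φ : M → M'} {U : Set M} (hU : IsOpen U) (hΦ : ContMDiffOn (𝓡 n) (𝓡 n) 1 Φ U) {p : M} {R : ℝ}
    (hball : Metric.ball p R ⊆ U) {C : ℝ≥0∞} (hC : C ≠ ⊤)
    (hbound : ∀ x ∈ Metric.ball p R, ∀ v, ‖mfderiv (𝓡 n) (𝓡 n) Φ x v‖ₑ ≤ C * ‖v‖ₑ)
    {x : M} (hx : x ∈ Metric.ball p R) :
    edist (Φ p) (Φ x) ≤ C * ENNReal.ofReal R := by
  rw [Metric.mem_ball'] at hx
  obtain ⟨γ, hγ0, hγ1, hγ, hlen⟩ := exists_path_of_dist_lt n hx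
  have hR : 0 < R := dist_nonneg.trans_lt hx
  -- A path from `p` of length less than `R` never leaves the ball of radius `R`, so the
  -- infinitesimal bound is available along all of it.
  have hin : ∀ t ∈ Set.Icc (0 : ℝ) 1, γ t ∈ Metric.ball p R := by
    intro t ht
    have e1 := edist_le_pathELength (hγ.mono (Set.Icc_subset_Icc_right ht.2)) ht.1
    have e2 := (e1.trans (pathELength_mono le_rfl ht.2)).trans_lt hlen
    rwa [hγ0, edist_dist, ENNReal.ofReal_lt_ofReal_iff hR, ← Metric.mem_ball'] at e2
  obtain ⟨h1, h2⟩ := pathELength_comp_le hU hΦ hγ (fun t ht => hball (hin t ht)) hC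
    (fun t ht => hbound _ (hin t ht))
  have h3 := edist_le_pathELength h1 zero_le_one
  simp only [Function.comp, hγ0, hγ1] at h3
  exact h3.trans (h2.trans (by gcongr))

/-- If the inverse of `Φ` is infinitesimally `C`-Lipschitz on the image of a ball, then this image
contains a ball. -/
theorem ball_subset_image_ball [IsRiemannianManifold (𝓡 n) M] [IsRiemannianManifold (𝓡 n) M']
    {Φ : OpenPartialHomeomorph M M'} (hΦ : ContMDiffOn (𝓡 n) (𝓡 n) ∞ Φ.symm Φ.target) {p : M}
    {R S A : ℝ} (hSR : S < R) (hcomp : IsCompact (Metric.closedBall p S))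
    (hball : Metric.ball p R ⊆ Φ.source) {C : ℝ≥0∞} (hC : C ≠ ⊤)
    (hbound : ∀ x ∈ Metric.ball p R, ∀ v,
      ‖mfderiv (𝓡 n) (𝓡 n) Φ.symm (Φ x) v‖ₑ ≤ C * ‖v‖ₑ)
    (hCA : C * ENNReal.ofReal A ≤ ENNReal.ofReal S) (hS : 0 ≤ S) :
    Metric.ball (Φ p) A ⊆ Φ '' Metric.ball p R := by
  intro q hq
  rw [Metric.mem_ball'] at hq
  have hpR : p ∈ Metric.ball p R := Metric.mem_ball_self (hS.trans_lt hSR)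
  obtain ⟨γ, hγ0, hγ1, hγ, hlen⟩ := exists_path_of_dist_lt n hq
  have hOopen : IsOpen (Φ '' Metric.ball p R) :=
    Φ.isOpen_image_of_subset_source Metric.isOpen_ball hball
  by_contra hqO
  -- The times at which `γ` is outside the image. At the first such time `t₀` a contradiction is
  -- reached: before it the path lifts through `Φ.symm`, and the length bound keeps the lift in the
  -- compact ball of radius `S`. The image of this ball is closed, so `γ t₀` still belongs to it.
  set E : Set ℝ := Set.Icc 0 1 ∩ γ ⁻¹' (Φ '' Metric.ball p R)ᶜ with hE
  have hEclosed : IsClosed E :=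
    hγ.continuousOn.preimage_isClosed_of_isClosed isClosed_Icc hOopen.isClosed_compl
  have hEcomp : IsCompact E := isCompact_Icc.of_isClosed_subset hEclosed Set.inter_subset_left
  obtain ⟨t₀, ht₀, hleast⟩ := hEcomp.exists_isLeast ⟨1, ⟨zero_le_one, le_rfl⟩, by
    simpa [hγ1] using hqO⟩
  have hbefore : ∀ s, 0 ≤ s → s < t₀ → γ s ∈ Φ '' Metric.closedBall p S := by
    intro s hs0 hst
    have hin : ∀ t ∈ Set.Icc 0 s, γ t ∈ Φ '' Metric.ball p R := by
      intro t ht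
      by_contra hnot
      have : t₀ ≤ t := hleast ⟨⟨ht.1, (ht.2.trans hst.le).trans ht₀.1.2⟩, hnot⟩
      linarith [ht.2]
    have hs1 : s ≤ 1 := hst.le.trans ht₀.1.2
    obtain ⟨h1, h2⟩ := pathELength_comp_le Φ.open_target (hΦ.of_le (by simp))
      (hγ.mono (Set.Icc_subset_Icc_right hs1))
      (fun t ht => by
        obtain ⟨x, hx, hxt⟩ := hin t ht
        rw [← hxt]; exact Φ.map_source (hball hx)) hC
      (fun t ht v => by
        obtain ⟨x, hx, hxt⟩ := hin t ht
        have := hbound x hx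
        rw [hxt] at this
        exact this v)
    have h3 := edist_le_pathELength h1 hs0
    have h4 : edist p (Φ.symm (γ s)) ≤ ENNReal.ofReal S := by
      simp only [Function.comp, hγ0, Φ.left_inv (hball hpR)] at h3
      refine h3.trans (h2.trans (le_trans ?_ hCA))
      gcongr
      exact (pathELength_mono le_rfl hs1).trans hlen.le
    rw [edist_dist, ENNReal.ofReal_le_ofReal_iff hS] at h4
    obtain ⟨x, hx, hxs⟩ := hin s ⟨hs0, le_rfl⟩
    refine ⟨Φ.symm (γ s), Metric.mem_closedBall'.2 h4, Φ.right_inv ?_⟩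
    rw [← hxs]
    exact Φ.map_source (hball hx)
  have hsub : Metric.closedBall p S ⊆ Metric.ball p R := Metric.closedBall_subset_ball hSR
  have hclosed : IsClosed (Φ '' Metric.closedBall p S) :=
    (hcomp.image_of_continuousOn (Φ.continuousOn.mono (hsub.trans hball))).isClosed
  have ht0 : 0 < t₀ := by
    rcases ht₀.1.1.eq_or_lt with h | h
    · exfalso
      apply ht₀.2
      rw [← h, hγ0]
      exact ⟨p, hpR, rfl⟩
    · exact h
  have hmem : γ t₀ ∈ Φ '' Metric.closedBall p S := by
    have hc : ContinuousWithinAt γ (Set.Ico 0 t₀) t₀ :=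
      (hγ.continuousOn t₀ ht₀.1).mono fun s hs => ⟨hs.1, hs.2.le.trans ht₀.1.2⟩
    have hcl : t₀ ∈ closure (Set.Ico 0 t₀) := by
      rw [closure_Ico ht0.ne]
      exact ⟨ht0.le, le_rfl⟩
    have := hc.mem_closure hcl (fun s hs => hbefore s hs.1 hs.2)
    rwa [hclosed.closure_eq] at this
  exact ht₀.2 (Set.image_mono hsub hmem)

end Paths

/-! ### Measures comparable up to a factor close to 1 -/

section MeasureComparison

variable {α : Type*} [MeasurableSpace α] {μ ν : Measure α} {δ : ℝ}

/-- Two measures with `(1 - δ) μ ≤ ν ≤ (1 + δ) μ`. -/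
structure MeasureClose (δ : ℝ) (μ ν : Measure α) : Prop where
  le : ν ≤ ENNReal.ofReal (1 + δ) • μ
  ge : ENNReal.ofReal (1 - δ) • μ ≤ ν

theorem MeasureClose.integrable (h : MeasureClose δ μ ν) {G : α → ℝ} (hG : Integrable G μ) :
    Integrable G ν :=
  (hG.smul_measure ENNReal.ofReal_ne_top).mono_measure h.le

theorem MeasureClose.abs_integral_sub_le_of_nonneg (h : MeasureClose δ μ ν) (hδ : 0 ≤ δ)
    (hδ1 : δ ≤ 1) {G : α → ℝ} (hG : Integrable G μ) (h0 : 0 ≤ G) :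
    |∫ x, G x ∂ν - ∫ x, G x ∂μ| ≤ δ * ∫ x, G x ∂μ := by
  have h1 := integral_mono_measure h.le (Eventually.of_forall h0)
    (hG.smul_measure ENNReal.ofReal_ne_top)
  have h2 := integral_mono_measure h.ge (Eventually.of_forall h0) (h.integrable hG)
  rw [integral_smul_measure, ENNReal.toReal_ofReal (by linarith), smul_eq_mul] at h1 h2
  rw [abs_le]
  constructor <;> linarith

theorem MeasureClose.abs_integral_sub_le (h : MeasureClose δ μ ν) (hδ : 0 ≤ δ)
    (hδ1 : δ ≤ 1) {G : α → ℝ} (hG : Integrable G μ) :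
    |∫ x, G x ∂ν - ∫ x, G x ∂μ| ≤ δ * ∫ x, |G x| ∂μ := by
  have hp := hG.pos_part
  have hn := hG.neg_part
  have h1 := h.abs_integral_sub_le_of_nonneg hδ hδ1 hp (fun x => le_max_right _ _)
  have h2 := h.abs_integral_sub_le_of_nonneg hδ hδ1 hn (fun x => le_max_right _ _)
  have e1 : ∀ x, G x = max (G x) 0 - max (-G x) 0 := fun x => by
    rcases le_total 0 (G x) with hx | hx
    · rw [max_eq_left hx, max_eq_right (by linarith)]; ring
    · rw [max_eq_right hx, max_eq_left (by linarith)]; ring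
  have e2 : ∀ x, |G x| = max (G x) 0 + max (-G x) 0 := fun x => by
    rcases le_total 0 (G x) with hx | hx
    · rw [max_eq_left hx, max_eq_right (by linarith), abs_of_nonneg hx]; ring
    · rw [max_eq_right hx, max_eq_left (by linarith), abs_of_nonpos hx]; ring
  have i1 : ∫ x, G x ∂ν = ∫ x, max (G x) 0 ∂ν - ∫ x, max (-G x) 0 ∂ν := by
    rw [← integral_sub (h.integrable hp) (h.integrable hn)]
    exact integral_congr_ae (Eventually.of_forall e1)
  have i2 : ∫ x, G x ∂μ = ∫ x, max (G x) 0 ∂μ - ∫ x, max (-G x) 0 ∂μ := by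
    rw [← integral_sub hp hn]
    exact integral_congr_ae (Eventually.of_forall e1)
  have i3 : ∫ x, |G x| ∂μ = ∫ x, max (G x) 0 ∂μ + ∫ x, max (-G x) 0 ∂μ := by
    rw [← integral_add hp hn]
    exact integral_congr_ae (Eventually.of_forall e2)
  rw [i1, i2, i3]
  rw [abs_le] at *
  constructor <;> linarith

theorem MeasureClose.lintegral_le (h : MeasureClose δ μ ν) (hδ1 : δ ≤ 1) (G : α → ℝ≥0∞) :
    ∫⁻ x, G x ∂ν ≤ 2 * ∫⁻ x, G x ∂μ := by
  refine (lintegral_mono' h.le le_rfl).trans ?_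
  rw [lintegral_smul_measure, smul_eq_mul]
  gcongr
  calc ENNReal.ofReal (1 + δ) ≤ ENNReal.ofReal 2 := ENNReal.ofReal_le_ofReal (by linarith)
    _ = 2 := by simp

theorem MeasureClose.le_lintegral (h : MeasureClose δ μ ν) (hδ1 : δ ≤ 1 / 2) (G : α → ℝ≥0∞) :
    ∫⁻ x, G x ∂μ ≤ 2 * ∫⁻ x, G x ∂ν := by
  have h1 : ENNReal.ofReal (1 - δ) * ∫⁻ x, G x ∂μ ≤ ∫⁻ x, G x ∂ν := by
    rw [← smul_eq_mul, ← lintegral_smul_measure]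
    exact lintegral_mono' h.ge le_rfl
  calc ∫⁻ x, G x ∂μ = ENNReal.ofReal (2 * 2⁻¹) * ∫⁻ x, G x ∂μ := by simp
    _ = 2 * (ENNReal.ofReal 2⁻¹ * ∫⁻ x, G x ∂μ) := by
        rw [ENNReal.ofReal_mul zero_le_two, mul_assoc]
        simp
    _ ≤ 2 * (ENNReal.ofReal (1 - δ) * ∫⁻ x, G x ∂μ) := by
        gcongr
        linarith
    _ ≤ _ := by gcongr

theorem MeasureClose.ae (h : MeasureClose δ μ ν) {P : α → Prop} (hP : ∀ᵐ x ∂μ, P x) :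
    ∀ᵐ x ∂ν, P x :=
  ((Measure.absolutelyContinuous_of_le h.le).trans
    (Measure.smul_absolutelyContinuous)).ae_le hP

end MeasureComparison

/-- An eventual statement which holds locally uniformly holds uniformly on compact sets. -/
theorem IsCompact.eventually_forall_of_nhds {α ι : Type*} [TopologicalSpace α] {l : Filter ι}
    {P : ι → α → Prop} {K : Set α} (hK : IsCompact K)
    (h : ∀ x ∈ K, ∃ U ∈ 𝓝 x, ∀ᶠ i in l, ∀ z ∈ U, P i z) : ∀ᶠ i in l, ∀ x ∈ K, P i x := by
  refine hK.induction_on (p := fun S => ∀ᶠ i in l, ∀ x ∈ S, P i x) (by simp) ?_ ?_ ?_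
  · intro s t hst ht
    filter_upwards [ht] with i hi x hx using hi x (hst hx)
  · intro s t hs ht
    filter_upwards [hs, ht] with i h1 h2 x hx
    exact hx.elim (h1 x) (h2 x)
  · intro x hx
    obtain ⟨U, hU, hP⟩ := h x hx
    exact ⟨U, mem_nhdsWithin_of_mem_nhds hU, hP⟩

/-! ### Uniform closeness of metrics and volumes -/

section Convergence

variable {n : ℕ}
  {M : Type*} [MetricSpace M] [ChartedSpace (EuclideanSpace ℝ (Fin n)) M]
  [IsManifold (𝓡 n) ∞ M] [RiemannianBundle (fun x : M => TangentSpace (𝓡 n) x)]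
  {N : ℕ → Type*} [∀ k, MetricSpace (N k)]
  [∀ k, ChartedSpace (EuclideanSpace ℝ (Fin n)) (N k)] [∀ k, IsManifold (𝓡 n) ∞ (N k)]
  [∀ k, RiemannianBundle (fun x : N k => TangentSpace (𝓡 n) x)]
  {p : M} {pk : ∀ k, N k} {Φ : ∀ k, OpenPartialHomeomorph M (N k)}

theorem PointedC1Convergence.isSmooth (hΦ : PointedC1Convergence (n := n) Φ p pk) (k : ℕ) :
    (Φ k).IsSmooth n := ⟨hΦ.contMDiffOn k, hΦ.contMDiffOn_symm k⟩

variable [IsContMDiffRiemannianBundle (𝓡 n) 1 (EuclideanSpace ℝ (Fin n))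
      (fun x : M => TangentSpace (𝓡 n) x)]

/-- Convergence jointly in the index and the point is the form that composes with determinant,
square root and quotient. -/
theorem PointedC1Convergence.tendsto_pullbackMetric
    (hΦ : PointedC1Convergence (n := n) Φ p pk)
    {e : OpenPartialHomeomorph M (EuclideanSpace ℝ (Fin n))}
    (he : e ∈ IsManifold.maximalAtlas (𝓡 n) ∞ M) {y₀ : EuclideanSpace ℝ (Fin n)}
    (hy₀ : y₀ ∈ e.target) (v w : EuclideanSpace ℝ (Fin n)) :
    Tendsto (fun z : ℕ × EuclideanSpace ℝ (Fin n) => pullbackMetric (Φ z.1) e v w z.2)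
      (atTop ×ˢ 𝓝 y₀) (𝓝 (inner ℝ (chartVec e y₀ v) (chartVec e y₀ w))) := by
  rw [Metric.tendsto_nhds]
  intro ε hε
  obtain ⟨K, hK, hKe, hKc⟩ := (e.open_target.mem_nhds hy₀ |> fun h =>
    local_compact_nhds h)
  have h1 := Metric.tendstoUniformlyOn_iff.1 (hΦ.tendsto_metric e he K hKc hKe v w) (ε / 2)
    (half_pos hε)
  have h2 := Metric.tendsto_nhds.1 ((continuousOn_inner_chartVec he v w).continuousAt
    (e.open_target.mem_nhds hy₀)) (ε / 2) (half_pos hε)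
  filter_upwards [h1.prod_mk (h2.and hK)] with z hz
  have h3 := hz.1 z.2 hz.2.2
  rw [dist_comm] at h3
  calc _ ≤ _ := dist_triangle _ _ _
    _ < ε / 2 + ε / 2 := add_lt_add h3 hz.2.1
    _ = ε := add_halves ε

/-- The pulled back metrics are uniformly close to the limit metric on compact sets. -/
theorem PointedC1Convergence.eventually_norm_mfderiv
    (hΦ : PointedC1Convergence (n := n) Φ p pk) {L : Set M} (hL : IsCompact L) {δ : ℝ}
    (hδ : 0 < δ) :
    ∀ᶠ k in atTop, ∀ x ∈ L, ∀ v : TangentSpace (𝓡 n) x,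
      |‖mfderiv (𝓡 n) (𝓡 n) (Φ k) x v‖ ^ 2 - ‖v‖ ^ 2| ≤ δ * ‖v‖ ^ 2 := by
  refine hL.eventually_forall_of_nhds fun x₀ _ => ?_
  set e := chartAt (EuclideanSpace ℝ (Fin n)) x₀
  have he : e ∈ IsManifold.maximalAtlas (𝓡 n) ∞ M := IsManifold.chart_mem_maximalAtlas x₀
  have hx₀ : x₀ ∈ e.source := mem_chart_source _ x₀
  obtain ⟨K, hK, hKe, hKc⟩ := local_compact_nhds (e.open_target.mem_nhds (e.map_source hx₀))
  obtain ⟨C, hC, hCb⟩ := exists_norm_le_norm_chartVec he hKc hKe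
  -- The quadratic form has n² coefficients, each with error `η`, and coordinates are at most `C`
  -- times the norm. The total error is thus n² C² η ≤ δ; the summand 1 keeps the denominator
  -- positive.
  set η := δ / (n ^ 2 * C ^ 2 + 1) with hη
  have hη0 : 0 < η := by positivity
  refine ⟨e.source ∩ e ⁻¹' K, inter_mem (e.open_source.mem_nhds hx₀)
    ((e.continuousAt hx₀).preimage_mem_nhds hK), ?_⟩
  have h1 : ∀ᶠ k in atTop, ∀ i j : Fin n, ∀ y ∈ K,
      dist (inner ℝ (chartVec e y (EuclideanSpace.single i 1))
        (chartVec e y (EuclideanSpace.single j 1)))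
        (pullbackMetric (Φ k) e (EuclideanSpace.single i 1) (EuclideanSpace.single j 1) y) < η :=
    eventually_all.2 fun i => eventually_all.2 fun j =>
      Metric.tendstoUniformlyOn_iff.1 (hΦ.tendsto_metric e he K hKc hKe _ _) η hη0
  filter_upwards [h1] with k hk x hx
  obtain ⟨y, hy, rfl⟩ : ∃ y ∈ K, e.symm y = x := ⟨e x, hx.2, e.left_inv hx.1⟩
  intro v
  obtain ⟨a, rfl⟩ := exists_chartVec_eq he (hKe hy) v
  have e1 : ‖chartVec e y a‖ ^ 2 = ∑ i, ∑ j, a i * a j *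
      inner ℝ (chartVec e y (EuclideanSpace.single i 1))
        (chartVec e y (EuclideanSpace.single j 1)) := by
    rw [← real_inner_self_eq_norm_sq, chartVec_eq_sum, sum_inner]
    simp only [inner_sum, inner_smul_left, inner_smul_right, RCLike.conj_to_real, mul_assoc]
    exact Finset.sum_congr rfl fun i _ => Finset.sum_congr rfl fun j _ => mul_left_comm _ _ _
  have e2 : ‖mfderiv (𝓡 n) (𝓡 n) (Φ k) (e.symm y) (chartVec e y a)‖ ^ 2 = ∑ i, ∑ j, a i * a j *
      pullbackMetric (Φ k) e (EuclideanSpace.single i 1) (EuclideanSpace.single j 1) y := by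
    rw [← real_inner_self_eq_norm_sq, chartVec_eq_sum, map_sum, sum_inner]
    simp only [inner_sum, map_smul, inner_smul_left, inner_smul_right, RCLike.conj_to_real,
      mul_assoc, pullbackMetric]
    exact Finset.sum_congr rfl fun i _ => Finset.sum_congr rfl fun j _ => mul_left_comm _ _ _
  have hcoord : ∀ i, |a i| ≤ ‖a‖ := fun i => by
    rw [← Real.norm_eq_abs]; exact PiLp.norm_apply_le a i
  rw [e1, e2, ← Finset.sum_sub_distrib]
  simp only [← Finset.sum_sub_distrib, ← mul_sub]
  rw [← e1]
  calc _ ≤ ∑ i, ∑ j, |a i * a j * (pullbackMetric (Φ k) e (EuclideanSpace.single i 1)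
          (EuclideanSpace.single j 1) y - inner ℝ (chartVec e y (EuclideanSpace.single i 1))
            (chartVec e y (EuclideanSpace.single j 1)))| :=
        (Finset.abs_sum_le_sum_abs _ _).trans
          (Finset.sum_le_sum fun i _ => Finset.abs_sum_le_sum_abs _ _)
    _ ≤ ∑ i : Fin n, ∑ j : Fin n, ‖a‖ * ‖a‖ * η := by
        refine Finset.sum_le_sum fun i _ => Finset.sum_le_sum fun j _ => ?_
        rw [abs_mul, abs_mul]
        have := (hk i j y hy).le
        rw [dist_comm, Real.dist_eq] at this
        gcongr
        · exact hcoord i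
        · exact hcoord j
    _ = n ^ 2 * η * ‖a‖ ^ 2 := by
        simp only [Finset.sum_const, Finset.card_univ, Fintype.card_fin, nsmul_eq_mul]
        ring
    _ ≤ n ^ 2 * η * (C * ‖chartVec e y a‖) ^ 2 := by
        gcongr
        exact hCb y hy a
    _ = (n ^ 2 * C ^ 2) * η * ‖chartVec e y a‖ ^ 2 := by ring
    _ ≤ δ * ‖chartVec e y a‖ ^ 2 := by
        gcongr
        rw [hη, mul_div_assoc', div_le_iff₀ (by positivity)]
        nlinarith

variable [MeasurableSpace M] [BorelSpace M] [∀ k, MeasurableSpace (N k)] [∀ k, BorelSpace (N k)]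
  [∀ k, IsContMDiffRiemannianBundle (𝓡 n) 1 (EuclideanSpace ℝ (Fin n))
      (fun x : N k => TangentSpace (𝓡 n) x)]

theorem pullMeasure_riemannianVolume_apply
    {M' : Type*} [MetricSpace M'] [ChartedSpace (EuclideanSpace ℝ (Fin n)) M']
    [IsManifold (𝓡 n) ∞ M'] [RiemannianBundle (fun x : M' => TangentSpace (𝓡 n) x)]
    [MeasurableSpace M'] [BorelSpace M']
    [IsContMDiffRiemannianBundle (𝓡 n) 1 (EuclideanSpace ℝ (Fin n))
      (fun x : M' => TangentSpace (𝓡 n) x)]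
    {Φ : OpenPartialHomeomorph M M'} (hΦ : Φ.IsSmooth n)
    {e : OpenPartialHomeomorph M (EuclideanSpace ℝ (Fin n))}
    (he : e ∈ IsManifold.maximalAtlas (𝓡 n) ∞ M) {s : Set M} (hs : MeasurableSet s)
    (hse : s ⊆ e.source) (hsΦ : s ⊆ Φ.source) :
    Φ.pullMeasure (riemannianVolume n M') s = ∫⁻ y in e.target ∩ e.symm ⁻¹' s,
      ENNReal.ofReal (√ (Matrix.of fun i j => pullbackMetric Φ e (EuclideanSpace.single i 1)
        (EuclideanSpace.single j 1) y).det) := by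
  have hset : (Φ.symm ≫ₕ e).target ∩ (Φ.symm ≫ₕ e).symm ⁻¹' (Φ.target ∩ Φ.symm ⁻¹' s) =
      e.target ∩ e.symm ⁻¹' s := by
    ext y
    simp only [OpenPartialHomeomorph.trans_target, OpenPartialHomeomorph.symm_target,
      Set.mem_inter_iff, Set.mem_preimage]
    constructor
    · rintro ⟨⟨h1, h2⟩, -, h4⟩
      refine ⟨h1, ?_⟩
      have h5 : Φ.symm (Φ (e.symm y)) ∈ s := h4
      rwa [Φ.left_inv h2] at h5
    · rintro ⟨h1, h2⟩
      refine ⟨⟨h1, hsΦ h2⟩, Φ.map_source (hsΦ h2), ?_⟩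
      change Φ.symm (Φ (e.symm y)) ∈ s
      rwa [Φ.left_inv (hsΦ h2)]
  rw [OpenPartialHomeomorph.pullMeasure_apply, riemannianVolume_apply_of_subset_source
    (symm_trans_mem_maximalAtlas hΦ he) (Φ.measurableSet_inter_preimage_symm hs), hset]
  · refine setLIntegral_congr_fun (e.measurableSet_inter_preimage_symm hs) fun y hy => ?_
    simp only [volumeDensity]
    rw [gramMatrix_symm_trans hΦ he hy.1 (hsΦ hy.2)]
  · rintro q ⟨h1, h2⟩
    simp only [OpenPartialHomeomorph.trans_source, OpenPartialHomeomorph.symm_source]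
    exact ⟨h1, hse h2⟩

/-- The pulled back volumes are uniformly close to the limit volume on compact sets. -/
theorem PointedC1Convergence.eventually_measureClose
    (hΦ : PointedC1Convergence (n := n) Φ p pk) {L : Set M} (hL : IsCompact L) {δ : ℝ}
    (hδ : 0 < δ) (hδ1 : δ < 1) :
    ∀ᶠ k in atTop, L ⊆ (Φ k).source ∧ MeasureClose δ ((riemannianVolume n M).restrict L)
      (((Φ k).pullMeasure (riemannianVolume n (N k))).restrict L) := by
  -- Quantifying over all measurable subsets of `T` makes the property pass to unions: a subset of
  -- `T ∪ T'` splits into its part in `T` and its part outside. Compactness of `L` then reduces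
  -- everything to small chart neighbourhoods.
  let Q : Set M → ℕ → Prop := fun T k => ∀ s, MeasurableSet s → s ⊆ T →
    (Φ k).pullMeasure (riemannianVolume n (N k)) s ≤
      ENNReal.ofReal (1 + δ) * riemannianVolume n M s ∧
    ENNReal.ofReal (1 - δ) * riemannianVolume n M s ≤
      (Φ k).pullMeasure (riemannianVolume n (N k)) s
  have hmain : ∃ T, L ⊆ T ∧ MeasurableSet T ∧ ∀ᶠ k in atTop, Q T k := by
    refine hL.induction_on (p := fun S => ∃ T, S ⊆ T ∧ MeasurableSet T ∧ ∀ᶠ k in atTop, Q T k)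
      ?_ ?_ ?_ ?_
    · refine ⟨∅, le_rfl, MeasurableSet.empty, Eventually.of_forall fun k s _ hs => ?_⟩
      rw [Set.subset_empty_iff.1 hs]
      simp
    · rintro S S' hSS ⟨T, hT, h⟩
      exact ⟨T, hSS.trans hT, h⟩
    · rintro S S' ⟨T, hST, hT, h⟩ ⟨T', hST', hT', h'⟩
      refine ⟨T ∪ T', Set.union_subset_union hST hST', hT.union hT', ?_⟩
      filter_upwards [h, h'] with k hk hk' s hs hsT
      have h1 := hk (s ∩ T) (hs.inter hT) Set.inter_subset_right
      have h2 := hk' (s \ T) (hs.diff hT) (fun x hx => (hsT hx.1).resolve_left hx.2)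
      rw [← measure_inter_add_sdiff (μ := riemannianVolume n M) s hT,
        ← measure_inter_add_sdiff (μ := (Φ k).pullMeasure (riemannianVolume n (N k))) s hT,
        mul_add, mul_add]
      exact ⟨add_le_add h1.1 h2.1, add_le_add h1.2 h2.2⟩
    · intro x₀ _
      set e := chartAt (EuclideanSpace ℝ (Fin n)) x₀
      have he : e ∈ IsManifold.maximalAtlas (𝓡 n) ∞ M := IsManifold.chart_mem_maximalAtlas x₀
      have hx₀ : x₀ ∈ e.source := mem_chart_source _ x₀
      have hy₀ := e.map_source hx₀
      have hdet0 := (posDef_gramMatrix he hy₀).det_pos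
      have h1 : Tendsto (fun z : ℕ × EuclideanSpace ℝ (Fin n) =>
          √ (Matrix.of fun i j => pullbackMetric (Φ z.1) e (EuclideanSpace.single i 1)
            (EuclideanSpace.single j 1) z.2).det) (atTop ×ˢ 𝓝 (e x₀))
          (𝓝 (√ (gramMatrix e (e x₀)).det)) := by
        refine (Real.continuous_sqrt.tendsto _).comp ?_
        refine ((continuous_id.matrix_det (n := Fin n) (R := ℝ)).tendsto _).comp ?_
        exact tendsto_pi_nhds.2 fun i => tendsto_pi_nhds.2 fun j =>
          hΦ.tendsto_pullbackMetric he hy₀ _ _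
      have h2 : Tendsto (fun z : ℕ × EuclideanSpace ℝ (Fin n) => √ (gramMatrix e z.2).det)
          (atTop ×ˢ 𝓝 (e x₀)) (𝓝 (√ (gramMatrix e (e x₀)).det)) :=
        ((Real.continuous_sqrt.comp_continuousOn (continuousOn_det_gramMatrix he)).continuousAt
          (e.open_target.mem_nhds hy₀)).tendsto.comp tendsto_snd
      -- The two densities have the same positive limit, so their quotient tends to 1 jointly in the
      -- index and the point. This yields relative bounds, as needed for a comparison of measures.
      have h3 := h1.div h2 (Real.sqrt_pos.2 hdet0).ne'
      rw [div_self (Real.sqrt_pos.2 hdet0).ne'] at h3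
      obtain ⟨pa, hpa, pb, hpb, hab⟩ := eventually_prod_iff.1
        (Metric.tendsto_nhds.1 h3 δ hδ)
      obtain ⟨K, hK, hKe, hKc⟩ := local_compact_nhds (inter_mem hpb (e.open_target.mem_nhds hy₀))
      have hTc : IsCompact (e.symm '' K) :=
        hKc.image_of_continuousOn (e.continuousOn_symm.mono fun y hy => (hKe hy).2)
      refine ⟨e.symm '' K, mem_nhdsWithin_of_mem_nhds ?_, e.symm '' K, le_rfl,
        hTc.measurableSet, ?_⟩
      · filter_upwards [e.open_source.mem_nhds hx₀, (e.continuousAt hx₀).preimage_mem_nhds hK]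
          with x hx hxK
        exact ⟨e x, hxK, e.left_inv hx⟩
      filter_upwards [hpa, hΦ.exhausts _ hTc] with k hk hsub s hs hsT
      have hse : s ⊆ e.source := by
        intro x hx
        obtain ⟨y, hy, rfl⟩ := hsT hx
        exact e.map_target (hKe hy).2
      have hms := e.measurableSet_inter_preimage_symm hs
      have hbd : ∀ y ∈ e.target ∩ e.symm ⁻¹' s,
          |√ (Matrix.of fun i j => pullbackMetric (Φ k) e (EuclideanSpace.single i 1)
            (EuclideanSpace.single j 1) y).det - √ (gramMatrix e y).det| ≤
            δ * √ (gramMatrix e y).det := by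
        intro y hy
        obtain ⟨y', hy', hyy⟩ := hsT hy.2
        have : y' = y := e.symm.injOn (hKe hy').2 hy.1 hyy
        subst this
        have hpos := Real.sqrt_pos.2 (posDef_gramMatrix he hy.1).det_pos
        have h4 := (hab hk (hKe hy').1).le
        rw [Real.dist_eq] at h4
        simp only [Pi.div_apply] at h4
        rw [div_sub_one hpos.ne', abs_div, abs_of_pos hpos, div_le_iff₀ hpos] at h4
        exact h4
      rw [pullMeasure_riemannianVolume_apply (hΦ.isSmooth k) he hs hse (hsT.trans hsub),
        riemannianVolume_apply_of_subset_source he hs hse,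
        ← lintegral_const_mul' _ _ ENNReal.ofReal_ne_top,
        ← lintegral_const_mul' _ _ ENNReal.ofReal_ne_top]
      constructor
      · refine setLIntegral_mono' hms fun y hy => ?_
        rw [volumeDensity, ← ENNReal.ofReal_mul (by linarith)]
        apply ENNReal.ofReal_le_ofReal
        have := abs_le.1 (hbd y hy)
        linarith
      · refine setLIntegral_mono' hms fun y hy => ?_
        rw [volumeDensity, ← ENNReal.ofReal_mul (by linarith)]
        apply ENNReal.ofReal_le_ofReal
        have := abs_le.1 (hbd y hy)
        linarith
  obtain ⟨T, hLT, -, hT⟩ := hmain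
  filter_upwards [hT, hΦ.exhausts L hL] with k hk hsub
  refine ⟨hsub, Measure.le_iff.2 fun s hs => ?_, Measure.le_iff.2 fun s hs => ?_⟩
  · rw [Measure.smul_apply, Measure.restrict_apply hs, Measure.restrict_apply hs, smul_eq_mul]
    exact (hk _ (hs.inter hL.measurableSet) (Set.inter_subset_right.trans hLT)).1
  · rw [Measure.smul_apply, Measure.restrict_apply hs, Measure.restrict_apply hs, smul_eq_mul]
    exact (hk _ (hs.inter hL.measurableSet) (Set.inter_subset_right.trans hLT)).2

end Convergence

/-! ### Pullback of gradients -/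

section PullbackAlgebra

variable {n : ℕ}
  {M : Type*} [MetricSpace M] [ChartedSpace (EuclideanSpace ℝ (Fin n)) M]
  [IsManifold (𝓡 n) ∞ M] [RiemannianBundle (fun x : M => TangentSpace (𝓡 n) x)]
  {M' : Type*} [MetricSpace M'] [ChartedSpace (EuclideanSpace ℝ (Fin n)) M']
  [IsManifold (𝓡 n) ∞ M'] [RiemannianBundle (fun x : M' => TangentSpace (𝓡 n) x)]

theorem pullbackGrad_smul_add_smul (Φ : M → M') (X Y : ∀ x : M', TangentSpace (𝓡 n) x)
    (a b : M' → ℝ) (x : M) :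
    pullbackGrad Φ (fun q => a q • X q + b q • Y q) x =
      a (Φ x) • pullbackGrad Φ X x + b (Φ x) • pullbackGrad Φ Y x := by
  refine ext_inner_right ℝ fun v => ?_
  rw [inner_pullbackGrad, inner_add_left, inner_add_left, inner_smul_left, inner_smul_left,
    inner_smul_left, inner_smul_left, inner_pullbackGrad, inner_pullbackGrad]

/-- The differentials of `Φ` and `Φ.symm` are mutually inverse. The auxiliary `key` transports the
inner product between the tangent spaces at `Φ.symm (Φ x)` and `x`, which are not syntactically the
same. -/
theorem pullbackGrad_pullbackGrad_symm {Φ : OpenPartialHomeomorph M M'} (hΦ : Φ.IsSmooth n)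
    (F : ∀ x : M, TangentSpace (𝓡 n) x) {x : M} (hx : x ∈ Φ.source) :
    pullbackGrad Φ (pullbackGrad Φ.symm F) x = F x := by
  refine ext_inner_right ℝ fun v => ?_
  rw [inner_pullbackGrad, inner_pullbackGrad]
  have h1 := congrArg (fun L : EuclideanSpace ℝ (Fin n) →L[ℝ] EuclideanSpace ℝ (Fin n) => L v)
    (hΦ.mdifferentiable.symm_comp_deriv hx)
  have key : ∀ (x' : M) (u : EuclideanSpace ℝ (Fin n)), x' = x → u = v →
      @inner ℝ (TangentSpace (𝓡 n) x') _ (F x') u = inner ℝ (F x) v := by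
    rintro x' u rfl rfl
    rfl
  exact key _ _ (Φ.left_inv hx) h1

theorem pullbackGrad_manifoldGrad {Φ : OpenPartialHomeomorph M M'} (hΦ : Φ.IsSmooth n)
    {χ : M' → ℝ} {ξ : M → ℝ} {x : M} (hx : x ∈ Φ.source)
    (hχ : MDifferentiableAt (𝓡 n) 𝓘(ℝ, ℝ) χ (Φ x)) (h : ξ =ᶠ[𝓝 x] χ ∘ Φ) :
    pullbackGrad Φ (manifoldGrad (n := n) χ) x = manifoldGrad ξ x := by
  refine ext_inner_right ℝ fun v => ?_
  rw [inner_pullbackGrad, inner_manifoldGrad, inner_manifoldGrad]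
  have h1 := h.mfderiv_eq (I := 𝓡 n) (I' := 𝓘(ℝ, ℝ))
  have h2 := mfderiv_comp (I' := 𝓡 n) x hχ (hΦ.mdifferentiable.mdifferentiableAt hx)
  exact congrArg (fun L : EuclideanSpace ℝ (Fin n) →L[ℝ] ℝ => L v) (h1.trans h2).symm

/-- From ∇(ψ²) = 2 ψ ∇ψ. The surviving factor ψ is the reason for squaring the cutoff: it lets the
cross terms be absorbed by ψ² times the squared gradients. -/
theorem norm_manifoldGrad_sq_le {ψ : M → ℝ} {x : M}
    (hψ : MDifferentiableAt (𝓡 n) 𝓘(ℝ, ℝ) ψ x) {c : ℝ} (hc : ‖manifoldGrad (n := n) ψ x‖ ≤ c)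
    (h0 : 0 ≤ ψ x) :
    ‖manifoldGrad (n := n) (fun z => ψ z ^ 2) x‖ ≤ 2 * ψ x * c := by
  have h : manifoldGrad (n := n) (fun z => ψ z ^ 2) x = (2 * ψ x) • manifoldGrad ψ x := by
    refine ext_inner_right ℝ fun v => ?_
    rw [inner_smul_left, inner_manifoldGrad, inner_manifoldGrad]
    have h1 : HasMFDerivAt (𝓡 n) 𝓘(ℝ, ℝ) (fun z => ψ z ^ 2) x
        ((ContinuousLinearMap.toSpanSingleton ℝ (2 * ψ x)).comp (mfderiv (𝓡 n) 𝓘(ℝ, ℝ) ψ x)) := by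
      have h2 : HasFDerivAt (fun t : ℝ => t ^ 2)
          (ContinuousLinearMap.toSpanSingleton ℝ (2 * ψ x)) (ψ x) := by
        have := (hasDerivAt_pow 2 (ψ x)).hasFDerivAt
        simpa using this
      exact HasMFDerivAt.comp x h2.hasMFDerivAt hψ.hasMFDerivAt
    rw [h1.mfderiv]
    simp only [RCLike.conj_to_real]
    change differentialCovector (n := n) ψ x v * (2 * ψ x) =
      2 * ψ x * differentialCovector (n := n) ψ x v
    ring
  rw [h, norm_smul, Real.norm_eq_abs, abs_of_nonneg (by positivity)]
  gcongr

end PullbackAlgebra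

/-! ### Maps close to isometries -/

section CloseMaps

variable {n : ℕ}
  {M : Type*} [MetricSpace M] [ChartedSpace (EuclideanSpace ℝ (Fin n)) M]
  [IsManifold (𝓡 n) ∞ M] [RiemannianBundle (fun x : M => TangentSpace (𝓡 n) x)]
  [MeasurableSpace M] [BorelSpace M]
  {M' : Type*} [MetricSpace M'] [ChartedSpace (EuclideanSpace ℝ (Fin n)) M']
  [IsManifold (𝓡 n) ∞ M'] [RiemannianBundle (fun x : M' => TangentSpace (𝓡 n) x)]
  [MeasurableSpace M'] [BorelSpace M']

variable (n) in
/-- The diffeomorphism `Φ` is `δ`-close to an isometry on `L`. -/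
structure IsCloseOn (δ : ℝ) (Φ : OpenPartialHomeomorph M M') (L : Set M) : Prop where
  isSmooth : Φ.IsSmooth n
  subset : L ⊆ Φ.source
  norm_mfderiv : ∀ x ∈ L, ∀ v : TangentSpace (𝓡 n) x,
    |‖mfderiv (𝓡 n) (𝓡 n) Φ x v‖ ^ 2 - ‖v‖ ^ 2| ≤ δ * ‖v‖ ^ 2
  measureClose : MeasureClose δ ((riemannianVolume n M).restrict L)
    ((Φ.pullMeasure (riemannianVolume n M')).restrict L)

variable {δ : ℝ} {Φ : OpenPartialHomeomorph M M'} {L : Set M}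

theorem IsCloseOn.norm_mfderiv_le (h : IsCloseOn n δ Φ L) (hδ : δ ≤ 1 / 4) {x : M} (hx : x ∈ L)
    (v : TangentSpace (𝓡 n) x) : ‖mfderiv (𝓡 n) (𝓡 n) Φ x v‖ ≤ 2 * ‖v‖ := by
  have := abs_le.1 (h.norm_mfderiv x hx v)
  refine (pow_le_pow_iff_left₀ (norm_nonneg _) (by positivity) two_ne_zero).1 ?_
  nlinarith [sq_nonneg ‖v‖]

/-- Every vector at `Φ x` is the image of some `v`, and the lower bound (1 - δ) ‖v‖² on the squared
length of the image controls `v`. -/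
theorem IsCloseOn.norm_mfderiv_symm_le (h : IsCloseOn n δ Φ L) (hδ : δ ≤ 1 / 4) {x : M}
    (hx : x ∈ L) (w : TangentSpace (𝓡 n) (Φ x)) :
    ‖mfderiv (𝓡 n) (𝓡 n) Φ.symm (Φ x) w‖ ≤ 2 * ‖w‖ := by
  obtain ⟨v, rfl⟩ := h.isSmooth.mdifferentiable.mfderiv_surjective (h.subset hx) w
  have h1 := congrArg (fun L : EuclideanSpace ℝ (Fin n) →L[ℝ] EuclideanSpace ℝ (Fin n) => L v)
    (h.isSmooth.mdifferentiable.symm_comp_deriv (h.subset hx))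
  have key : ∀ (x' : M) (u : EuclideanSpace ℝ (Fin n)), x' = x → u = v →
      @norm (TangentSpace (𝓡 n) x') _ u = ‖v‖ := by
    rintro x' u rfl rfl
    rfl
  have h2 := key _ _ (Φ.left_inv (h.subset hx)) h1
  refine (le_of_eq h2).trans ?_
  have := abs_le.1 (h.norm_mfderiv x hx v)
  refine (pow_le_pow_iff_left₀ (norm_nonneg _) (by positivity) two_ne_zero).1 ?_
  nlinarith [sq_nonneg ‖v‖]

/-- Pulling a gradient back is transposing the differential, so the linear algebra of almost
isometric surjections applies pointwise. It compares the pairing in the metric of `M'` with the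
pairing in the metric of `M`. -/
theorem IsCloseOn.abs_inner_sub_le (h : IsCloseOn n δ Φ L) (hδ : δ ≤ 1 / 4) {x : M}
    (hx : x ∈ L) (X Y : ∀ x : M', TangentSpace (𝓡 n) x) :
    |inner ℝ (X (Φ x)) (Y (Φ x)) - inner ℝ (pullbackGrad Φ X x) (pullbackGrad Φ Y x)| ≤
      2 * δ * ‖pullbackGrad Φ X x‖ * ‖pullbackGrad Φ Y x‖ :=
  abs_inner_sub_inner_adjoint_le (mfderiv (𝓡 n) (𝓡 n) Φ x).toLinearMap
    (h.isSmooth.mdifferentiable.mfderiv_surjective (h.subset hx)) (by linarith)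
    (h.norm_mfderiv x hx) (inner_pullbackGrad Φ X x) (inner_pullbackGrad Φ Y x)

theorem IsCloseOn.abs_norm_sq_sub_le (h : IsCloseOn n δ Φ L) (hδ : δ ≤ 1 / 4) {x : M}
    (hx : x ∈ L) (X : ∀ x : M', TangentSpace (𝓡 n) x) :
    |‖X (Φ x)‖ ^ 2 - ‖pullbackGrad Φ X x‖ ^ 2| ≤ 2 * δ * ‖pullbackGrad Φ X x‖ ^ 2 := by
  have := h.abs_inner_sub_le hδ hx X X
  rw [real_inner_self_eq_norm_sq, real_inner_self_eq_norm_sq] at this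
  rwa [mul_assoc, ← sq] at this

theorem IsCloseOn.norm_sq_le (h : IsCloseOn n δ Φ L) (hδ : δ ≤ 1 / 4) {x : M}
    (hx : x ∈ L) (X : ∀ x : M', TangentSpace (𝓡 n) x) :
    ‖X (Φ x)‖ ^ 2 ≤ 2 * ‖pullbackGrad Φ X x‖ ^ 2 := by
  have := abs_le.1 (h.abs_norm_sq_sub_le hδ hx X)
  nlinarith [sq_nonneg ‖pullbackGrad Φ X x‖]

theorem IsCloseOn.norm_pullbackGrad_sq_le (h : IsCloseOn n δ Φ L) (hδ : δ ≤ 1 / 4) {x : M}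
    (hx : x ∈ L) (X : ∀ x : M', TangentSpace (𝓡 n) x) :
    ‖pullbackGrad Φ X x‖ ^ 2 ≤ 2 * ‖X (Φ x)‖ ^ 2 := by
  have := abs_le.1 (h.abs_norm_sq_sub_le hδ hx X)
  nlinarith [sq_nonneg ‖pullbackGrad Φ X x‖]

theorem IsCloseOn.isCompact_image (h : IsCloseOn n δ Φ L) (hL : IsCompact L) :
    IsCompact (Φ '' L) := hL.image_of_continuousOn (Φ.continuousOn.mono h.subset)

theorem IsCloseOn.abs_integral_sub_le (h : IsCloseOn n δ Φ L) (hL : MeasurableSet L)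
    (hδ0 : 0 ≤ δ) (hδ : δ ≤ 1 / 4) {G : M' → ℝ} (hG : Function.support G ⊆ Φ '' L)
    (hint : IntegrableOn (fun x => G (Φ x)) L (riemannianVolume n M)) :
    |∫ q, G q ∂riemannianVolume n M' - ∫ x in L, G (Φ x) ∂riemannianVolume n M| ≤
      δ * ∫ x in L, |G (Φ x)| ∂riemannianVolume n M := by
  rw [Φ.integral_eq_setIntegral_pullMeasure _ hL h.subset G hG]
  exact h.measureClose.abs_integral_sub_le hδ0 (by linarith) hint

theorem IsCloseOn.setLIntegral_image_le (h : IsCloseOn n δ Φ L) (hL : IsCompact L)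
    (hδ : δ ≤ 1 / 4) (G : M' → ℝ≥0∞) :
    ∫⁻ q in Φ '' L, G q ∂riemannianVolume n M' ≤
      2 * ∫⁻ x in L, G (Φ x) ∂riemannianVolume n M := by
  rw [← Φ.setLIntegral_comp_pullMeasure _ hL.measurableSet h.subset
    (h.isCompact_image hL).measurableSet]
  exact h.measureClose.lintegral_le (by linarith) _

theorem IsCloseOn.setLIntegral_le (h : IsCloseOn n δ Φ L) (hL : IsCompact L)
    (hδ : δ ≤ 1 / 4) (G : M' → ℝ≥0∞) :
    ∫⁻ x in L, G (Φ x) ∂riemannianVolume n M ≤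
      2 * ∫⁻ q in Φ '' L, G q ∂riemannianVolume n M' := by
  rw [← Φ.setLIntegral_comp_pullMeasure _ hL.measurableSet h.subset
    (h.isCompact_image hL).measurableSet]
  exact h.measureClose.le_lintegral (by linarith) _

theorem IsCloseOn.ae_image (h : IsCloseOn n δ Φ L) (hL : IsCompact L) {P : M' → Prop}
    (hP : ∀ᵐ x ∂(riemannianVolume n M).restrict L, P (Φ x)) :
    ∀ᵐ q ∂(riemannianVolume n M').restrict (Φ '' L), P q := by
  have h1 := (ae_restrict_iff' hL.measurableSet).1 (h.measureClose.ae hP)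
  rw [Φ.ae_pullMeasure_iff (riemannianVolume n M') (fun x => x ∈ L → P (Φ x)),
    ae_restrict_iff' Φ.open_target.measurableSet] at h1
  rw [ae_restrict_iff' (h.isCompact_image hL).measurableSet]
  filter_upwards [h1] with q hq
  rintro ⟨x, hx, rfl⟩
  have := hq (Φ.map_source (h.subset hx))
  rw [Φ.left_inv (h.subset hx)] at this
  exact this hx

/-- The pulled back volume makes the composition measurable. The lower bound in the comparison of
measures, with δ < 1, makes the volume of `M` on `L` absolutely continuous with respect to it. -/
theorem IsCloseOn.aestronglyMeasurable_comp (h : IsCloseOn n δ Φ L) (hL : IsCompact L)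
    (hδ : δ ≤ 1 / 4) {G : M' → ℝ}
    (hG : AEStronglyMeasurable G ((riemannianVolume n M').restrict (Φ '' L))) :
    AEStronglyMeasurable (fun x => G (Φ x)) ((riemannianVolume n M).restrict L) := by
  have hm := (h.isCompact_image hL).measurableSet
  have h1 : AEStronglyMeasurable ((Φ '' L).indicator G) (riemannianVolume n M') :=
    (aestronglyMeasurable_indicator_iff hm).2 hG
  have h2 : AEStronglyMeasurable (fun x => (Φ '' L).indicator G (Φ x))
      (Φ.pullMeasure (riemannianVolume n M')) := by
    rw [Φ.aestronglyMeasurable_pullMeasure_iff]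
    refine (h1.restrict (s := Φ.target)).congr ?_
    filter_upwards [ae_restrict_mem Φ.open_target.measurableSet] with q hq
    rw [Φ.right_inv hq]
  have hac : (riemannianVolume n M).restrict L ≪
      (Φ.pullMeasure (riemannianVolume n M')).restrict L := by
    refine Measure.AbsolutelyContinuous.trans ?_
      (Measure.absolutelyContinuous_of_le h.measureClose.ge)
    refine Measure.absolutelyContinuous_smul ?_
    simp only [ne_eq, ENNReal.ofReal_eq_zero, not_le]
    linarith
  refine ((h2.restrict (s := L)).mono_ac hac).congr ?_
  filter_upwards [ae_restrict_mem hL.measurableSet] with x hx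
  rw [Set.indicator_of_mem (Set.mem_image_of_mem _ hx)]

end CloseMaps

/-! ### Images of balls under the approximating maps -/

section EventuallyClose

variable {n : ℕ}
  {M : Type*} [MetricSpace M] [ChartedSpace (EuclideanSpace ℝ (Fin n)) M]
  [IsManifold (𝓡 n) ∞ M] [RiemannianBundle (fun x : M => TangentSpace (𝓡 n) x)]
  [IsContMDiffRiemannianBundle (𝓡 n) 1 (EuclideanSpace ℝ (Fin n))
      (fun x : M => TangentSpace (𝓡 n) x)]
  [MeasurableSpace M] [BorelSpace M]
  {N : ℕ → Type*} [∀ k, MetricSpace (N k)]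
  [∀ k, ChartedSpace (EuclideanSpace ℝ (Fin n)) (N k)] [∀ k, IsManifold (𝓡 n) ∞ (N k)]
  [∀ k, RiemannianBundle (fun x : N k => TangentSpace (𝓡 n) x)]
  [∀ k, MeasurableSpace (N k)] [∀ k, BorelSpace (N k)]
  [∀ k, IsContMDiffRiemannianBundle (𝓡 n) 1 (EuclideanSpace ℝ (Fin n))
      (fun x : N k => TangentSpace (𝓡 n) x)]
  {p : M} {pk : ∀ k, N k} {Φ : ∀ k, OpenPartialHomeomorph M (N k)}

theorem PointedC1Convergence.eventually_isCloseOn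
    (hΦ : PointedC1Convergence (n := n) Φ p pk) {L : Set M} (hL : IsCompact L) {δ : ℝ}
    (hδ : 0 < δ) (hδ1 : δ < 1) : ∀ᶠ k in atTop, IsCloseOn n δ (Φ k) L := by
  filter_upwards [hΦ.eventually_measureClose hL hδ hδ1, hΦ.eventually_norm_mfderiv hL hδ]
    with k h1 h2
  exact ⟨hΦ.isSmooth k, h1.1, h2, h1.2⟩

variable [IsRiemannianManifold (𝓡 n) M] [∀ k, IsRiemannianManifold (𝓡 n) (N k)]

/-- Closeness is asked on a larger radius R' because almost shortest paths to points of the ball of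
radius `R` need room. The map is infinitesimally 2-Lipschitz there, and the final 1 makes the
inclusion land in an open ball. -/
theorem IsCloseOn.image_closedBall_subset {k : ℕ} {R R' δ : ℝ} (hR : 0 < R') (hRR : R < R')
    (hδ : δ ≤ 1 / 4) (h : IsCloseOn n δ (Φ k) (Metric.closedBall p R')) :
    Φ k '' Metric.closedBall p R ⊆ Metric.ball (Φ k p) (2 * R' + 1) := by
  rintro _ ⟨x, hx, rfl⟩
  have h1 := edist_map_le_of_mem_ball (Φ k).open_source (h.isSmooth.contMDiffOn.of_le (by simp))
    (Metric.ball_subset_closedBall.trans h.subset) (C := 2) (by simp)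
    (fun x hx v => by
      have := h.norm_mfderiv_le hδ (Metric.ball_subset_closedBall hx) v
      rw [← ofReal_norm, ← ofReal_norm]
      calc _ ≤ ENNReal.ofReal (2 * ‖v‖) := ENNReal.ofReal_le_ofReal this
        _ = _ := by rw [ENNReal.ofReal_mul zero_le_two]; simp)
    (Metric.closedBall_subset_ball hRR hx)
  have h2 : (2 : ℝ≥0∞) * ENNReal.ofReal R' = ENNReal.ofReal (2 * R') := by
    rw [ENNReal.ofReal_mul zero_le_two]; simp
  rw [h2, edist_dist, ENNReal.ofReal_le_ofReal_iff (by positivity)] at h1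
  rw [Metric.mem_ball']
  linarith

/-- The inverse is infinitesimally 2-Lipschitz, so paths of length less than `A` lift into the
compact ball of radius `2 * A`, one unit away from the boundary of the ball where closeness is
known. -/
theorem IsCloseOn.ball_subset_image [ProperSpace M] {k : ℕ} {A δ : ℝ} (hA : 0 ≤ A)
    (hδ : δ ≤ 1 / 4) (h : IsCloseOn n δ (Φ k) (Metric.closedBall p (2 * A + 1))) :
    Metric.ball (Φ k p) A ⊆ Φ k '' Metric.closedBall p (2 * A + 1) := by
  refine (ball_subset_image_ball h.isSmooth.contMDiffOn_symm (S := 2 * A) (by linarith)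
    (isCompact_closedBall _ _) (Metric.ball_subset_closedBall.trans h.subset) (C := 2) (by simp)
    (fun x hx v => ?_) ?_ (by positivity)).trans (Set.image_mono Metric.ball_subset_closedBall)
  · have := h.norm_mfderiv_symm_le hδ (Metric.ball_subset_closedBall hx) v
    rw [← ofReal_norm, ← ofReal_norm]
    calc _ ≤ ENNReal.ofReal (2 * ‖v‖) := ENNReal.ofReal_le_ofReal this
      _ = _ := by rw [ENNReal.ofReal_mul zero_le_two]; simp
  · rw [ENNReal.ofReal_mul zero_le_two]; simp

end EventuallyClose

/-! ### The pointwise form of the gradient estimate -/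

theorem mul_add_le_sq_add (a b c : ℝ) : c * (a + b) ≤ a ^ 2 + (b ^ 2 + c ^ 2) := by
  linarith [sq_nonneg (c - a), sq_nonneg (c - b), sq_nonneg a, sq_nonneg b]

theorem add_mul_add_le {a b c ε : ℝ} (ha : 0 ≤ a) (hb : 0 ≤ b) (hc : 0 ≤ c) (hε : ε ≤ 1) :
    (a + b) * (a + 4 * ε * c) ≤ 4 * (a ^ 2 + (b ^ 2 + c ^ 2)) := by
  have h1 : ε * (c * (a + b)) ≤ 1 * (c * (a + b)) := by gcongr
  have h2 : (a + b) * (a + 4 * ε * c) = a ^ 2 + a * b + 4 * (ε * (c * (a + b))) := by ring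
  rw [h2]
  linarith [sq_nonneg (c - a), sq_nonneg (c - b), sq_nonneg (a - b), sq_nonneg a, sq_nonneg b]

/-- Here `U` and `F` stand for the pulled back gradient of f' and the gradient of `f`, `ζ` for
∇(ψ²), `g` for the truncated factor ε - s (f' - f), and `G` for the pairing in the metric of `M'`.
With W = U - F, the pairing of U with -s ψ² W is -s ψ² (⟨F, W⟩ + ‖W‖²). The remaining terms are the
one with ζ, of size ε, and the metric error, of size δ. Young's inequality bounds both by ψ² ‖W‖² +
ψ² ‖F‖² + c². The second conclusion serves for integrability and for the volume error, the third for
finite energy of the test function. -/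
theorem pointwise_gradient_estimate {T : Type*} [NormedAddCommGroup T] [InnerProductSpace ℝ T]
    {F U ζ : T} {ψ c ε δ g s G : ℝ} (hs : s = 1 ∨ s = -1) (h0 : 0 ≤ ψ) (h1 : ψ ≤ 1)
    (hc : 0 ≤ c) (hζ : ‖ζ‖ ≤ 2 * ψ * c) (hg0 : 0 ≤ g) (hg : g ≤ 2 * ε) (hε : ε ≤ 1)
    (hδ0 : 0 ≤ δ) (hδ : δ ≤ 1 / 4)
    (hG : |G - inner ℝ U (ψ ^ 2 • ((-s) • U + s • F) + g • ζ)| ≤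
      2 * δ * ‖U‖ * ‖ψ ^ 2 • ((-s) • U + s • F) + g • ζ‖) :
    s * G ≤ -(ψ ^ 2 * ‖U - F‖ ^ 2) - ψ ^ 2 * inner ℝ F (U - F) +
        (8 * δ + 4 * ε) * (ψ ^ 2 * ‖U - F‖ ^ 2 + (ψ ^ 2 * ‖F‖ ^ 2 + c ^ 2)) ∧
      |G| ≤ 8 * (ψ ^ 2 * ‖U - F‖ ^ 2 + (ψ ^ 2 * ‖F‖ ^ 2 + c ^ 2)) ∧
      ‖ψ ^ 2 • ((-s) • U + s • F) + g • ζ‖ ^ 2 ≤ 2 * ‖U - F‖ ^ 2 + 32 * c ^ 2 := by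
  obtain ⟨W, rfl⟩ : ∃ W, U = F + W := ⟨U - F, by abel⟩
  have hW : F + W - F = W := by abel
  have hs2 : s * s = 1 := by rcases hs with rfl | rfl <;> norm_num
  have habs : |s| = 1 := by rcases hs with rfl | rfl <;> norm_num
  have hZ : ψ ^ 2 • ((-s) • (F + W) + s • F) + g • ζ = (-(ψ ^ 2 * s)) • W + g • ζ := by module
  rw [hW]
  rw [hZ] at hG ⊢
  have hA : 0 ≤ ‖W‖ := norm_nonneg _
  have hB : 0 ≤ ‖F‖ := norm_nonneg _
  have hε0 : 0 ≤ ε := by linarith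
  have hU : ‖F + W‖ ≤ ‖W‖ + ‖F‖ := by rw [add_comm ‖W‖]; exact norm_add_le _ _
  have hgζ : g * ‖ζ‖ ≤ 4 * ε * c * ψ := by
    calc g * ‖ζ‖ ≤ 2 * ε * (2 * ψ * c) := by gcongr
      _ = _ := by ring
  have hZn : ‖(-(ψ ^ 2 * s)) • W + g • ζ‖ ≤ ψ ^ 2 * ‖W‖ + 4 * ε * c * ψ := by
    refine (norm_add_le _ _).trans ?_
    rw [norm_smul, norm_smul, Real.norm_eq_abs, Real.norm_eq_abs, abs_neg, abs_mul, habs,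
      abs_of_nonneg hg0, abs_of_nonneg (sq_nonneg ψ), mul_one]
    gcongr
  have hinner : inner ℝ (F + W) ((-(ψ ^ 2 * s)) • W + g • ζ) =
      -(ψ ^ 2 * s) * (inner ℝ F W + ‖W‖ ^ 2) + g * inner ℝ (F + W) ζ := by
    rw [inner_add_right, inner_smul_right, inner_smul_right, inner_add_left,
      real_inner_self_eq_norm_sq]
  have hUZ : ‖F + W‖ * ‖(-(ψ ^ 2 * s)) • W + g • ζ‖ ≤
      4 * (ψ ^ 2 * ‖W‖ ^ 2 + (ψ ^ 2 * ‖F‖ ^ 2 + c ^ 2)) := by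
    calc _ ≤ (‖W‖ + ‖F‖) * (ψ ^ 2 * ‖W‖ + 4 * ε * c * ψ) := by gcongr
      _ = (ψ * ‖W‖ + ψ * ‖F‖) * (ψ * ‖W‖ + 4 * ε * c) := by ring
      _ ≤ _ := add_mul_add_le (by positivity) (by positivity) hc hε
      _ = _ := by ring
  have hgi : |g * inner ℝ (F + W) ζ| ≤
      4 * ε * (ψ ^ 2 * ‖W‖ ^ 2 + (ψ ^ 2 * ‖F‖ ^ 2 + c ^ 2)) := by
    rw [abs_mul, abs_of_nonneg hg0]
    calc g * |inner ℝ (F + W) ζ| ≤ g * (‖F + W‖ * ‖ζ‖) := by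
          gcongr; exact abs_real_inner_le_norm _ _
      _ = (g * ‖ζ‖) * ‖F + W‖ := by ring
      _ ≤ (4 * ε * c * ψ) * (‖W‖ + ‖F‖) := by gcongr
      _ = 4 * ε * (c * (ψ * ‖W‖ + ψ * ‖F‖)) := by ring
      _ ≤ 4 * ε * ((ψ * ‖W‖) ^ 2 + ((ψ * ‖F‖) ^ 2 + c ^ 2)) := by
          gcongr; exact mul_add_le_sq_add _ _ _
      _ = _ := by ring
  have hin := abs_real_inner_le_norm (F + W) ((-(ψ ^ 2 * s)) • W + g • ζ)
  have h3 : ‖(-(ψ ^ 2 * s)) • W + g • ζ‖ ^ 2 ≤ 2 * ‖W‖ ^ 2 + 32 * c ^ 2 := by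
    have e1 : ‖(-(ψ ^ 2 * s)) • W + g • ζ‖ ≤ ‖W‖ + 4 * c := by
      refine hZn.trans ?_
      have e3 : ε * c * ψ ≤ 1 * c * 1 := by gcongr
      have e4 : ψ ^ 2 * ‖W‖ ≤ 1 ^ 2 * ‖W‖ := by gcongr
      linarith
    calc _ ≤ (‖W‖ + 4 * c) ^ 2 := by gcongr
      _ ≤ _ := by linarith [sq_nonneg (‖W‖ - 4 * c)]
  generalize inner ℝ (F + W) ((-(ψ ^ 2 * s)) • W + g • ζ) = I at *
  generalize ‖(-(ψ ^ 2 * s)) • W + g • ζ‖ = z at *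
  generalize inner ℝ (F + W) ζ = t at *
  generalize inner ℝ F W = w at *
  have hQ0 : 0 ≤ ψ ^ 2 * ‖W‖ ^ 2 + (ψ ^ 2 * ‖F‖ ^ 2 + c ^ 2) := by positivity
  rw [show 4 * ε * (ψ ^ 2 * ‖W‖ ^ 2 + (ψ ^ 2 * ‖F‖ ^ 2 + c ^ 2)) =
    4 * (ε * (ψ ^ 2 * ‖W‖ ^ 2 + (ψ ^ 2 * ‖F‖ ^ 2 + c ^ 2))) by ring] at hgi
  rw [add_mul, mul_assoc 8, mul_assoc 4]
  have hGe : |G - I| ≤ 8 * (δ * (ψ ^ 2 * ‖W‖ ^ 2 + (ψ ^ 2 * ‖F‖ ^ 2 + c ^ 2))) := by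
    calc |G - I| ≤ 2 * δ * (‖F + W‖ * z) := hG.trans_eq (mul_assoc _ _ _)
      _ ≤ 2 * δ * (4 * (ψ ^ 2 * ‖W‖ ^ 2 + (ψ ^ 2 * ‖F‖ ^ 2 + c ^ 2))) := by gcongr
      _ = _ := by ring
  have hδQ : δ * (ψ ^ 2 * ‖W‖ ^ 2 + (ψ ^ 2 * ‖F‖ ^ 2 + c ^ 2)) ≤
      1 / 4 * (ψ ^ 2 * ‖W‖ ^ 2 + (ψ ^ 2 * ‖F‖ ^ 2 + c ^ 2)) := by gcongr
  refine ⟨?_, ?_, h3⟩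
  · have e1 : s * (G - I) ≤ |G - I| := by
      refine (le_abs_self _).trans ?_
      rw [abs_mul, habs, one_mul]
    have e2 : s * (g * t) ≤ |g * t| := by
      refine (le_abs_self _).trans ?_
      rw [abs_mul, habs, one_mul]
    have e3 : s * G = s * (G - I) + (-(s * s) * (ψ ^ 2 * (w + ‖W‖ ^ 2)) + s * (g * t)) := by
      rw [hinner]; ring
    rw [e3, hs2]
    linarith
  · have e2 := abs_sub_abs_le_abs_sub G I
    linarith

/-! ### The test function and the Caccioppoli estimate -/

section GradientEstimate

variable {n : ℕ}
  {M : Type*} [MetricSpace M] [ChartedSpace (EuclideanSpace ℝ (Fin n)) M]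
  [IsManifold (𝓡 n) ∞ M] [RiemannianBundle (fun x : M => TangentSpace (𝓡 n) x)]
  [IsContMDiffRiemannianBundle (𝓡 n) 1 (EuclideanSpace ℝ (Fin n))
      (fun x : M => TangentSpace (𝓡 n) x)]
  [MeasurableSpace M] [BorelSpace M]
  {M' : Type*} [MetricSpace M'] [ChartedSpace (EuclideanSpace ℝ (Fin n)) M']
  [IsManifold (𝓡 n) ∞ M'] [RiemannianBundle (fun x : M' => TangentSpace (𝓡 n) x)]
  [IsContMDiffRiemannianBundle (𝓡 n) 1 (EuclideanSpace ℝ (Fin n))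
      (fun x : M' => TangentSpace (𝓡 n) x)]
  [MeasurableSpace M'] [BorelSpace M']

theorem manifoldGrad_eq_zero {χ : M → ℝ} {x : M} (h : χ =ᶠ[𝓝 x] fun _ => 0) :
    manifoldGrad (n := n) χ x = 0 := by
  refine ext_inner_right ℝ fun v => ?_
  rw [inner_manifoldGrad, h.mfderiv_eq, mfderiv_const, inner_zero_left]
  rfl

/-- The estimate ‖∇ψ‖² = dψ(∇ψ) ≤ B C ‖∇ψ‖ in a compact part of a chart, where `B` bounds the
coordinate differential, gives a local bound without discussing continuity of the gradient field. -/
theorem exists_norm_manifoldGrad_le {ψ : M → ℝ} (hψ : ContMDiff (𝓡 n) 𝓘(ℝ, ℝ) ∞ ψ) {K : Set M}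
    (hK : IsCompact K) : ∃ c ≥ 0, ∀ x ∈ K, ‖manifoldGrad (n := n) ψ x‖ ≤ c := by
  have h : ∀ᶠ c : ℝ in atTop, ∀ x ∈ K, ‖manifoldGrad (n := n) ψ x‖ ≤ c := by
    refine hK.eventually_forall_of_nhds fun x₀ _ => ?_
    set e := chartAt (EuclideanSpace ℝ (Fin n)) x₀
    have he : e ∈ IsManifold.maximalAtlas (𝓡 n) ∞ M := IsManifold.chart_mem_maximalAtlas x₀
    have hx₀ : x₀ ∈ e.source := mem_chart_source _ x₀
    obtain ⟨S, hS, hSe, hSc⟩ := local_compact_nhds (e.open_target.mem_nhds (e.map_source hx₀))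
    obtain ⟨C, hC, hCb⟩ := exists_norm_le_norm_chartVec he hSc hSe
    obtain ⟨B, hB⟩ := hSc.exists_bound_of_continuousOn
      (((contDiffOn_comp_chart_symm hψ he).continuousOn_fderiv_of_isOpen e.open_target
        (by simp)).mono hSe)
    refine ⟨e.source ∩ e ⁻¹' S, inter_mem (e.open_source.mem_nhds hx₀)
      ((e.continuousAt hx₀).preimage_mem_nhds hS), ?_⟩
    filter_upwards [eventually_ge_atTop (B * C)] with c hc x hx
    obtain ⟨y, hy, rfl⟩ : ∃ y ∈ S, e.symm y = x := ⟨e x, hx.2, e.left_inv hx.1⟩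
    refine le_trans ?_ hc
    obtain ⟨a, ha⟩ := exists_chartVec_eq he (hSe hy) (manifoldGrad ψ (e.symm y))
    rcases eq_or_ne (manifoldGrad (n := n) ψ (e.symm y)) 0 with h0 | h0
    · rw [h0, norm_zero]
      have := (norm_nonneg _).trans (hB y hy)
      positivity
    have hpos : 0 < ‖manifoldGrad (n := n) ψ (e.symm y)‖ := norm_pos_iff.2 h0
    have h1 : ‖manifoldGrad (n := n) ψ (e.symm y)‖ ^ 2 =
        fderiv ℝ (fun y => ψ (e.symm y)) y a := by
      rw [← chartPairing_manifoldGrad hψ he (hSe hy), chartPairing, ha,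
        real_inner_self_eq_norm_sq]
    have h2 : fderiv ℝ (fun y => ψ (e.symm y)) y a ≤ B * (C * ‖manifoldGrad (n := n) ψ (e.symm y)‖) := by
      refine (le_abs_self _).trans ?_
      rw [← Real.norm_eq_abs]
      refine (ContinuousLinearMap.le_opNorm _ _).trans ?_
      have h3 := hCb y hy a
      rw [ha] at h3
      have := (norm_nonneg _).trans (hB y hy)
      gcongr
      exact hB y hy
    rw [← h1] at h2
    nlinarith
  obtain ⟨c, hc, hc0⟩ := (h.and (eventually_ge_atTop 0)).exists
  exact ⟨c, hc0, hc⟩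

/-- Pushing forward a cutoff function by a local diffeomorphism. -/
theorem contMDiff_indicator_comp_symm {Φ : OpenPartialHomeomorph M M'} (hΦ : Φ.IsSmooth n)
    {ξ : M → ℝ} (hξ : ContMDiff (𝓡 n) 𝓘(ℝ, ℝ) ∞ ξ) (hc : HasCompactSupport ξ)
    (hs : tsupport ξ ⊆ Φ.source) :
    ContMDiff (𝓡 n) 𝓘(ℝ, ℝ) ∞ (Φ.target.indicator fun q => ξ (Φ.symm q)) ∧
    tsupport (Φ.target.indicator fun q => ξ (Φ.symm q)) ⊆ Φ '' tsupport ξ := by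
  -- The image of the compact support is closed in the whole of `M'`, not merely in `Φ.target`; this
  -- is what makes the extension by zero smooth.
  have h1 : tsupport (Φ.target.indicator fun q => ξ (Φ.symm q)) ⊆ Φ '' tsupport ξ := by
    refine closure_minimal ?_
      (IsCompact.image_of_continuousOn hc (Φ.continuousOn.mono hs)).isClosed
    intro q hq
    have hqt : q ∈ Φ.target := by
      by_contra h
      exact hq (Set.indicator_of_notMem h _)
    rw [Function.mem_support, Set.indicator_of_mem hqt] at hq
    exact ⟨Φ.symm q, subset_tsupport _ hq, Φ.right_inv hqt⟩
  refine ⟨contMDiff_of_tsupport fun q hq => ?_, h1⟩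
  obtain ⟨x, hx, rfl⟩ := h1 hq
  have hqt := Φ.map_source (hs hx)
  have h2 : ContMDiffAt (𝓡 n) 𝓘(ℝ, ℝ) ∞ (ξ ∘ Φ.symm) (Φ x) :=
    hξ.contMDiffAt.comp _ ((hΦ.contMDiffOn_symm _ hqt).contMDiffAt (Φ.open_target.mem_nhds hqt))
  refine h2.congr_of_eventuallyEq ?_
  filter_upwards [Φ.open_target.mem_nhds hqt] with z hz
  rw [Set.indicator_of_mem hz]
  rfl

theorem HasWeakGradientOn.mono {O O' : Set M} (hO : O' ⊆ O) {f : M → ℝ}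
    {X : ∀ x : M, TangentSpace (𝓡 n) x} (h : HasWeakGradientOn O f X) :
    HasWeakGradientOn O' f X :=
  ⟨fun e he heO => h.1 e he (heO.trans hO), fun e he heO => h.2 e he (heO.trans hO),
    fun e he heO => h.3 e he (heO.trans hO)⟩

theorem enorm_sq_eq_ofReal {E : Type*} [SeminormedAddCommGroup E] (v : E) :
    ‖v‖ₑ ^ 2 = ENNReal.ofReal (‖v‖ ^ 2) := by
  rw [ENNReal.ofReal_pow (norm_nonneg _), ofReal_norm]

theorem IsMeasurableFieldOn.integrableOn_norm_sq {O : Set M} (hO : IsOpen O)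
    {X : ∀ x : M, TangentSpace (𝓡 n) x} (hX : IsMeasurableFieldOn O X)
    {K : Set M} (hK : IsCompact K) (hKO : K ⊆ O)
    (h : ∫⁻ x in K, ‖X x‖ₑ ^ 2 ∂riemannianVolume n M < ⊤) :
    IntegrableOn (fun x => ‖X x‖ ^ 2) K (riemannianVolume n M) := by
  refine ⟨(hX.aestronglyMeasurable_norm hO hK hKO).pow 2, ?_⟩
  rw [hasFiniteIntegral_iff_enorm]
  refine lt_of_le_of_lt (lintegral_mono fun x => ?_) h
  rw [enorm_sq_eq_ofReal, Real.enorm_of_nonneg (sq_nonneg _)]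

theorem IsCloseOn.integrableOn_norm_pullbackGrad_sq {δ : ℝ} {Φ : OpenPartialHomeomorph M M'}
    {L : Set M} (h : IsCloseOn n δ Φ L) (hL : IsCompact L) (hδ : δ ≤ 1 / 4)
    {X : ∀ x : M', TangentSpace (𝓡 n) x} (hX : IsMeasurableField X)
    (hfin : ∫⁻ q in Φ '' L, ‖X q‖ₑ ^ 2 ∂riemannianVolume n M' < ⊤) :
    IntegrableOn (fun x => ‖pullbackGrad Φ X x‖ ^ 2) L (riemannianVolume n M) := by
  refine (isMeasurableFieldOn_pullbackGrad h.isSmooth hX).integrableOn_norm_sq Φ.open_source hL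
    h.subset ?_
  calc ∫⁻ x in L, ‖pullbackGrad Φ X x‖ₑ ^ 2 ∂riemannianVolume n M
      ≤ ∫⁻ x in L, 2 * ‖X (Φ x)‖ₑ ^ 2 ∂riemannianVolume n M := by
        refine setLIntegral_mono' hL.measurableSet fun x hx => ?_
        rw [enorm_sq_eq_ofReal, enorm_sq_eq_ofReal]
        refine (ENNReal.ofReal_le_ofReal (h.norm_pullbackGrad_sq_le hδ hx X)).trans_eq ?_
        rw [ENNReal.ofReal_mul zero_le_two]
        simp
    _ = 2 * ∫⁻ x in L, ‖X (Φ x)‖ₑ ^ 2 ∂riemannianVolume n M :=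
        lintegral_const_mul' _ _ (by simp)
    _ ≤ 2 * (2 * ∫⁻ q in Φ '' L, ‖X q‖ₑ ^ 2 ∂riemannianVolume n M') := by
        gcongr
        exact h.setLIntegral_le hL hδ fun q => ‖X q‖ₑ ^ 2
    _ < ⊤ := ENNReal.mul_lt_top (by simp) (ENNReal.mul_lt_top (by simp) hfin)

end GradientEstimate

theorem integral_neg_sub_add_const_mul {α : Type*} [MeasurableSpace α] {μ : Measure α}
    {a b d : α → ℝ} (ha : Integrable a μ) (hb : Integrable b μ) (hd : Integrable d μ) (k : ℝ) :
    ∫ x, -(a x) - b x + k * (a x + d x) ∂μ =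
      -(∫ x, a x ∂μ) - ∫ x, b x ∂μ + k * (∫ x, a x ∂μ + ∫ x, d x ∂μ) := by
  rw [integral_add (f := fun x => -(a x) - b x) (g := fun x => k * (a x + d x)) (ha.neg.sub hb)
    ((ha.add hd).const_mul k), integral_const_mul, integral_add ha hd,
    integral_sub (f := fun x => -(a x)) ha.neg hb, integral_neg]

section GradientEstimate

variable {n : ℕ}
  {M : Type*} [MetricSpace M] [ChartedSpace (EuclideanSpace ℝ (Fin n)) M]
  [IsManifold (𝓡 n) ∞ M] [RiemannianBundle (fun x : M => TangentSpace (𝓡 n) x)]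
  [IsContMDiffRiemannianBundle (𝓡 n) 1 (EuclideanSpace ℝ (Fin n))
      (fun x : M => TangentSpace (𝓡 n) x)]
  [MeasurableSpace M] [BorelSpace M]
  {M' : Type*} [MetricSpace M'] [ChartedSpace (EuclideanSpace ℝ (Fin n)) M']
  [IsManifold (𝓡 n) ∞ M'] [RiemannianBundle (fun x : M' => TangentSpace (𝓡 n) x)]
  [IsContMDiffRiemannianBundle (𝓡 n) 1 (EuclideanSpace ℝ (Fin n))
      (fun x : M' => TangentSpace (𝓡 n) x)]
  [MeasurableSpace M'] [BorelSpace M']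

theorem MemW12Loc.integrableOn_norm_sq {f : M → ℝ} {X : ∀ x : M, TangentSpace (𝓡 n) x}
    (h : MemW12Loc f X) {K : Set M} (hK : IsCompact K) :
    IntegrableOn (fun x => ‖X x‖ ^ 2) K (riemannianVolume n M) :=
  (h.hasWeakGradient.isMeasurableField.on Set.univ).integrableOn_norm_sq isOpen_univ hK
    (Set.subset_univ K) (h.lintegral_grad_lt_top K hK)

theorem IsMeasurableFieldOn.integrableOn_inner {O : Set M} (hO : IsOpen O)
    {X Y : ∀ x : M, TangentSpace (𝓡 n) x} (hX : IsMeasurableFieldOn O X)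
    (hY : IsMeasurableFieldOn O Y) {K : Set M} (hK : IsCompact K) (hKO : K ⊆ O)
    (hX2 : IntegrableOn (fun x => ‖X x‖ ^ 2) K (riemannianVolume n M))
    (hY2 : IntegrableOn (fun x => ‖Y x‖ ^ 2) K (riemannianVolume n M)) :
    IntegrableOn (fun x => (inner ℝ (X x) (Y x) : ℝ)) K (riemannianVolume n M) := by
  refine (hX2.add hY2).mono' (hX.aestronglyMeasurable_inner hO hY hK hKO)
    (Eventually.of_forall fun x => (abs_real_inner_le_norm _ _).trans ?_)
  simp only [Pi.add_apply]
  nlinarith [sq_nonneg (‖X x‖ - ‖Y x‖), sq_nonneg ‖X x‖, sq_nonneg ‖Y x‖]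

variable {δ : ℝ} {Φ : OpenPartialHomeomorph M M'} {L : Set M}
  {f' : M' → ℝ} {X' : ∀ x : M', TangentSpace (𝓡 n) x}
  {f : M → ℝ} {F : ∀ x : M, TangentSpace (𝓡 n) x}

theorem IsCloseOn.integrableOn_norm_pullbackGrad_sub_sq (h : IsCloseOn n δ Φ L)
    (hL : IsCompact L) (hδ : δ ≤ 1 / 4) (hf' : MemW12Loc f' X') (hf : MemW12Loc f F) :
    IntegrableOn (fun x => ‖pullbackGrad Φ X' x - F x‖ ^ 2) L (riemannianVolume n M) := by
  have h1 := h.integrableOn_norm_pullbackGrad_sq hL hδ hf'.hasWeakGradient.isMeasurableField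
    (hf'.lintegral_grad_lt_top _ (h.isCompact_image hL))
  have h2 := hf.integrableOn_norm_sq hL
  have hm := (((isMeasurableFieldOn_pullbackGrad h.isSmooth
    hf'.hasWeakGradient.isMeasurableField).sub
      (hf.hasWeakGradient.isMeasurableField.on Φ.source)).aestronglyMeasurable_norm
        Φ.open_source hL h.subset).pow 2
  refine ((h1.const_mul 2).add (h2.const_mul 2)).mono' hm (Eventually.of_forall fun x => ?_)
  rw [Real.norm_of_nonneg (sq_nonneg _)]
  have h3 := norm_sub_le (pullbackGrad Φ X' x) (F x)
  calc _ ≤ (‖pullbackGrad Φ X' x‖ + ‖F x‖) ^ 2 := by gcongr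
    _ ≤ 2 * ‖pullbackGrad Φ X' x‖ ^ 2 + 2 * ‖F x‖ ^ 2 := by
      linarith [sq_nonneg (‖pullbackGrad Φ X' x‖ - ‖F x‖)]

/-- The test function `ψ² (ε - s (f' - f))`, transplanted to `M'`. -/
theorem IsCloseOn.exists_testFunction (h : IsCloseOn n δ Φ L) (hL : IsCompact L)
    (hδ0 : 0 ≤ δ) (hδ : δ ≤ 1 / 4) (hf' : MemW12Loc f' X') (hf : MemW12Loc f F)
    {ψ : M → ℝ} (hψ : ContMDiff (𝓡 n) 𝓘(ℝ, ℝ) ∞ ψ) (hψ0 : ∀ x, 0 ≤ ψ x) (hψ1 : ∀ x, ψ x ≤ 1)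
    (hψc : HasCompactSupport ψ) {V : Set M} (hV : IsOpen V) (hψV : tsupport ψ ⊆ V) (hVL : V ⊆ L)
    {c : ℝ} (hc : 0 ≤ c) (hψg : ∀ x ∈ L, ‖manifoldGrad (n := n) ψ x‖ ≤ c)
    {ε : ℝ} (hε0 : 0 ≤ ε) (hε1 : ε ≤ 1)
    (hε : ∀ᵐ x ∂(riemannianVolume n M).restrict L, |f' (Φ x) - f x| ≤ ε)
    {s : ℝ} (hs : s = 1 ∨ s = -1) :
    ∃ (φ : M' → ℝ) (Y : ∀ x : M', TangentSpace (𝓡 n) x), MemW12Loc φ Y ∧ (∀ x, 0 ≤ φ x) ∧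
      (∀ x, φ x ≤ 2 * ε) ∧ tsupport φ ⊆ Φ '' L ∧ (∀ q ∉ Φ '' L, Y q = 0) ∧
      ∀ x ∈ L, ∃ (g : ℝ) (ζ : TangentSpace (𝓡 n) x), 0 ≤ g ∧ g ≤ 2 * ε ∧ ‖ζ‖ ≤ 2 * ψ x * c ∧
        pullbackGrad Φ Y x = ψ x ^ 2 • ((-s) • pullbackGrad Φ X' x + s • F x) + g • ζ := by
  have hξ : ContMDiff (𝓡 n) 𝓘(ℝ, ℝ) ∞ fun x => ψ x ^ 2 := hψ.pow 2
  have hξs : tsupport (fun x => ψ x ^ 2) ⊆ tsupport ψ := by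
    refine closure_mono fun x hx => ?_
    contrapose! hx
    simp only [Function.mem_support, not_not] at hx ⊢
    simp [hx]
  have hVs : V ⊆ Φ.source := hVL.trans h.subset
  have hξV := hξs.trans hψV
  obtain ⟨hχ, hχs⟩ := contMDiff_indicator_comp_symm h.isSmooth hξ
    (hψc.of_isClosed_subset (isClosed_tsupport _) hξs) (hξV.trans hVs)
  set χ : M' → ℝ := Φ.target.indicator fun q => ψ (Φ.symm q) ^ 2 with hχdef
  have hχ0 : ∀ q, 0 ≤ χ q := fun q => Set.indicator_nonneg (fun _ _ => sq_nonneg _) q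
  have hχ1 : ∀ q, χ q ≤ 1 := fun q =>
    Set.indicator_apply_le' (fun _ => pow_le_one₀ (hψ0 _) (hψ1 _)) (fun _ => zero_le_one)
  have hχΦ : ∀ x ∈ Φ.source, χ (Φ x) = ψ x ^ 2 := fun x hx => by
    rw [hχdef, Set.indicator_of_mem (Φ.map_source hx), Φ.left_inv hx]
  -- The bound by `ε` holds only almost everywhere on `L`, whereas test functions must be
  -- nonnegative everywhere. Truncating to [0, 2 ε] gives global bounds and changes nothing almost
  -- everywhere on the image of `L`, so the weak gradient there is the same.
  set g : M' → ℝ := fun q => max 0 (min (2 * ε) (ε + ((-s) * f' q + s * f (Φ.symm q)))) with hg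
  have hg0 : ∀ q, 0 ≤ g q := fun q => le_max_left _ _
  have hg1 : ∀ q, g q ≤ 2 * ε := fun q => max_le (by linarith) (min_le_left _ _)
  -- The open set `V` between the support of `ψ` and the compact set `L` provides the open domain
  -- required for weak gradients.
  set O : Set M' := Φ '' V with hOdef
  have hO : IsOpen O := Φ.isOpen_image_of_subset_source hV hVs
  have hOt : O ⊆ Φ.target := by
    rintro _ ⟨x, hx, rfl⟩
    exact Φ.map_source (hVs hx)
  have hOL : O ⊆ Φ '' L := Set.image_mono hVL
  set Xg : ∀ x : M', TangentSpace (𝓡 n) x :=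
    fun q => (-s) • X' q + s • pullbackGrad Φ.symm F q with hXg
  have hgO : HasWeakGradientOn O g Xg := by
    have h1 : HasWeakGradientOn O (fun q => f (Φ.symm q)) (pullbackGrad Φ.symm F) :=
      (HasWeakGradientOn.pullback h.isSmooth.symm (hf.hasWeakGradient.on _)).mono hOt
    refine ((hf'.hasWeakGradient.on O).const_add_smul_add_smul h1 ε (-s) s).congr_ae ?_
    have h2 : ∀ᵐ x ∂(riemannianVolume n M).restrict L,
        |f' (Φ x) - f (Φ.symm (Φ x))| ≤ ε := by
      filter_upwards [hε, ae_restrict_mem hL.measurableSet] with x hx hxL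
      rwa [Φ.left_inv (h.subset hxL)]
    have h3 := ae_restrict_of_ae_restrict_of_subset hOL
      (h.ae_image hL (P := fun q => |f' q - f (Φ.symm q)| ≤ ε) h2)
    filter_upwards [h3] with q hq
    have h4 := abs_le.1 hq
    have h5 : 0 ≤ ε + ((-s) * f' q + s * f (Φ.symm q)) ∧
        ε + ((-s) * f' q + s * f (Φ.symm q)) ≤ 2 * ε := by
      rcases hs with rfl | rfl <;> constructor <;> linarith
    simp only [hg]
    rw [min_eq_right h5.2, max_eq_right h5.1]
  have hχO : tsupport χ ⊆ O := hχs.trans (Set.image_mono hξV)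
  have hφY := hgO.cutoff_mul hO hχ hχO
  set φ : M' → ℝ := fun q => χ q * g q with hφ
  set Y : ∀ x : M', TangentSpace (𝓡 n) x := fun q => χ q • Xg q + g q • manifoldGrad χ q with hY
  have hφ1 : ∀ q, φ q ≤ 2 * ε := fun q => by
    calc χ q * g q ≤ 1 * (2 * ε) := mul_le_mul (hχ1 q) (hg1 q) (hg0 q) zero_le_one
      _ = 2 * ε := one_mul _
  have hφ0 : ∀ q, 0 ≤ φ q := fun q => mul_nonneg (hχ0 q) (hg0 q)
  have hY0 : ∀ q ∉ Φ '' L, Y q = 0 := fun q hq => by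
    have h1 : χ =ᶠ[𝓝 q] fun _ => 0 :=
      notMem_tsupport_iff_eventuallyEq.1 fun h' => hq (hOL (hχO h'))
    simp only [hY]
    rw [manifoldGrad_eq_zero h1, h1.eq_of_nhds, zero_smul, smul_zero, add_zero]
  have hpG : ∀ x ∈ L, ∃ (g : ℝ) (ζ : TangentSpace (𝓡 n) x), 0 ≤ g ∧ g ≤ 2 * ε ∧
      ‖ζ‖ ≤ 2 * ψ x * c ∧
      pullbackGrad Φ Y x = ψ x ^ 2 • ((-s) • pullbackGrad Φ X' x + s • F x) + g • ζ := by
    intro x hx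
    have hxs := h.subset hx
    refine ⟨g (Φ x), manifoldGrad (fun z => ψ z ^ 2) x, hg0 _, hg1 _,
      norm_manifoldGrad_sq_le (hψ.mdifferentiableAt (by simp)) (hψg x hx) (hψ0 x), ?_⟩
    rw [hY, pullbackGrad_smul_add_smul, hχΦ x hxs, hXg,
      pullbackGrad_smul_add_smul Φ X' (pullbackGrad Φ.symm F) (fun _ => -s) (fun _ => s),
      pullbackGrad_pullbackGrad_symm h.isSmooth F hxs,
      pullbackGrad_manifoldGrad h.isSmooth hxs (hχ.mdifferentiableAt (by simp))]
    filter_upwards [Φ.open_source.mem_nhds hxs] with z hz using (hχΦ z hz).symm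
  refine ⟨φ, Y, ⟨hφY, fun K hK => ?_, fun K hK => ?_⟩, hφ0, hφ1, ?_, hY0, hpG⟩
  · have : IsFiniteMeasure ((riemannianVolume n M').restrict K) :=
      ⟨by rw [Measure.restrict_apply_univ]; exact riemannianVolume_lt_top hK⟩
    refine MemLp.of_bound ((hφY.on Set.univ).aestronglyMeasurable isOpen_univ hK
      (Set.subset_univ K)) (2 * ε) (Eventually.of_forall fun q => ?_)
    rw [Real.norm_of_nonneg (hφ0 q)]
    exact hφ1 q
  · have hm := (h.isCompact_image hL).measurableSet
    calc ∫⁻ q in K, ‖Y q‖ₑ ^ 2 ∂riemannianVolume n M'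
        ≤ ∫⁻ q, ‖Y q‖ₑ ^ 2 ∂riemannianVolume n M' := setLIntegral_le_lintegral _ _
      _ = ∫⁻ q in Φ '' L, ‖Y q‖ₑ ^ 2 ∂riemannianVolume n M' := by
          rw [← lintegral_indicator hm]
          congr 1
          ext q
          by_cases hq : q ∈ Φ '' L
          · rw [Set.indicator_of_mem hq]
          · rw [Set.indicator_of_notMem hq, hY0 q hq]
            simp
      _ ≤ 2 * ∫⁻ x in L, ‖Y (Φ x)‖ₑ ^ 2 ∂riemannianVolume n M :=
          h.setLIntegral_image_le hL hδ fun q => ‖Y q‖ₑ ^ 2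
      _ ≤ 2 * ∫⁻ x in L, ENNReal.ofReal (2 * (2 * ‖pullbackGrad Φ X' x - F x‖ ^ 2 + 32 * c ^ 2))
            ∂riemannianVolume n M := by
          gcongr 2 * ?_
          refine setLIntegral_mono' hL.measurableSet fun x hx => ?_
          rw [enorm_sq_eq_ofReal]
          refine ENNReal.ofReal_le_ofReal ((h.norm_sq_le hδ hx Y).trans ?_)
          obtain ⟨g, ζ, hg0, hg1, hζ, hYx⟩ := hpG x hx
          have h2 := h.abs_inner_sub_le hδ hx X' Y
          rw [hYx] at h2 ⊢
          have := (pointwise_gradient_estimate hs (hψ0 x) (hψ1 x) hc hζ hg0 hg1 hε1 hδ0 hδ h2).2.2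
          linarith
      _ < ⊤ := by
          refine ENNReal.mul_lt_top (by simp) (Integrable.lintegral_lt_top ?_)
          refine (((h.integrableOn_norm_pullbackGrad_sub_sq hL hδ hf' hf).const_mul 2).add
            (integrableOn_const (riemannianVolume_lt_top hL).ne)).const_mul 2
  · refine (closure_mono ?_).trans (hχO.trans hOL)
    exact Function.support_mul_subset_left _ _

/-- A Caccioppoli type estimate for `f' ∘ Φ - f`. -/
theorem IsCloseOn.gradient_estimate (h : IsCloseOn n δ Φ L) (hL : IsCompact L)
    (hδ0 : 0 ≤ δ) (hδ : δ ≤ 1 / 4) (hf' : MemW12Loc f' X') (hf : MemW12Loc f F)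
    {ψ : M → ℝ} (hψ : ContMDiff (𝓡 n) 𝓘(ℝ, ℝ) ∞ ψ) (hψ0 : ∀ x, 0 ≤ ψ x) (hψ1 : ∀ x, ψ x ≤ 1)
    (hψc : HasCompactSupport ψ) {V : Set M} (hV : IsOpen V) (hψV : tsupport ψ ⊆ V) (hVL : V ⊆ L)
    {c : ℝ} (hc : 0 ≤ c) (hψg : ∀ x ∈ L, ‖manifoldGrad (n := n) ψ x‖ ≤ c)
    {ε : ℝ} (hε0 : 0 ≤ ε) (hε1 : ε ≤ 1)
    (hε : ∀ᵐ x ∂(riemannianVolume n M).restrict L, |f' (Φ x) - f x| ≤ ε)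
    {s : ℝ} (hs : s = 1 ∨ s = -1) {C : ℝ} (hC : 0 ≤ C)
    (H : ∀ (φ : M' → ℝ) (Y : ∀ x : M', TangentSpace (𝓡 n) x), MemW12Loc φ Y → (∀ x, 0 ≤ φ x) →
      tsupport φ ⊆ Φ '' L → s * ∫ x, inner ℝ (X' x) (Y x) ∂(riemannianVolume n M') ≥
        - C * ∫ x, φ x ∂(riemannianVolume n M')) :
    ∫ x in L, ψ x ^ 2 * ‖pullbackGrad Φ X' x - F x‖ ^ 2 ∂(riemannianVolume n M) ≤
      -(∫ x in L, ψ x ^ 2 * inner ℝ (F x) (pullbackGrad Φ X' x - F x) ∂(riemannianVolume n M)) +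
      (16 * δ + 4 * ε) *
        (∫ x in L, ψ x ^ 2 * ‖pullbackGrad Φ X' x - F x‖ ^ 2 ∂(riemannianVolume n M) +
          ∫ x in L, (ψ x ^ 2 * ‖F x‖ ^ 2 + c ^ 2) ∂(riemannianVolume n M)) +
      4 * C * ε * (riemannianVolume n M L).toReal := by
  obtain ⟨φ, Y, hφY, hφ0, hφ1, hφs, hY0, hpG⟩ := h.exists_testFunction hL hδ0 hδ hf' hf hψ hψ0
    hψ1 hψc hV hψV hVL hc hψg hε0 hε1 hε hs
  have hest : ∀ x ∈ L, s * inner ℝ (X' (Φ x)) (Y (Φ x)) ≤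
      -(ψ x ^ 2 * ‖pullbackGrad Φ X' x - F x‖ ^ 2) -
        ψ x ^ 2 * inner ℝ (F x) (pullbackGrad Φ X' x - F x) +
        (8 * δ + 4 * ε) * (ψ x ^ 2 * ‖pullbackGrad Φ X' x - F x‖ ^ 2 +
          (ψ x ^ 2 * ‖F x‖ ^ 2 + c ^ 2)) ∧
      |(inner ℝ (X' (Φ x)) (Y (Φ x)) : ℝ)| ≤ 8 * (ψ x ^ 2 * ‖pullbackGrad Φ X' x - F x‖ ^ 2 +
        (ψ x ^ 2 * ‖F x‖ ^ 2 + c ^ 2)) := by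
    intro x hx
    obtain ⟨g, ζ, hg0, hg1, hζ, hYx⟩ := hpG x hx
    have h2 := h.abs_inner_sub_le hδ hx X' Y
    rw [hYx] at h2
    have h3 := pointwise_gradient_estimate hs (hψ0 x) (hψ1 x) hc hζ hg0 hg1 hε1 hδ0 hδ h2
    exact ⟨h3.1, h3.2.1⟩
  have hH := H φ Y hφY hφ0 hφs
  have hfin : IsFiniteMeasure ((riemannianVolume n M).restrict L) :=
    ⟨by rw [Measure.restrict_apply_univ]; exact riemannianVolume_lt_top hL⟩
  have hK := h.isCompact_image hL
  have hψm : AEStronglyMeasurable (fun x => ψ x ^ 2) ((riemannianVolume n M).restrict L) :=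
    (hψ.continuous.pow 2).aestronglyMeasurable
  have hψb : ∀ᵐ x ∂(riemannianVolume n M).restrict L, ‖ψ x ^ 2‖ ≤ 1 :=
    Eventually.of_forall fun x => by
      rw [Real.norm_of_nonneg (sq_nonneg _)]
      exact pow_le_one₀ (hψ0 x) (hψ1 x)
  have hW := h.integrableOn_norm_pullbackGrad_sub_sq hL hδ hf' hf
  have hF := hf.integrableOn_norm_sq hL
  have i1 : Integrable (fun x => ψ x ^ 2 * ‖pullbackGrad Φ X' x - F x‖ ^ 2)
      ((riemannianVolume n M).restrict L) := hW.bdd_mul hψm hψb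
  have i2 : Integrable (fun x => ψ x ^ 2 * ‖F x‖ ^ 2 + c ^ 2)
      ((riemannianVolume n M).restrict L) := (hF.bdd_mul hψm hψb).add (integrable_const _)
  have i3 : Integrable (fun x => ψ x ^ 2 * inner ℝ (F x) (pullbackGrad Φ X' x - F x))
      ((riemannianVolume n M).restrict L) := by
    have hFm := hf.hasWeakGradient.isMeasurableField.on Φ.source
    exact (hFm.integrableOn_inner Φ.open_source ((isMeasurableFieldOn_pullbackGrad h.isSmooth
      hf'.hasWeakGradient.isMeasurableField).sub hFm) hL h.subset hF hW).bdd_mul hψm hψb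
  have i4 : IntegrableOn (fun x => (inner ℝ (X' (Φ x)) (Y (Φ x)) : ℝ)) L
      (riemannianVolume n M) := by
    have hm := h.aestronglyMeasurable_comp hL hδ
      ((hf'.hasWeakGradient.isMeasurableField.on Set.univ).aestronglyMeasurable_inner isOpen_univ
        (hφY.hasWeakGradient.isMeasurableField.on Set.univ) hK (Set.subset_univ _))
    refine ((i1.add i2).const_mul 8).mono' hm ?_
    filter_upwards [ae_restrict_mem hL.measurableSet] with x hx
    exact (hest x hx).2
  have i5 : IntegrableOn (fun x => φ (Φ x)) L (riemannianVolume n M) := by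
    have hm := h.aestronglyMeasurable_comp hL hδ
      ((hφY.hasWeakGradient.on Set.univ).aestronglyMeasurable isOpen_univ hK (Set.subset_univ _))
    refine (integrable_const (2 * ε)).mono' hm (Eventually.of_forall fun x => ?_)
    rw [Real.norm_of_nonneg (hφ0 _)]
    exact hφ1 _
  have t1 := h.abs_integral_sub_le hL.measurableSet hδ0 hδ
    (G := fun q => inner ℝ (X' q) (Y q)) (fun q hq => by
      by_contra hq'
      rw [Function.mem_support, hY0 q hq', inner_zero_right] at hq
      exact hq rfl) i4
  have t2 := h.abs_integral_sub_le hL.measurableSet hδ0 hδ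
    (G := φ) ((subset_tsupport φ).trans hφs) i5
  have b1 : ∫ x in L, |(inner ℝ (X' (Φ x)) (Y (Φ x)) : ℝ)| ∂riemannianVolume n M ≤
      8 * (∫ x in L, ψ x ^ 2 * ‖pullbackGrad Φ X' x - F x‖ ^ 2 ∂(riemannianVolume n M) +
          ∫ x in L, (ψ x ^ 2 * ‖F x‖ ^ 2 + c ^ 2) ∂(riemannianVolume n M)) := by
    rw [← integral_add i1 i2, ← integral_const_mul]
    refine setIntegral_mono_on i4.abs ((i1.add i2).const_mul 8) hL.measurableSet
      fun x hx => (hest x hx).2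
  have b2 : s * ∫ x in L, inner ℝ (X' (Φ x)) (Y (Φ x)) ∂riemannianVolume n M ≤
      -(∫ x in L, ψ x ^ 2 * ‖pullbackGrad Φ X' x - F x‖ ^ 2 ∂(riemannianVolume n M)) -
      ∫ x in L, ψ x ^ 2 * inner ℝ (F x) (pullbackGrad Φ X' x - F x) ∂(riemannianVolume n M) +
      (8 * δ + 4 * ε) *
        (∫ x in L, ψ x ^ 2 * ‖pullbackGrad Φ X' x - F x‖ ^ 2 ∂(riemannianVolume n M) +
          ∫ x in L, (ψ x ^ 2 * ‖F x‖ ^ 2 + c ^ 2) ∂(riemannianVolume n M)) := by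
    have i6 := ((i1.neg.sub i3).add ((i1.add i2).const_mul (8 * δ + 4 * ε)))
    calc s * ∫ x in L, inner ℝ (X' (Φ x)) (Y (Φ x)) ∂riemannianVolume n M
        = ∫ x in L, s * inner ℝ (X' (Φ x)) (Y (Φ x)) ∂riemannianVolume n M :=
          (integral_const_mul _ _).symm
      _ ≤ _ := setIntegral_mono_on (i4.const_mul s) i6 hL.measurableSet
          fun x hx => (hest x hx).1
      _ = _ := integral_neg_sub_add_const_mul i1 i3 i2 _
  have b3 : ∫ x in L, φ (Φ x) ∂riemannianVolume n M ≤ 2 * ε * (riemannianVolume n M L).toReal := by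
    have := setIntegral_mono_on i5 (integrable_const (2 * ε)) hL.measurableSet
      fun x _ => hφ1 (Φ x)
    rw [integral_const, smul_eq_mul, measureReal_restrict_apply_univ, mul_comm] at this
    exact this
  have b4 : ∫ x in L, |φ (Φ x)| ∂riemannianVolume n M = ∫ x in L, φ (Φ x) ∂riemannianVolume n M := by
    simp only [abs_of_nonneg (hφ0 _)]
  have b5 : 0 ≤ ∫ x in L, φ (Φ x) ∂riemannianVolume n M := integral_nonneg fun x => hφ0 _
  rw [b4] at t2
  generalize ∫ q, φ q ∂riemannianVolume n M' = Iφ at *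
  generalize ∫ x in L, φ (Φ x) ∂riemannianVolume n M = Jφ at *
  generalize ∫ q, inner ℝ (X' q) (Y q) ∂riemannianVolume n M' = I at *
  generalize ∫ x in L, inner ℝ (X' (Φ x)) (Y (Φ x)) ∂riemannianVolume n M = J at *
  generalize ∫ x in L, |(inner ℝ (X' (Φ x)) (Y (Φ x)) : ℝ)| ∂riemannianVolume n M = Ja at *
  generalize ∫ x in L, ψ x ^ 2 * ‖pullbackGrad Φ X' x - F x‖ ^ 2 ∂(riemannianVolume n M) = Z at *
  generalize ∫ x in L, (ψ x ^ 2 * ‖F x‖ ^ 2 + c ^ 2) ∂(riemannianVolume n M) = B at *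
  generalize (riemannianVolume n M L).toReal = m at *
  -- Replacing the volume of `M'` by that of `M` costs another 8 δ. With the 8 δ of the metric error
  -- this explains the coefficient 16 δ.
  have e1 : s * I - s * J ≤ δ * (8 * (Z + B)) := by
    have e2 : s * (I - J) ≤ |I - J| := by
      refine (le_abs_self _).trans ?_
      rw [abs_mul]
      rcases hs with rfl | rfl <;> simp
    calc s * I - s * J = s * (I - J) := by ring
      _ ≤ δ * Ja := e2.trans t1
      _ ≤ _ := by gcongr
  -- From φ ≤ 2 ε and a volume factor of at most 5/4, rounded up.
  have e3 : Iφ ≤ 4 * ε * m := by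
    have := (abs_le.1 t2).2
    have e4 : δ * Jφ ≤ 1 / 4 * Jφ := by gcongr
    linarith
  have e5 : C * Iφ ≤ C * (4 * ε * m) := by gcongr
  linarith

end GradientEstimate

theorem ae_abs_le_toReal_eLpNorm_top {α : Type*} [MeasurableSpace α] {μ : Measure α} {g : α → ℝ}
    (h : eLpNorm g ⊤ μ ≠ ⊤) : ∀ᵐ x ∂μ, |g x| ≤ (eLpNorm g ⊤ μ).toReal := by
  filter_upwards [ae_le_eLpNormEssSup (f := g) (μ := μ)] with x hx
  rw [← eLpNorm_exponent_top, ← ENNReal.ofReal_toReal h, ← ofReal_norm,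
    ENNReal.ofReal_le_ofReal_iff ENNReal.toReal_nonneg] at hx
  exact hx

section SmoothMultiple

variable {n : ℕ}
  {M : Type*} [MetricSpace M] [ChartedSpace (EuclideanSpace ℝ (Fin n)) M]
  [IsManifold (𝓡 n) ∞ M] [RiemannianBundle (fun x : M => TangentSpace (𝓡 n) x)]

theorem IsMeasurableField.continuous_smul {X : ∀ x : M, TangentSpace (𝓡 n) x}
    (hX : IsMeasurableField X) {g : M → ℝ} (hg : Continuous g) :
    IsMeasurableField fun x => g x • X x := by
  intro e he v
  have h1 : ContinuousOn (fun y => g (e.symm y)) e.target :=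
    hg.comp_continuousOn e.continuousOn_symm
  refine ((h1.aestronglyMeasurable e.open_target.measurableSet).mul (hX e he v)).congr
    (Eventually.of_forall fun y => ?_)
  simp only [chartPairing, Pi.mul_apply, inner_smul_left, RCLike.conj_to_real]

end SmoothMultiple

/-! ### Strong convergence of the gradients -/

section StrongConvergence

variable {n : ℕ}
  {M : Type*} [MetricSpace M] [ChartedSpace (EuclideanSpace ℝ (Fin n)) M]
  [IsManifold (𝓡 n) ∞ M] [RiemannianBundle (fun x : M => TangentSpace (𝓡 n) x)]
  [IsContMDiffRiemannianBundle (𝓡 n) 1 (EuclideanSpace ℝ (Fin n))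
      (fun x : M => TangentSpace (𝓡 n) x)]
  [MeasurableSpace M] [BorelSpace M]
  {N : ℕ → Type*} [∀ k, MetricSpace (N k)]
  [∀ k, ChartedSpace (EuclideanSpace ℝ (Fin n)) (N k)] [∀ k, IsManifold (𝓡 n) ∞ (N k)]
  [∀ k, RiemannianBundle (fun x : N k => TangentSpace (𝓡 n) x)]
  [∀ k, MeasurableSpace (N k)] [∀ k, BorelSpace (N k)]
  [∀ k, IsContMDiffRiemannianBundle (𝓡 n) 1 (EuclideanSpace ℝ (Fin n))
      (fun x : N k => TangentSpace (𝓡 n) x)]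
  {p : M} {pk : ∀ k, N k} {Φ : ∀ k, OpenPartialHomeomorph M (N k)}
  {fk : ∀ k, N k → ℝ} {gradfk : ∀ k, ∀ x : N k, TangentSpace (𝓡 n) x}
  {f : M → ℝ} {gradf : ∀ x : M, TangentSpace (𝓡 n) x}

theorem TendstoLinftyLoc.tendsto_lintegral_sq (hconv : TendstoLinftyLoc n Φ fk f) {K : Set M}
    (hK : IsCompact K) :
    Tendsto (fun k => ∫⁻ x in K, ‖fk k (Φ k x) - f x‖ₑ ^ 2 ∂(riemannianVolume n M)) atTop
      (𝓝 0) := by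
  have hm := riemannianVolume_lt_top (n := n) hK
  have h1 : Tendsto (fun k => (eLpNorm (fun x => fk k (Φ k x) - f x) ⊤
      ((riemannianVolume n M).restrict K)) ^ 2 * riemannianVolume n M K) atTop (𝓝 0) := by
    have := ENNReal.Tendsto.mul_const ((ENNReal.continuous_pow 2).tendsto 0 |>.comp (hconv K hK))
      (b := riemannianVolume n M K) (Or.inr hm.ne)
    simpa using this
  refine tendsto_of_tendsto_of_tendsto_of_le_of_le tendsto_const_nhds h1 (fun _ => zero_le)
    fun k => ?_
  calc ∫⁻ x in K, ‖fk k (Φ k x) - f x‖ₑ ^ 2 ∂(riemannianVolume n M)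
      ≤ ∫⁻ _ in K, (eLpNorm (fun x => fk k (Φ k x) - f x) ⊤
        ((riemannianVolume n M).restrict K)) ^ 2 ∂(riemannianVolume n M) := by
        refine lintegral_mono_ae ?_
        filter_upwards [ae_le_eLpNormEssSup (f := fun x => fk k (Φ k x) - f x)
          (μ := (riemannianVolume n M).restrict K)] with x hx
        rw [← eLpNorm_exponent_top] at hx
        gcongr
    _ = _ := by rw [lintegral_const, Measure.restrict_apply_univ]

/-- Weak convergence tested with the field ψ² ∇f. Closeness of the maps enters only to know that the
integrals may be split. -/
theorem TendstoWeaklyW12Loc.tendsto_integral_cutoff_inner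
    (hΦ : PointedC1Convergence (n := n) Φ p pk)
    (hfk : ∀ k, MemW12Loc (fk k) (gradfk k)) (hf : MemW12Loc f gradf)
    (hweak : TendstoWeaklyW12Loc Φ fk gradfk f gradf)
    {ψ : M → ℝ} (hψ : Continuous ψ) (hψ0 : ∀ x, 0 ≤ ψ x) (hψ1 : ∀ x, ψ x ≤ 1)
    {L : Set M} (hL : IsCompact L) :
    Tendsto (fun k => ∫ x in L, ψ x ^ 2 * inner ℝ (gradf x)
      (pullbackGrad (Φ k) (gradfk k) x - gradf x) ∂(riemannianVolume n M)) atTop (𝓝 0) := by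
  have hm : IsMeasurableField fun x => ψ x ^ 2 • gradf x :=
    hf.hasWeakGradient.isMeasurableField.continuous_smul (hψ.pow 2)
  have hle : ∀ x, ‖ψ x ^ 2 • gradf x‖ₑ ^ 2 ≤ ‖gradf x‖ₑ ^ 2 := fun x => by
    rw [enorm_sq_eq_ofReal, enorm_sq_eq_ofReal, norm_smul, Real.norm_of_nonneg (sq_nonneg _)]
    refine ENNReal.ofReal_le_ofReal ?_
    have : ψ x ^ 2 ≤ 1 := pow_le_one₀ (hψ0 x) (hψ1 x)
    calc (ψ x ^ 2 * ‖gradf x‖) ^ 2 ≤ (1 * ‖gradf x‖) ^ 2 := by gcongr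
      _ = _ := by rw [one_mul]
  have hfin : ∫⁻ x in L, ‖ψ x ^ 2 • gradf x‖ₑ ^ 2 ∂(riemannianVolume n M) < ⊤ :=
    (lintegral_mono hle).trans_lt (hf.lintegral_grad_lt_top L hL)
  have h1 := (hweak.tendsto_grad L hL _ hm hfin).sub_const
    (∫ x in L, inner ℝ (gradf x) (ψ x ^ 2 • gradf x) ∂(riemannianVolume n M))
  rw [sub_self] at h1
  refine h1.congr' ?_
  filter_upwards [hΦ.eventually_isCloseOn hL (δ := 1 / 4) (by norm_num) (by norm_num)] with k hk
  have hU := hk.integrableOn_norm_pullbackGrad_sq hL le_rfl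
    (hfk k).hasWeakGradient.isMeasurableField
    ((hfk k).lintegral_grad_lt_top _ (hk.isCompact_image hL))
  have hY := (hm.on (Φ k).source).integrableOn_norm_sq (Φ k).open_source hL hk.subset hfin
  have hF := hf.integrableOn_norm_sq hL
  have i1 := (isMeasurableFieldOn_pullbackGrad hk.isSmooth
    (hfk k).hasWeakGradient.isMeasurableField).integrableOn_inner (Φ k).open_source
      (hm.on (Φ k).source) hL hk.subset hU hY
  have i2 := (hf.hasWeakGradient.isMeasurableField.on (Φ k).source).integrableOn_inner
    (Φ k).open_source (hm.on (Φ k).source) hL hk.subset hF hY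
  rw [← integral_sub i1 i2]
  refine integral_congr_ae (Eventually.of_forall fun x => ?_)
  simp only [inner_smul_right, inner_sub_right]
  rw [real_inner_comm (gradf x) (pullbackGrad (Φ k) (gradfk k) x)]
  ring

/-- The parameter δ is chosen first, with 16 δ ≤ 1/4 and 16 δ B ≤ θ/8. For large k also 4 ε ≤ 1/4,
so half of `Z k` moves to the left and `Z k` is below θ. Since `Z k` is finite for each k, no
uniform bound is needed. -/
theorem tendsto_zero_of_absorbed_bound {Z a ε : ℕ → ℝ} {B C : ℝ} (hB : 0 ≤ B)
    (hZ : ∀ k, 0 ≤ Z k) (ha : Tendsto a atTop (𝓝 0)) (hε : Tendsto ε atTop (𝓝 0))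
    (h : ∀ δ > 0, δ ≤ 1 / 4 → ∀ᶠ k in atTop,
      Z k ≤ -a k + (16 * δ + 4 * ε k) * (Z k + B) + C * ε k) :
    Tendsto Z atTop (𝓝 0) := by
  rw [Metric.tendsto_nhds]
  intro θ hθ
  set δ := min (1 / 64) (θ / (128 * (B + 1))) with hδ
  have hδ0 : 0 < δ := by positivity
  have hδ1 : δ ≤ 1 / 64 := min_le_left _ _
  have hδB : 16 * δ * B ≤ θ / 8 := by
    have h1 : δ * (128 * (B + 1)) ≤ θ := by
      rw [← le_div_iff₀ (by positivity)]
      exact min_le_right _ _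
    nlinarith
  have h2 : Tendsto (fun k => -a k + ε k * (4 * B + C)) atTop (𝓝 0) := by
    simpa using ha.neg.add (hε.mul_const (4 * B + C))
  filter_upwards [h δ hδ0 (by linarith), h2.eventually_lt_const (show 0 < θ / 8 by positivity),
    hε.eventually_lt_const (show (0 : ℝ) < 1 / 16 by norm_num)] with k hk h3 h4
  rw [Real.dist_eq, sub_zero, abs_of_nonneg (hZ k)]
  have h5 : (16 * δ + 4 * ε k) * Z k ≤ 1 / 2 * Z k := by
    have := hZ k
    gcongr
    linarith
  linarith

variable [IsRiemannianManifold (𝓡 n) M] [∀ k, IsRiemannianManifold (𝓡 n) (N k)] [ProperSpace M]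

/-- The sign `s` treats both kinds of Laplacian bounds at once. The constants `c` and `C` are fixed
independently of k and δ, as the absorption argument requires. -/
theorem PointedC1Convergence.tendsto_integral_cutoff_norm_sq
    (hΦ : PointedC1Convergence (n := n) Φ p pk)
    (hfk : ∀ k, MemW12Loc (fk k) (gradfk k)) (hf : MemW12Loc f gradf)
    (hconv : TendstoLinftyLoc n Φ fk f) (hweak : TendstoWeaklyW12Loc Φ fk gradfk f gradf)
    {s : ℝ} (hs : s = 1 ∨ s = -1)
    (hΔ : ∀ A > 0, ∃ C > 0, ∀ k, ∀ (φ : N k → ℝ) (Y : ∀ x : N k, TangentSpace (𝓡 n) x),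
      MemW12Loc φ Y → (∀ x, 0 ≤ φ x) → tsupport φ ⊆ Metric.ball (pk k) A →
      s * ∫ x, inner ℝ (gradfk k x) (Y x) ∂(riemannianVolume n (N k)) ≥
        - C * ∫ x, φ x ∂(riemannianVolume n (N k)))
    {ψ : M → ℝ} (hψ : ContMDiff (𝓡 n) 𝓘(ℝ, ℝ) ∞ ψ) (hψ0 : ∀ x, 0 ≤ ψ x) (hψ1 : ∀ x, ψ x ≤ 1)
    {R : ℝ} (hR : 0 < R) (hψR : tsupport ψ ⊆ Metric.ball p R) :
    Tendsto (fun k => ∫ x in Metric.closedBall p R,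
      ψ x ^ 2 * ‖pullbackGrad (Φ k) (gradfk k) x - gradf x‖ ^ 2 ∂(riemannianVolume n M)) atTop
      (𝓝 0) := by
  have hL := isCompact_closedBall p R
  have hψc : HasCompactSupport ψ := hL.of_isClosed_subset (isClosed_tsupport _)
    (hψR.trans Metric.ball_subset_closedBall)
  obtain ⟨c, hc, hψg⟩ := exists_norm_manifoldGrad_le hψ hL
  -- This radius is the one for which the image of the ball of radius `R`, hence the support of the
  -- test function, lies in the ball about `pk k`, given closeness on radius `R + 1`.
  obtain ⟨C, hC, hCk⟩ := hΔ (2 * (R + 1) + 1) (by linarith)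
  have hε0 := hconv _ hL
  refine tendsto_zero_of_absorbed_bound
    (ε := fun k => (eLpNorm (fun x => fk k (Φ k x) - f x) ⊤
      ((riemannianVolume n M).restrict (Metric.closedBall p R))).toReal)
    (B := ∫ x in Metric.closedBall p R, (ψ x ^ 2 * ‖gradf x‖ ^ 2 + c ^ 2) ∂(riemannianVolume n M))
    (C := 4 * C * (riemannianVolume n M (Metric.closedBall p R)).toReal)
    (integral_nonneg fun x => by positivity) (fun k => integral_nonneg fun x => by positivity)
    (hweak.tendsto_integral_cutoff_inner hΦ hfk hf hψ.continuous hψ0 hψ1 hL)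
    ((ENNReal.tendsto_toReal ENNReal.zero_ne_top).comp hε0) fun δ hδ0 hδ => ?_
  filter_upwards [hΦ.eventually_isCloseOn hL hδ0 (by linarith),
    hΦ.eventually_isCloseOn (isCompact_closedBall p (R + 1)) hδ0 (by linarith),
    hε0.eventually_lt_const zero_lt_one] with k h1 h2 h3
  have h4 := h2.image_closedBall_subset (R := R) (by linarith) (by linarith) hδ
  rw [hΦ.map_base k] at h4
  have h5 := h1.gradient_estimate hL hδ0.le hδ (hfk k) hf hψ hψ0 hψ1 hψc Metric.isOpen_ball hψR
    Metric.ball_subset_closedBall hc hψg ENNReal.toReal_nonneg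
    (ENNReal.toReal_le_of_le_ofReal zero_le_one (by simpa using h3.le))
    (ae_abs_le_toReal_eLpNorm_top (h3.trans ENNReal.one_lt_top).ne) hs hC.le
    fun φ Y hφ h0 hφs => hCk k φ Y hφ h0 (hφs.trans h4)
  refine h5.trans_eq ?_
  ring

theorem PointedC1Convergence.tendsto_lintegral_grad_sub
    (hΦ : PointedC1Convergence (n := n) Φ p pk)
    (hfk : ∀ k, MemW12Loc (fk k) (gradfk k)) (hf : MemW12Loc f gradf)
    (hconv : TendstoLinftyLoc n Φ fk f) (hweak : TendstoWeaklyW12Loc Φ fk gradfk f gradf)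
    {s : ℝ} (hs : s = 1 ∨ s = -1)
    (hΔ : ∀ A > 0, ∃ C > 0, ∀ k, ∀ (φ : N k → ℝ) (Y : ∀ x : N k, TangentSpace (𝓡 n) x),
      MemW12Loc φ Y → (∀ x, 0 ≤ φ x) → tsupport φ ⊆ Metric.ball (pk k) A →
      s * ∫ x, inner ℝ (gradfk k x) (Y x) ∂(riemannianVolume n (N k)) ≥
        - C * ∫ x, φ x ∂(riemannianVolume n (N k)))
    {K : Set M} (hK : IsCompact K) :
    Tendsto (fun k => ∫⁻ x in K, ‖pullbackGrad (Φ k) (gradfk k) x - gradf x‖ₑ ^ 2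
      ∂(riemannianVolume n M)) atTop (𝓝 0) := by
  obtain ⟨r, hr0, hr⟩ := hK.isBounded.subset_closedBall_lt 0 p
  -- The cutoff is 1 on a ball containing `K` and vanishes outside radius `r + 1`. Its closed
  -- support then fits into the open ball of radius `r + 2`.
  obtain ⟨ψ, hψs, hψt, hψ01⟩ := exists_contMDiffMap_zero_one_of_isClosed (n := (⊤ : ℕ∞)) (𝓡 n)
    (s := (Metric.ball p (r + 1))ᶜ) (t := Metric.closedBall p r)
    Metric.isOpen_ball.isClosed_compl Metric.isClosed_closedBall
    (Set.disjoint_compl_left_iff_subset.2 (Metric.closedBall_subset_ball (by linarith)))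
  have hψR : tsupport ψ ⊆ Metric.ball p (r + 2) := by
    refine (closure_minimal (fun x hx => ?_) Metric.isClosed_closedBall).trans
      (Metric.closedBall_subset_ball (show r + 1 < r + 2 by linarith))
    by_contra h
    exact hx (hψs fun h' => h (Metric.ball_subset_closedBall h'))
  have hL := isCompact_closedBall p (r + 2)
  have h1 := ENNReal.tendsto_ofReal (hΦ.tendsto_integral_cutoff_norm_sq hfk hf hconv hweak hs hΔ
    ψ.contMDiff (fun x => (hψ01 x).1) (fun x => (hψ01 x).2) (R := r + 2) (by linarith) hψR)
  rw [ENNReal.ofReal_zero] at h1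
  refine tendsto_of_tendsto_of_tendsto_of_le_of_le' tendsto_const_nhds h1
    (Eventually.of_forall fun _ => zero_le) ?_
  filter_upwards [hΦ.eventually_isCloseOn hL (δ := 1 / 4) (by norm_num) (by norm_num)] with k hk
  have hint : IntegrableOn (fun x => ψ x ^ 2 *
      ‖pullbackGrad (Φ k) (gradfk k) x - gradf x‖ ^ 2) (Metric.closedBall p (r + 2))
      (riemannianVolume n M) := by
    refine (hk.integrableOn_norm_pullbackGrad_sub_sq hL le_rfl (hfk k) hf).bdd_mul (c := 1)
      (ψ.contMDiff.continuous.pow 2).aestronglyMeasurable (Eventually.of_forall fun x => ?_)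
    rw [Real.norm_of_nonneg (sq_nonneg _)]
    exact pow_le_one₀ (hψ01 x).1 (hψ01 x).2
  rw [ofReal_integral_eq_lintegral_ofReal hint (Eventually.of_forall fun x => by positivity)]
  calc _ = ∫⁻ x in K, ENNReal.ofReal (ψ x ^ 2 *
        ‖pullbackGrad (Φ k) (gradfk k) x - gradf x‖ ^ 2) ∂(riemannianVolume n M) := by
        refine setLIntegral_congr_fun hK.measurableSet fun x hx => ?_
        rw [hψt (hr hx), enorm_sq_eq_ofReal]
        simp
    _ ≤ _ := lintegral_mono_set (hr.trans (Metric.closedBall_subset_closedBall (by linarith)))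

end StrongConvergence

/-! ### Convergence of weighted energies -/

theorem abs_norm_sq_sub_norm_sq_le {T : Type*} [SeminormedAddCommGroup T] (U F : T) {δ : ℝ}
    (hδ : 0 < δ) :
    |‖U‖ ^ 2 - ‖F‖ ^ 2| ≤ (1 + 1 / δ) * ‖U - F‖ ^ 2 + δ * ‖F‖ ^ 2 := by
  have h1 := abs_norm_sub_norm_le U F
  have h2 : ‖U‖ + ‖F‖ ≤ ‖U - F‖ + 2 * ‖F‖ := by linarith [(abs_le.1 h1).2]
  have h3 : |‖U‖ ^ 2 - ‖F‖ ^ 2| ≤ ‖U - F‖ * (‖U - F‖ + 2 * ‖F‖) := by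
    rw [show ‖U‖ ^ 2 - ‖F‖ ^ 2 = (‖U‖ - ‖F‖) * (‖U‖ + ‖F‖) by ring, abs_mul,
      abs_of_nonneg (show 0 ≤ ‖U‖ + ‖F‖ by positivity)]
    gcongr
  have h4 : 0 ≤ δ * (1 / δ * ‖U - F‖ - ‖F‖) ^ 2 := by positivity
  have h5 : δ * (1 / δ * ‖U - F‖ - ‖F‖) ^ 2 =
      1 / δ * ‖U - F‖ ^ 2 - 2 * (‖U - F‖ * ‖F‖) + δ * ‖F‖ ^ 2 := by
    field_simp
    ring
  linarith

/-- Here `X` is |∇f_k|² in its own metric, `U` the same for the pulled back gradient in the limit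
metric, `F` is |∇f|² and `W` the squared norm of the difference. The metric error 2 δ U is at most W
+ 4 δ F, which raises the coefficients 1 + 1/δ and δ to 2 + 1/δ and 5 δ. -/
theorem abs_mul_sub_mul_le {X U F W η' η b e δ : ℝ} (hδ : 0 < δ) (hδ1 : δ ≤ 1 / 4)
    (hF : 0 ≤ F) (hW : 0 ≤ W) (hXU : |X - U| ≤ 2 * δ * U) (hU2 : U ≤ 2 * W + 2 * F)
    (hUF : |U - F| ≤ (1 + 1 / δ) * W + δ * F) (hη : |η| ≤ b) (he : |η' - η| ≤ e) (he1 : e ≤ 1) :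
    |X * η' - F * η| ≤ (b + 1) * ((2 + 1 / δ) * W + 5 * δ * F) + e * F ∧
      |X * η'| ≤ (b + 1) * (4 * W + 4 * F) := by
  have hη' : |η'| ≤ b + 1 := by
    have := abs_sub_abs_le_abs_sub η' η
    linarith
  have hb : 0 ≤ b + 1 := (abs_nonneg _).trans hη'
  have hδU : δ * U ≤ δ * (2 * W + 2 * F) := by gcongr
  have hδW : δ * W ≤ 1 / 4 * W := by gcongr
  have hδF : δ * F ≤ 1 / 4 * F := by gcongr
  constructor
  · have h1 : |X - F| ≤ (2 + 1 / δ) * W + 5 * δ * F := by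
      have := abs_sub_le X U F
      linarith
    calc |X * η' - F * η| = |η' * (X - F) + (η' - η) * F| := by congr 1; ring
      _ ≤ |η'| * |X - F| + |η' - η| * F := by
        refine (abs_add_le _ _).trans_eq ?_
        rw [abs_mul, abs_mul, abs_of_nonneg hF]
      _ ≤ _ := by gcongr
  · have h1 : |X| ≤ 4 * W + 4 * F := by
      have h2 := abs_le.1 hXU
      have h3 := abs_le.1 hUF
      refine abs_le.2 ⟨?_, ?_⟩
      · have : 0 ≤ 2 * δ * U := (abs_nonneg _).trans hXU
        have hU0 : 0 ≤ U := by
          by_contra hneg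
          nlinarith
        nlinarith
      · nlinarith
    rw [abs_mul, mul_comm]
    gcongr

theorem integral_const_mul_add_add {α : Type*} [MeasurableSpace α] {μ : Measure α}
    {a d : α → ℝ} (ha : Integrable a μ) (hd : Integrable d μ) (k l m e : ℝ) :
    ∫ x, k * (l * a x + m * d x) + e * d x ∂μ =
      k * (l * (∫ x, a x ∂μ) + m * ∫ x, d x ∂μ) + e * ∫ x, d x ∂μ := by
  rw [integral_add (f := fun x => k * (l * a x + m * d x))
    (((ha.const_mul l).add (hd.const_mul m)).const_mul k) (hd.const_mul e),
    integral_const_mul, integral_const_mul, integral_add (ha.const_mul l) (hd.const_mul m),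
    integral_const_mul, integral_const_mul]

section GradientIntegral

variable {n : ℕ}
  {M : Type*} [MetricSpace M] [ChartedSpace (EuclideanSpace ℝ (Fin n)) M]
  [IsManifold (𝓡 n) ∞ M] [RiemannianBundle (fun x : M => TangentSpace (𝓡 n) x)]
  [IsContMDiffRiemannianBundle (𝓡 n) 1 (EuclideanSpace ℝ (Fin n))
      (fun x : M => TangentSpace (𝓡 n) x)]
  [MeasurableSpace M] [BorelSpace M]
  {M' : Type*} [MetricSpace M'] [ChartedSpace (EuclideanSpace ℝ (Fin n)) M']
  [IsManifold (𝓡 n) ∞ M'] [RiemannianBundle (fun x : M' => TangentSpace (𝓡 n) x)]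
  [IsContMDiffRiemannianBundle (𝓡 n) 1 (EuclideanSpace ℝ (Fin n))
      (fun x : M' => TangentSpace (𝓡 n) x)]
  [MeasurableSpace M'] [BorelSpace M']

/-- The pointwise comparison is integrated, and changing the volume adds at most (b + 1) times ∫ W +
4 δ ∫ F in the same notation; hence 3 + 1/δ and 9 δ. The large factor 1/δ multiplies only the part
that tends to 0 for fixed δ. -/
theorem IsCloseOn.abs_integral_norm_sq_mul_sub_le {δ : ℝ} {Φ : OpenPartialHomeomorph M M'}
    {L : Set M} {f' : M' → ℝ} {X' : ∀ x : M', TangentSpace (𝓡 n) x} {f : M → ℝ}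
    {F : ∀ x : M, TangentSpace (𝓡 n) x} (h : IsCloseOn n δ Φ L) (hL : IsCompact L)
    (hδ0 : 0 < δ) (hδ : δ ≤ 1 / 4) (hf' : MemW12Loc f' X') (hf : MemW12Loc f F)
    {η' : M' → ℝ} {η : M → ℝ} (hη'm : AEStronglyMeasurable η' (riemannianVolume n M'))
    (hηm : AEStronglyMeasurable η (riemannianVolume n M)) (hsupp : Function.support η' ⊆ Φ '' L)
    {b e : ℝ} (hb : ∀ᵐ x ∂(riemannianVolume n M).restrict L, |η x| ≤ b)
    (he : ∀ᵐ x ∂(riemannianVolume n M).restrict L, |η' (Φ x) - η x| ≤ e) (he1 : e ≤ 1) :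
    |∫ q, ‖X' q‖ ^ 2 * η' q ∂(riemannianVolume n M') -
        ∫ x in L, ‖F x‖ ^ 2 * η x ∂(riemannianVolume n M)| ≤
      (b + 1) * ((3 + 1 / δ) *
          (∫⁻ x in L, ‖pullbackGrad Φ X' x - F x‖ₑ ^ 2 ∂(riemannianVolume n M)).toReal +
        9 * δ * ∫ x in L, ‖F x‖ ^ 2 ∂(riemannianVolume n M)) +
      e * ∫ x in L, ‖F x‖ ^ 2 ∂(riemannianVolume n M) := by
  have hK := h.isCompact_image hL
  have hW := h.integrableOn_norm_pullbackGrad_sub_sq hL hδ hf' hf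
  have hF := hf.integrableOn_norm_sq hL
  have hw : (∫⁻ x in L, ‖pullbackGrad Φ X' x - F x‖ₑ ^ 2 ∂(riemannianVolume n M)).toReal =
      ∫ x in L, ‖pullbackGrad Φ X' x - F x‖ ^ 2 ∂(riemannianVolume n M) := by
    simp only [enorm_sq_eq_ofReal]
    rw [← ofReal_integral_eq_lintegral_ofReal hW (Eventually.of_forall fun x => sq_nonneg _),
      ENNReal.toReal_ofReal (integral_nonneg fun x => sq_nonneg _)]
  have hpt : ∀ᵐ x ∂(riemannianVolume n M).restrict L,
      |‖X' (Φ x)‖ ^ 2 * η' (Φ x) - ‖F x‖ ^ 2 * η x| ≤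
        (b + 1) * ((2 + 1 / δ) * ‖pullbackGrad Φ X' x - F x‖ ^ 2 + 5 * δ * ‖F x‖ ^ 2) +
          e * ‖F x‖ ^ 2 ∧
      |‖X' (Φ x)‖ ^ 2 * η' (Φ x)| ≤
        (b + 1) * (4 * ‖pullbackGrad Φ X' x - F x‖ ^ 2 + 4 * ‖F x‖ ^ 2) := by
    filter_upwards [hb, he, ae_restrict_mem hL.measurableSet] with x hbx hex hx
    refine abs_mul_sub_mul_le hδ0 hδ (sq_nonneg _) (sq_nonneg _) (h.abs_norm_sq_sub_le hδ hx X')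
      ?_ (abs_norm_sq_sub_norm_sq_le _ _ hδ0) hbx hex he1
    have h3 : ‖pullbackGrad Φ X' x‖ ≤ ‖pullbackGrad Φ X' x - F x‖ + ‖F x‖ := by
      simpa using norm_add_le (pullbackGrad Φ X' x - F x) (F x)
    calc _ ≤ (‖pullbackGrad Φ X' x - F x‖ + ‖F x‖) ^ 2 := by gcongr
      _ ≤ _ := by linarith [sq_nonneg (‖pullbackGrad Φ X' x - F x‖ - ‖F x‖)]
  have i1 : IntegrableOn (fun x => ‖X' (Φ x)‖ ^ 2 * η' (Φ x)) L (riemannianVolume n M) := by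
    have hm := h.aestronglyMeasurable_comp hL hδ (G := fun q => ‖X' q‖ ^ 2 * η' q)
      ((((hf'.hasWeakGradient.isMeasurableField.on Set.univ).aestronglyMeasurable_norm isOpen_univ
        hK (Set.subset_univ _)).pow 2).mul hη'm.restrict)
    refine (((hW.const_mul 4).add (hF.const_mul 4)).const_mul (b + 1)).mono' hm ?_
    filter_upwards [hpt] with x hx using hx.2
  have i2 : IntegrableOn (fun x => ‖F x‖ ^ 2 * η x) L (riemannianVolume n M) :=
    hF.mul_bdd (c := b) hηm.restrict hb
  have i3 := (((hW.const_mul (2 + 1 / δ)).add (hF.const_mul (5 * δ))).const_mul (b + 1)).add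
    (hF.const_mul e)
  have t1 := h.abs_integral_sub_le hL.measurableSet hδ0.le hδ
    (G := fun q => ‖X' q‖ ^ 2 * η' q)
    ((Function.support_mul_subset_right _ _).trans hsupp) i1
  have t2 : ∫ x in L, |‖X' (Φ x)‖ ^ 2 * η' (Φ x)| ∂(riemannianVolume n M) ≤ (b + 1) *
      (4 * (∫ x in L, ‖pullbackGrad Φ X' x - F x‖ ^ 2 ∂(riemannianVolume n M)) +
        4 * ∫ x in L, ‖F x‖ ^ 2 ∂(riemannianVolume n M)) := by
    rw [← integral_const_mul, ← integral_const_mul,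
      ← integral_add (hW.const_mul 4) (hF.const_mul 4), ← integral_const_mul]
    refine integral_mono_ae i1.abs (((hW.const_mul 4).add (hF.const_mul 4)).const_mul (b + 1)) ?_
    filter_upwards [hpt] with x hx using hx.2
  have t3 : |∫ x in L, ‖X' (Φ x)‖ ^ 2 * η' (Φ x) ∂(riemannianVolume n M) -
      ∫ x in L, ‖F x‖ ^ 2 * η x ∂(riemannianVolume n M)| ≤ (b + 1) *
      ((2 + 1 / δ) * (∫ x in L, ‖pullbackGrad Φ X' x - F x‖ ^ 2 ∂(riemannianVolume n M)) +
        5 * δ * ∫ x in L, ‖F x‖ ^ 2 ∂(riemannianVolume n M)) +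
      e * ∫ x in L, ‖F x‖ ^ 2 ∂(riemannianVolume n M) := by
    rw [← integral_const_mul_add_add hW hF, ← integral_sub i1 i2]
    refine (abs_integral_le_integral_abs).trans (integral_mono_ae (i1.sub i2).abs i3 ?_)
    filter_upwards [hpt] with x hx using hx.1
  rw [hw]
  have hW0 : 0 ≤ ∫ x in L, ‖pullbackGrad Φ X' x - F x‖ ^ 2 ∂(riemannianVolume n M) :=
    integral_nonneg fun x => sq_nonneg _
  -- If `L` is a null set, the bound by `b` is vacuous and `b + 1` may be negative, so this case is
  -- treated apart.
  have hb0 : (riemannianVolume n M).restrict L = 0 ∨ 0 ≤ b + 1 := by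
    rcases eq_or_ne ((riemannianVolume n M).restrict L) 0 with h0 | h0
    · exact Or.inl h0
    · have : (ae ((riemannianVolume n M).restrict L)).NeBot := ae_neBot.2 h0
      obtain ⟨x, hx⟩ := hb.exists
      exact Or.inr (by linarith [abs_nonneg (η x)])
  rcases hb0 with hb0 | hb0
  · simp only [hb0, integral_zero_measure, mul_zero, add_zero, sub_zero, abs_zero] at t1 t2 t3 ⊢
    simpa using t1
  have t4 : δ * ∫ x in L, |‖X' (Φ x)‖ ^ 2 * η' (Φ x)| ∂(riemannianVolume n M) ≤ (b + 1) *
      (∫ x in L, ‖pullbackGrad Φ X' x - F x‖ ^ 2 ∂(riemannianVolume n M) +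
        4 * δ * ∫ x in L, ‖F x‖ ^ 2 ∂(riemannianVolume n M)) := by
    calc _ ≤ δ * ((b + 1) * (4 * (∫ x in L, ‖pullbackGrad Φ X' x - F x‖ ^ 2
            ∂(riemannianVolume n M)) + 4 * ∫ x in L, ‖F x‖ ^ 2 ∂(riemannianVolume n M))) := by
          gcongr
      _ = (b + 1) * (δ * 4 * (∫ x in L, ‖pullbackGrad Φ X' x - F x‖ ^ 2
            ∂(riemannianVolume n M)) + 4 * δ * ∫ x in L, ‖F x‖ ^ 2 ∂(riemannianVolume n M)) := by
          ring
      _ ≤ (b + 1) * (1 * (∫ x in L, ‖pullbackGrad Φ X' x - F x‖ ^ 2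
            ∂(riemannianVolume n M)) + 4 * δ * ∫ x in L, ‖F x‖ ^ 2 ∂(riemannianVolume n M)) := by
          gcongr
          linarith
      _ = _ := by rw [one_mul]
  refine (abs_sub_le _ _ _).trans ((add_le_add (t1.trans t4) t3).trans_eq ?_)
  ring

end GradientIntegral

/-! ### Passage to the limit and conclusion -/

section Limit

variable {n : ℕ}
  {M : Type*} [MetricSpace M] [ChartedSpace (EuclideanSpace ℝ (Fin n)) M]
  [IsManifold (𝓡 n) ∞ M] [RiemannianBundle (fun x : M => TangentSpace (𝓡 n) x)]
  [IsContMDiffRiemannianBundle (𝓡 n) 1 (EuclideanSpace ℝ (Fin n))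
      (fun x : M => TangentSpace (𝓡 n) x)]
  [MeasurableSpace M] [BorelSpace M]
  {N : ℕ → Type*} [∀ k, MetricSpace (N k)]
  [∀ k, ChartedSpace (EuclideanSpace ℝ (Fin n)) (N k)] [∀ k, IsManifold (𝓡 n) ∞ (N k)]
  [∀ k, RiemannianBundle (fun x : N k => TangentSpace (𝓡 n) x)]
  [∀ k, MeasurableSpace (N k)] [∀ k, BorelSpace (N k)]
  [∀ k, IsContMDiffRiemannianBundle (𝓡 n) 1 (EuclideanSpace ℝ (Fin n))
      (fun x : N k => TangentSpace (𝓡 n) x)]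
  {p : M} {pk : ∀ k, N k} {Φ : ∀ k, OpenPartialHomeomorph M (N k)}

/-- A point outside `L` lies in the domain of Φ_k for all large k, and by injectivity its image is
outside the support of η_k. Outside one null set serving all k, |η| is then bounded there by sup
norms tending to 0. -/
theorem ae_eq_zero_of_tendsto_of_support_subset
    (hΦ : PointedC1Convergence (n := n) Φ p pk) {L : Set M}
    {ηk : ∀ k, N k → ℝ} {η : M → ℝ}
    (hsupp : ∀ᶠ k in atTop, L ⊆ (Φ k).source ∧ Function.support (ηk k) ⊆ Φ k '' L)
    (hη : Tendsto (fun k => eLpNorm (fun x => ηk k (Φ k x) - η x) ⊤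
        ((riemannianVolume n M).restrict (Φ k).source)) atTop (𝓝 0)) :
    ∀ᵐ x ∂riemannianVolume n M, x ∉ L → η x = 0 := by
  have h1 : ∀ᵐ x ∂riemannianVolume n M, ∀ k, x ∈ (Φ k).source →
      ‖ηk k (Φ k x) - η x‖ₑ ≤ eLpNorm (fun x => ηk k (Φ k x) - η x) ⊤
        ((riemannianVolume n M).restrict (Φ k).source) := by
    refine ae_all_iff.2 fun k => ?_
    rw [← ae_restrict_iff' (Φ k).open_source.measurableSet, eLpNorm_exponent_top]
    exact ae_le_eLpNormEssSup
  filter_upwards [h1] with x hx hxL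
  have h2 : ‖η x‖ₑ ≤ 0 := by
    refine ge_of_tendsto hη ?_
    filter_upwards [hsupp, hΦ.exhausts {x} isCompact_singleton] with k hk hxk
    have hxs := hxk (Set.mem_singleton x)
    have h3 : ηk k (Φ k x) = 0 := by
      by_contra h4
      obtain ⟨z, hz, hzx⟩ := hk.2 h4
      exact hxL ((Φ k).injOn (hk.1 hz) hxs hzx ▸ hz)
    have h5 := hx k hxs
    rwa [h3, zero_sub, enorm_neg] at h5
  simpa using h2

variable {fk : ∀ k, N k → ℝ} {gradfk : ∀ k, ∀ x : N k, TangentSpace (𝓡 n) x}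
  {f : M → ℝ} {gradf : ∀ x : M, TangentSpace (𝓡 n) x}
  [IsRiemannianManifold (𝓡 n) M] [∀ k, IsRiemannianManifold (𝓡 n) (N k)] [ProperSpace M]

theorem PointedC1Convergence.tendsto_integral_norm_sq_mul
    (hΦ : PointedC1Convergence (n := n) Φ p pk)
    (hfk : ∀ k, MemW12Loc (fk k) (gradfk k)) (hf : MemW12Loc f gradf)
    (hgrad : ∀ K : Set M, IsCompact K →
      Tendsto (fun k => ∫⁻ x in K, ‖pullbackGrad (Φ k) (gradfk k) x - gradf x‖ₑ ^ 2
        ∂(riemannianVolume n M)) atTop (𝓝 0))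
    {A : ℝ} {ηk : ∀ k, N k → ℝ} {η : M → ℝ}
    (hηkm : ∀ k, MemLp (ηk k) ⊤ (riemannianVolume n (N k)))
    (hηm : MemLp η ⊤ (riemannianVolume n M))
    (hsupp : ∀ k, Function.support (ηk k) ⊆ Metric.ball (pk k) A)
    (hη : Tendsto (fun k => eLpNorm (fun x => ηk k (Φ k x) - η x) ⊤
        ((riemannianVolume n M).restrict (Φ k).source)) atTop (𝓝 0)) :
    Tendsto (fun k => ∫ x, ‖gradfk k x‖ ^ 2 * ηk k x ∂(riemannianVolume n (N k))) atTop
      (𝓝 (∫ x, ‖gradf x‖ ^ 2 * η x ∂(riemannianVolume n M))) := by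
  -- This ball has an image containing the ball of radius `|A|` about `pk k`; the absolute value
  -- covers negative `A`.
  set L := Metric.closedBall p (2 * |A| + 1) with hLdef
  have hL : IsCompact L := isCompact_closedBall _ _
  have hsub : ∀ {δ : ℝ} {k : ℕ}, δ ≤ 1 / 4 → IsCloseOn n δ (Φ k) L →
      Function.support (ηk k) ⊆ Φ k '' L := fun {δ k} hδ hk => by
    have h1 := hk.ball_subset_image (abs_nonneg A) hδ
    rw [hΦ.map_base k] at h1
    exact ((hsupp k).trans (Metric.ball_subset_ball (le_abs_self A))).trans h1
  have hη0 : ∀ᵐ x ∂riemannianVolume n M, x ∉ L → η x = 0 := by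
    refine ae_eq_zero_of_tendsto_of_support_subset hΦ ?_ hη
    filter_upwards [hΦ.eventually_isCloseOn hL (δ := 1 / 4) (by norm_num) (by norm_num)] with k hk
    exact ⟨hk.subset, hsub le_rfl hk⟩
  rw [← setIntegral_eq_integral_of_ae_compl_eq_zero (s := L) (by
    filter_upwards [hη0] with x hx hxL
    rw [hx hxL, mul_zero])]
  set b := (eLpNorm η ⊤ (riemannianVolume n M)).toReal with hb
  set B := ∫ x in L, ‖gradf x‖ ^ 2 ∂(riemannianVolume n M) with hB
  have hB0 : 0 ≤ B := integral_nonneg fun x => sq_nonneg _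
  have hb0 : 0 ≤ b := ENNReal.toReal_nonneg
  have hbae : ∀ᵐ x ∂(riemannianVolume n M).restrict L, |η x| ≤ b :=
    ae_restrict_of_ae (ae_abs_le_toReal_eLpNorm_top hηm.eLpNorm_ne_top)
  have hw := (ENNReal.tendsto_toReal ENNReal.zero_ne_top).comp (hgrad L hL)
  have he := (ENNReal.tendsto_toReal ENNReal.zero_ne_top).comp hη
  rw [Metric.tendsto_nhds]
  intro θ hθ
  -- This makes the term with 9 δ at most θ/2. Only afterwards does k tend to infinity, when the
  -- term with 1/δ and the term with the weight error are together below θ/2.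
  set δ := min (1 / 4) (θ / (18 * ((b + 1) * (B + 1)))) with hδdef
  have hδ0 : 0 < δ := by positivity
  have hδ : δ ≤ 1 / 4 := min_le_left _ _
  have hδB : (b + 1) * (9 * δ * B) ≤ θ / 2 := by
    have h1 : δ * (18 * ((b + 1) * (B + 1))) ≤ θ := by
      rw [← le_div_iff₀ (by positivity)]
      exact min_le_right _ _
    have h2 : 0 ≤ δ * (b + 1) := by positivity
    linarith
  have hlim := (hw.const_mul ((b + 1) * (3 + 1 / δ))).add (he.mul_const B)
  simp only [ENNReal.toReal_zero, mul_zero, zero_mul, add_zero] at hlim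
  filter_upwards [hΦ.eventually_isCloseOn hL hδ0 (by linarith),
    hlim.eventually_lt_const (half_pos hθ), hη.eventually_lt_const zero_lt_one] with k hk h1 h2
  have h3 := hk.abs_integral_norm_sq_mul_sub_le hL hδ0 hδ (hfk k) hf (hηkm k).1 hηm.1
    (hsub hδ hk) hbae
    (ae_restrict_of_ae_restrict_of_subset hk.subset
      (ae_abs_le_toReal_eLpNorm_top (h2.trans ENNReal.one_lt_top).ne))
    (ENNReal.toReal_le_of_le_ofReal zero_le_one (by simpa using h2.le))
  rw [Real.dist_eq]
  refine h3.trans_lt ?_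
  simp only [Function.comp_apply] at h1
  rw [mul_add, ← mul_assoc]
  linarith

end Limit

theorem lemma2p4 {n : ℕ}
    -- the limit `(M, h, p)`: a pointed complete Riemannian manifold
    {M : Type*} [MetricSpace M] [CompleteSpace M] [MeasurableSpace M] [BorelSpace M]
    [ChartedSpace (EuclideanSpace ℝ (Fin n)) M] [IsManifold (𝓡 n) ∞ M]
    [RiemannianBundle (fun x : M => TangentSpace (𝓡 n) x)]
    [IsContMDiffRiemannianBundle (𝓡 n) 1 (EuclideanSpace ℝ (Fin n))
      (fun x : M => TangentSpace (𝓡 n) x)]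
    [IsRiemannianManifold (𝓡 n) M] (p : M)
    -- the sequence `(N k, h_k, p_k)` of pointed complete Riemannian manifolds
    {N : ℕ → Type*} [∀ k, MetricSpace (N k)] [∀ k, CompleteSpace (N k)]
    [∀ k, MeasurableSpace (N k)] [∀ k, BorelSpace (N k)]
    [∀ k, ChartedSpace (EuclideanSpace ℝ (Fin n)) (N k)] [∀ k, IsManifold (𝓡 n) ∞ (N k)]
    [∀ k, RiemannianBundle (fun x : N k => TangentSpace (𝓡 n) x)]
    [∀ k, IsContMDiffRiemannianBundle (𝓡 n) 1 (EuclideanSpace ℝ (Fin n))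
      (fun x : N k => TangentSpace (𝓡 n) x)]
    [∀ k, IsRiemannianManifold (𝓡 n) (N k)] (pk : ∀ k, N k)
    -- pointed `C¹` convergence
    (Φ : ∀ k, OpenPartialHomeomorph M (N k)) (hΦ : PointedC1Convergence (n := n) Φ p pk)
    -- the functions `f_k` and `f`, with their weak gradients
    (fk : ∀ k, N k → ℝ) (gradfk : ∀ k, ∀ x : N k, TangentSpace (𝓡 n) x)
    (hfk : ∀ k, MemW12Loc (fk k) (gradfk k)) (hfk' : ∀ k, MemLpLoc n ⊤ (fk k))
    (f : M → ℝ) (gradf : ∀ x : M, TangentSpace (𝓡 n) x)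
    (hf : MemW12Loc f gradf) (hf' : MemLpLoc n ⊤ f)
    (hconv : TendstoLinftyLoc n Φ fk f)
    (hweak : TendstoWeaklyW12Loc Φ fk gradfk f gradf)
    -- the Laplacians are locally uniformly bounded from above, or from below, in the weak sense
    (hΔ : (∀ A > 0, ∃ C > 0, ∀ k, WeakLaplacianLE (gradfk k) C (Metric.ball (pk k) A)) ∨
      (∀ A > 0, ∃ C > 0, ∀ k, WeakLaplacianGE (gradfk k) C (Metric.ball (pk k) A))) :
    TendstoStronglyW12Loc Φ fk gradfk f gradf ∧
    ∀ (A : ℝ) (ηk : ∀ k, N k → ℝ) (η : M → ℝ),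
      (∀ k, MemLp (ηk k) ⊤ (riemannianVolume n (N k))) → MemLp η ⊤ (riemannianVolume n M) →
      (∀ k, Function.support (ηk k) ⊆ Metric.ball (pk k) A) →
      Tendsto (fun k => eLpNorm (fun x => ηk k (Φ k x) - η x) ⊤
        ((riemannianVolume n M).restrict (Φ k).source)) atTop (𝓝 0) →
      Tendsto (fun k => ∫ x, ‖gradfk k x‖ ^ 2 * ηk k x ∂(riemannianVolume n (N k))) atTop
        (𝓝 (∫ x, ‖gradf x‖ ^ 2 * η x ∂(riemannianVolume n M))) := by
  have : ProperSpace M := properSpace_of_isRiemannianManifold n M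
  have hgrad : ∀ K : Set M, IsCompact K →
      Tendsto (fun k => ∫⁻ x in K, ‖pullbackGrad (Φ k) (gradfk k) x - gradf x‖ₑ ^ 2
        ∂(riemannianVolume n M)) atTop (𝓝 0) := by
    intro K hK
    -- An upper bound on the Laplacian is the case s = 1. A lower bound becomes the same inequality
    -- with s = -1 after changing signs.
    rcases hΔ with hΔ | hΔ
    · refine hΦ.tendsto_lintegral_grad_sub hfk hf hconv hweak (Or.inl rfl) (fun A hA => ?_) hK
      obtain ⟨C, hC, h⟩ := hΔ A hA
      refine ⟨C, hC, fun k φ Y hφ h0 hs => ?_⟩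
      rw [one_mul]
      exact h k φ Y hφ h0 hs
    · refine hΦ.tendsto_lintegral_grad_sub hfk hf hconv hweak (Or.inr rfl) (fun A hA => ?_) hK
      obtain ⟨C, hC, h⟩ := hΔ A hA
      refine ⟨C, hC, fun k φ Y hφ h0 hs => ?_⟩
      have := h k φ Y hφ h0 hs
      linarith
  exact ⟨⟨fun K hK => hconv.tendsto_lintegral_sq hK, hgrad⟩,
    fun A ηk η hηk hη hsupp hlim =>
      hΦ.tendsto_integral_norm_sq_mul hfk hf hgrad hηk hη hsupp hlim⟩
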